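/- **Theory.** Consider tree-level scalar QED with complex scalars $\phi_f$ ($f$ in a finite set of flavours, possibly just one) of unit charge, $\mathcal L=-\tfrac14F_{\mu\nu}F^{\mu\nu}+\sum_f|D\phi_f|^2$, $D_\mu=\partial_\mu-igA_\mu$. For $N$ even let $$\mathcal O=\frac1{(N/2)!}\,[\phi^*\phi]^{N/2},\qquad \phi^*\phi=\sum_f\phi_f^*\phi_f .$$ All operators are taken at $x=0$, all particles are outgoing and massless, and a matrix element $\langle X|\cdot|0\rangle$ is the sum of all tree diagrams; in particular, in the matrix element of a product of fields each connected component of a diagram is attached to exactly one field. **$N$-jet states.** Let $\langle X|=\langle X_1\cdots X_N;X_s|$ be a state of scalars, antiscalars and photons with a fixed particle content. Each $\langle X_j|$ ($j\le N$) carries the quantum numbers of a single scalar ($\sigma_j=+1$) or antiscalar ($\sigma_j=-1$) of flavour $f_j$, and for each flavour $f$ the number $m_f$ of jets with $(f_j,\sigma_j)=(f,1)$ equals the number with $(f_j,\sigma_j)=(f,-1)$. Let $P_j$ be the total momentum of $\langle X_j|$ and $n_j=(1,\vec P_j/|\vec P_j|)$. For a power-counting parameter $\lambda>0$ and a fixed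 constant $K>0$ assume (in units of the hard scale): * particles in the jets have energies in $[K^{-1},K]$; * distinct particles of one jet satisfy $p\cdot q\le K\lambda^2$, and $p\cdot q\ge K^{-1}\lambda^2$ unless both are photons; * $n_i\cdot n_j\ge K^{-1}$ for $i\ne j$; * soft particles have energies $\le K\lambda^2$ and satisfy $n_j\cdot k\ge K^{-1}\lambda^2$ for all $j$; distinct soft particles satisfy $k\cdot k'\ge K^{-1}\lambda^4$ unless both are photons. Each photon of momentum $q$ has a helicity polarization vector $\epsilon$ with an arbitrary real light-like reference vector $r$ linearly independent of $q$: $\epsilon^2=0$, $\epsilon^*\cdot\epsilon=-1$, $q\cdot\epsilon=r\cdot\epsilon=0$. **Wilson lines.** Let $t_j$ be any real light-like vectors with $t_j^0>0$ and $t_j\cdot n_j\ge K^{-1}t_j^0$, and put, with $\varepsilon\to0^+$, $$W_j=\exp\Big(-ig\int_0^\infty ds\,t_j\cdot A(s\,t_j)\,e^{-\varepsilon s}\Big),\qquad Y_j^\dagger=\exp\Big(ig\int_0^\infty ds\,n_j\cdot A(s\,n_j)\,e^{-\varepsilon s}\Big).$$ **Claim.** At leading power in $\lambda$, $$\langle X_1\cdots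 X_N;X_s|\mathcal O|0\rangle\;\cong\;\Big(\prod_f m_f!\Big)\;\prod_{j=1}^N\langle X_j|\,\mathcal O_j\,|0\rangle\;\;\langle X_s|\,Y_1^{(\dagger)}\cdots Y_N^{(\dagger)}\,|0\rangle ,$$ where $\mathcal O_j=\phi_{f_j}^*W_j$ if $\sigma_j=1$ and $\mathcal O_j=W_j^\dagger\phi_{f_j}$ if $\sigma_j=-1$, and $Y_j^{(\dagger)}$ is $Y_j^\dagger$ if $\sigma_j=1$ and $Y_j$ if $\sigma_j=-1$. The factor $\prod_fm_f!$ is the matrix element of $\mathcal O$ in the state with one parton in each jet; it is $1$ if no two jets are initiated by identical particles. Precisely: let $d$ be the number of particles in the jets minus $N$, plus twice the number of soft particles, so that $\lambda^{-d}$ is the leading power. There are constants $C$ and $\lambda_0>0$, depending only on $g$, $N$, $K$ and the particle content, such that for all $0<\lambda\le\lambda_0$ and all momenta, polarization vectors, reference vectors and $t_j$ as above, the difference of the two sides is at most $C\,\lambda^{1-d}$ in absolute value. -/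

import Mathlib

open scoped BigOperators Topology ComplexConjugate

noncomputable section

namespace ScalarQED

/-! ### Minkowski space, signature (+,-,-,-) -/

/-- The Minkowski product. It is bilinear (no complex conjugation) over `ℂ` as well. -/
def mdot {K : Type*} [CommRing K] (u v : Fin 4 → K) : K :=
  u 0 * v 0 - u 1 * v 1 - u 2 * v 2 - u 3 * v 3

/-- A real four-vector regarded as a complex one. -/
def toC (p : Fin 4 → ℝ) : Fin 4 → ℂ := fun μ => (p μ : ℂ)

/-- The Euclidean length of the spatial part. -/
def spatialNorm (p : Fin 4 → ℝ) : ℝ := Real.sqrt (p 1 ^ 2 + p 2 ^ 2 + p 3 ^ 2)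

/-- The light-like vector `(1, P⃗ / |P⃗|)`. -/
def lightDirection (P : Fin 4 → ℝ) : Fin 4 → ℝ :=
  fun μ => if μ = 0 then 1 else P μ / spatialNorm P

/-- `ε` is a helicity polarization vector of a photon of momentum `q` with (light-like, real)
reference vector `r`, linearly independent of `q`. -/
structure IsPolarization (q r : Fin 4 → ℝ) (ε : Fin 4 → ℂ) : Prop where
  ref_null : mdot r r = 0
  ref_indep : LinearIndependent ℝ ![q, r]
  null : mdot ε ε = 0
  normalized : mdot (fun μ => conj (ε μ)) ε = -1
  transverse : mdot (toC q) ε = 0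
  ref_orthogonal : mdot (toC r) ε = 0

/-! ### External states

The theory contains complex scalar fields `φ_f`, `f : F`, of equal (unit) charge, with Lagrangian
`-¼ F_{μν} F^{μν} + ∑_f |D φ_f|²`, `D = ∂ - i g A`.  -/

/-- The particles: `charged f 1` is the scalar of flavour `f`, `charged f (-1)` its antiparticle. -/
inductive Species (F : Type*) where
  | charged (f : F) (σ : ℤˣ) : Species F
  | photon : Species F

/-- An outgoing multi-particle state; particles are labelled by `ι`. The value of `pol` matters
only for photons. -/
structure OutState (ι F : Type*) where
  species : ι → Species F
  mom : ι → Fin 4 → ℝ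
  pol : ι → Fin 4 → ℂ

/-- The total momentum of a set of particles. -/
def totalMom {ι : Type*} (p : ι → Fin 4 → ℝ) (S : Finset ι) : Fin 4 → ℝ := ∑ i ∈ S, p i

/-! ### Tree diagrams

`charged f σ` is the sum of the tree diagrams of `⟨S| φ_f^* (0) |0⟩` (`σ = 1`) or
`⟨S| φ_f (0) |0⟩` (`σ = -1`), and `photon μ` that of `⟨S| A^μ (0) |0⟩`, for the state formed by a
set `S` of the external particles. The line leaving the operator is included with its propagator. -/

structure Currents (F : Type*) where
  charged : F → ℤˣ → ℂ
  photon : Fin 4 → ℂ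

/-- No diagram. -/
def Currents.zero {F : Type*} : Currents F := ⟨fun _ _ => 0, fun _ => 0⟩

/-- The external line of a particle. -/
def externalLine {ι F : Type*} [DecidableEq F] (X : OutState ι F) (i : ι) : Currents F :=
  match X.species i with
  | .charged f σ => ⟨fun f' σ' => if f' = f ∧ σ' = σ then 1 else 0, fun _ => 0⟩
  | .photon => ⟨fun _ _ => 0, fun μ => conj (X.pol i μ)⟩

/-- One application of the Feynman rules (Feynman gauge; all powers of `i` are collected).
A tree with external particles `S` is either an external line, or the line from the operator
carries the propagator `1 / P_S²` to a vertex (scalar–scalar–photon or scalar–scalar–photon–photon),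
whose other legs are trees `c` that share out the particles in `S`. The seagull vertex of a
scalar line has `2 g²` for an unordered pair of photon legs, that is `g²` for each ordered one. -/
def attachVertex {ι F : Type*} [DecidableEq ι] [DecidableEq F] [Fintype F]
    (g : ℝ) (X : OutState ι F) (c : Finset ι → Currents F) (S : Finset ι) :
    Currents F where
  charged f σ :=
    (∑ i ∈ S, if S = {i} then (externalLine X i).charged f σ else 0)
    - (((σ : ℤ) : ℂ) * g * ∑ A ∈ S.powerset,
          mdot (toC (totalMom X.mom A + 2 • totalMom X.mom (S \ A))) (c A).photon
            * (c (S \ A)).charged f σ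
        + (g : ℂ) ^ 2 * ∑ A ∈ S.powerset, ∑ B ∈ (S \ A).powerset,
          mdot (c A).photon (c B).photon * (c ((S \ A) \ B)).charged f σ)
      / ((mdot (totalMom X.mom S) (totalMom X.mom S) : ℝ) : ℂ)
  photon μ :=
    (∑ i ∈ S, if S = {i} then (externalLine X i).photon μ else 0)
    + ((g : ℂ) * ∑ f : F, ∑ A ∈ S.powerset,
          toC (totalMom X.mom A - totalMom X.mom (S \ A)) μ
            * (c A).charged f 1 * (c (S \ A)).charged f (-1)
        + 2 * (g : ℂ) ^ 2 * ∑ f : F, ∑ A ∈ S.powerset, ∑ B ∈ (S \ A).powerset,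
          (c ((S \ A) \ B)).photon μ * (c A).charged f 1 * (c B).charged f (-1))
      / ((mdot (totalMom X.mom S) (totalMom X.mom S) : ℝ) : ℂ)

/-- The sum of all tree diagrams with external particles `S`; every leg of the first vertex
carries a proper nonempty subset of `S` (for `S = ∅` there is no diagram). -/
def currents {ι F : Type*} [DecidableEq ι] [DecidableEq F] [Fintype F]
    (g : ℝ) (X : OutState ι F) (S : Finset ι) : Currents F :=
  attachVertex g X (fun T => if _h : T ⊂ S then currents g X T else Currents.zero) S
termination_by S.card
decreasing_by exact Finset.card_lt_card _h

theorem currents_eq {ι F : Type*} [DecidableEq ι] [DecidableEq F] [Fintype F]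
    (g : ℝ) (X : OutState ι F) (S : Finset ι) :
    currents g X S =
      attachVertex g X (fun T => if T ⊂ S then currents g X T else Currents.zero) S := by
  rw [currents]
  simp only [dite_eq_ite]

/-! ### Operators

An operator at the origin is represented by its tree-level matrix elements `S ↦ ⟨S| · |0⟩`
between the vacuum and the sets of external particles. -/

/-- Product of operators: Wick contractions at tree level. Each external particle is connected
to exactly one of the factors. -/
def opProd {ι κ : Type*} [DecidableEq ι] [Fintype κ] [DecidableEq κ] (O : κ → Finset ι → ℂ) (S : Finset ι) : ℂ :=
  ∑ a : S → κ, ∏ k : κ, O k ((Finset.univ.filter fun i : S => a i = k).map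
    (Function.Embedding.subtype _))

/-- The exponential of an operator `w` that is linear in the fields (so `w ∅ = 0`). With `|S|`
external particles the terms of order above `|S|` of the exponential series vanish. -/
def opExp {ι : Type*} [DecidableEq ι] (w : Finset ι → ℂ) (S : Finset ι) : ℂ :=
  ∑ n ∈ Finset.range (S.card + 1), (1 / (n.factorial : ℂ)) * opProd (fun _ : Fin n => w) S

/-- The field `φ_f^*` (`σ = 1`) or `φ_f` (`σ = -1`) at the origin. -/
def field {ι F : Type*} [DecidableEq ι] [DecidableEq F] [Fintype F]
    (g : ℝ) (X : OutState ι F) (f : F) (σ : ℤˣ) : Finset ι → ℂ :=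
  fun S => (currents g X S).charged f σ

/-- `∫_0^∞ ds e^{i s a} e^{-ε s}` in the limit `ε → 0⁺`; it is used with `a = n·P`. -/
def rayIntegral (a : ℝ) : ℂ :=
  Filter.limUnder (𝓝[>] (0 : ℝ)) fun ε : ℝ =>
    ∫ s in Set.Ioi (0 : ℝ), Complex.exp (Complex.I * s * a) * Complex.exp (-ε * s)

theorem rayIntegral_eq {a : ℝ} (ha : a ≠ 0) : rayIntegral a = Complex.I / a := by
  have ha' : (a : ℂ) ≠ 0 := by exact_mod_cast ha
  have key : ∀ ε : ℝ, 0 < ε → ∫ s in Set.Ioi (0 : ℝ),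
      Complex.exp (Complex.I * s * a) * Complex.exp (-ε * s) = -1 / (Complex.I * a - ε) := by
    intro ε hε
    have h := integral_exp_mul_complex_Ioi (a := Complex.I * a - ε) (by simpa using hε) 0
    simp only [Complex.ofReal_zero, mul_zero, Complex.exp_zero] at h
    rw [← h]
    refine MeasureTheory.integral_congr_ae (Filter.Eventually.of_forall fun s => ?_)
    simp only [← Complex.exp_add]
    congr 1
    ring
  refine Filter.Tendsto.limUnder_eq ?_
  have h1 : Filter.Tendsto (fun ε : ℝ => -1 / (Complex.I * a - (ε : ℂ))) (𝓝[>] (0 : ℝ))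
      (𝓝 (-1 / (Complex.I * a - ((0 : ℝ) : ℂ)))) := by
    refine (ContinuousAt.tendsto ?_).mono_left nhdsWithin_le_nhds
    refine ContinuousAt.div (by fun_prop) (by fun_prop) ?_
    simpa using ha'
  have h2 : -1 / (Complex.I * a - ((0 : ℝ) : ℂ)) = Complex.I / a := by
    have hI := Complex.I_ne_zero
    simp only [Complex.ofReal_zero, sub_zero]
    rw [div_eq_div_iff (mul_ne_zero hI ha') ha']
    linear_combination (-(a:ℂ)) * Complex.I_mul_I
  rw [h2] at h1
  refine h1.congr' ?_
  filter_upwards [self_mem_nhdsWithin] with ε hε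
  exact (key ε hε).symm

/-- The operator `i q g ∫_0^∞ ds n·A(s n) e^{-ε s}`, `ε → 0⁺`, where
`⟨S| A(x) |0⟩ = e^{i P_S·x} ⟨S| A(0) |0⟩`. -/
def wilsonExponent {ι F : Type*} [DecidableEq ι] [DecidableEq F] [Fintype F]
    (g : ℝ) (X : OutState ι F) (q : ℤˣ) (n : Fin 4 → ℝ) : Finset ι → ℂ :=
  fun S => Complex.I * ((q : ℤ) : ℂ) * g * mdot (toC n) (currents g X S).photon
    * rayIntegral (mdot n (totalMom X.mom S))

/-- The outgoing Wilson line `exp (i q g ∫_0^∞ ds n·A(s n) e^{-ε s})` along `n`. -/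
def wilsonLine {ι F : Type*} [DecidableEq ι] [DecidableEq F] [Fintype F]
    (g : ℝ) (X : OutState ι F) (q : ℤˣ) (n : Fin 4 → ℝ) : Finset ι → ℂ :=
  opExp (wilsonExponent g X q n)

/-- The hard-scattering operator `(1 / (N/2)!) [φ^* φ]^{N/2}` with `φ^* φ = ∑_f φ_f^* φ_f`. -/
def hardOperator {ι F : Type*} [DecidableEq ι] [DecidableEq F] [Fintype F]
    (N : ℕ) (g : ℝ) (X : OutState ι F) : Finset ι → ℂ :=
  fun S => (1 / ((N / 2).factorial : ℂ)) * ∑ fl : Fin (N / 2) → F,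
    opProd (fun k : Fin (N / 2) × ℤˣ => field g X (fl k.1) k.2) S

/-- The operator `φ_f^* W` (for `σ = 1`) or `W^† φ_f` (for `σ = -1`), with the Wilson line
`W = exp (-i g ∫_0^∞ ds t·A(s t) e^{-ε s})`. -/
def jetOperator {ι F : Type*} [DecidableEq ι] [DecidableEq F] [Fintype F]
    (g : ℝ) (X : OutState ι F) (f : F) (σ : ℤˣ) (t : Fin 4 → ℝ) : Finset ι → ℂ :=
  opProd ![field g X f σ, wilsonLine g X (-σ) t]

/-- The product over the jets of `Y_j^†` (for `σ_j = 1`) or `Y_j` (for `σ_j = -1`), with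
`Y_j^† = exp (i g ∫_0^∞ ds n_j·A(s n_j) e^{-ε s})`. -/
def softOperator {ι F : Type*} [DecidableEq ι] [DecidableEq F] [Fintype F]
    {N : ℕ} (g : ℝ) (X : OutState ι F) (σ : Fin N → ℤˣ) (n : Fin N → Fin 4 → ℝ) : Finset ι → ℂ :=
  opProd fun j => wilsonLine g X (σ j) (n j)

/-! ### `N`-jet states

`sector i = some j` if the particle `i` belongs to the jet `j`, and `sector i = none` if it is
soft. -/

/-- The particles of one sector. -/
def sectorSet {ι : Type*} [Fintype ι] {N : ℕ} (sector : ι → Option (Fin N))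
    (s : Option (Fin N)) : Finset ι :=
  Finset.univ.filter fun i => sector i = s

/-- The number of scalars of flavour `f` minus that of their antiparticles. -/
def flavorCharge {ι F : Type*} [DecidableEq F] (species : ι → Species F) (S : Finset ι)
    (f : F) : ℤ :=
  ∑ i ∈ S, match species i with
    | .charged f' σ => if f' = f then (σ : ℤ) else 0
    | .photon => 0

/-- The jet `j` carries the quantum numbers of a single (anti)scalar, of flavour `flavor j` and
charge `σ j`, and the operator can produce these `N` (anti)scalars. -/
structure IsJetContent {ι F : Type*} [Fintype ι] [DecidableEq F] {N : ℕ}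
    (species : ι → Species F) (sector : ι → Option (Fin N)) (flavor : Fin N → F)
    (σ : Fin N → ℤˣ) : Prop where
  single_scalar : ∀ j f, flavorCharge species (sectorSet sector (some j)) f =
    if flavor j = f then (σ j : ℤ) else 0
  neutral : ∀ f, ∑ j, (if flavor j = f then (σ j : ℤ) else 0) = 0

/-- The light-like direction `n_j = (1, P⃗_j / |P⃗_j|)` of a jet, `P_j` its total momentum. -/
def jetDirection {ι : Type*} [Fintype ι] {N : ℕ} (sector : ι → Option (Fin N))
    (p : ι → Fin 4 → ℝ) (j : Fin N) : Fin 4 → ℝ :=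
  lightDirection (totalMom p (sectorSet sector (some j)))

/-- The momenta of an `N`-jet state with power-counting parameter `lam` (and total energy of order
one). Statements `a ∼ b` are made quantitative by a constant `K`. Lower bounds on `p_i · p_{i'}`
are needed only for pairs that can share a propagator, so not for two photons. -/
structure IsNJetKinematics {ι F : Type*} [Fintype ι] {N : ℕ} (species : ι → Species F)
    (sector : ι → Option (Fin N)) (K lam : ℝ) (p : ι → Fin 4 → ℝ) : Prop where
  massless : ∀ i, mdot (p i) (p i) = 0
  energy_pos : ∀ i, 0 < p i 0
  jet_energy : ∀ i, sector i ≠ none → K⁻¹ ≤ p i 0 ∧ p i 0 ≤ K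
  collinear : ∀ i i' j, i ≠ i' → sector i = some j → sector i' = some j →
    mdot (p i) (p i') ≤ K * lam ^ 2
  collinear_lower : ∀ i i' j, i ≠ i' → sector i = some j → sector i' = some j →
    ¬(species i = .photon ∧ species i' = .photon) → K⁻¹ * lam ^ 2 ≤ mdot (p i) (p i')
  jets_separated : ∀ j j', j ≠ j' →
    K⁻¹ ≤ mdot (jetDirection sector p j) (jetDirection sector p j')
  soft_energy : ∀ i, sector i = none → p i 0 ≤ K * lam ^ 2
  soft_not_collinear : ∀ i j, sector i = none →
    K⁻¹ * lam ^ 2 ≤ mdot (jetDirection sector p j) (p i)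
  soft_lower : ∀ i i', i ≠ i' → sector i = none → sector i' = none →
    ¬(species i = .photon ∧ species i' = .photon) → K⁻¹ * lam ^ 4 ≤ mdot (p i) (p i')

/-- `t` is a light-like direction that is not collinear to the jet direction `n`. -/
structure IsWilsonDirection (K : ℝ) (n t : Fin 4 → ℝ) : Prop where
  null : mdot t t = 0
  pos : 0 < t 0
  not_collinear : K⁻¹ * t 0 ≤ mdot t n

/-- The leading power: the matrix element scales like `lam ^ (-d)`, where `d` is the number of
collinear particles beyond one for each jet plus twice the number of soft particles. -/
def leadingPower {ι : Type*} [Fintype ι] {N : ℕ} (sector : ι → Option (Fin N)) : ℤ :=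
  ((∑ j, ((sectorSet sector (some j)).card : ℤ)) - N) + 2 * ((sectorSet sector none).card : ℤ)

/-- The matrix element `⟨p_1 ⋯ p_N| O |0⟩` with one (anti)scalar for each jet: the number of
contractions `∏_f (m_f)!`, `m_f` the number of jets initiated by a scalar of flavour `f`. It is `1`
if no two jets are initiated by identical particles. -/
def leadingOrder {F : Type*} [Fintype F] [DecidableEq F] {N : ℕ} (flavor : Fin N → F)
    (σ : Fin N → ℤˣ) : ℕ :=
  ∏ f : F, (Finset.univ.filter fun j => flavor j = f ∧ σ j = 1).card.factorial

end ScalarQED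

end

open ScalarQED

open scoped BigOperators Topology ComplexConjugate

noncomputable section

set_option linter.unusedSectionVars false
set_option linter.unusedSimpArgs false
set_option linter.unusedDecidableInType false
namespace ScalarQED

/-! ### The algebra of tree-level matrix elements -/

/-! At tree level a matrix element is a function of the set of external particles, and the operator
product is convolution over the ways of sharing out that set. This gives a commutative algebra `Gen
ι` in which the total momentum `P` acts as a derivation and the exponential of a family vanishing on
`∅` is a finite sum. In it the sums of tree diagrams solve the classical field equations `(P + eA)²
φ = 0` and `P² A = J` (`Regular.box_phi`, `Regular.sq_mul_phot`). They can therefore be gauge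
transformed, `φ → exp(e c) φ`, `A → A - P c`, and the products `φ_f^* φ_f` in the hard operator do
not change (`hardOperator_eq`).

The function `gaugeFn` puts every sector into an axial gauge: along `t_j` inside the jet `j`, along
a vector `w` on purely soft sets; it vanishes on sets that mix sectors. Photon polarizations become
bounded whatever the reference vectors, and `φ^* W_j` or `W_j^† φ` on the jet `j` becomes the
transformed field alone (`eventually_jetOperator`). Changing `w` from the rest frame to `n_j`
multiplies the charged field by a phase made of soft photon fields, the soft Wilson line
(`gPhi_eq_softLine_mul`). The rest frame cancels in the product over the jets because their charges
add up to zero (`softOperator_eq`).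

Fields are measured relative to `lam ^ (-wt)`, where a jet particle has weight 1 and a soft one
weight 2. By induction on the set of particles: soft fields are `O(lam²)` (`soft_bounds`). In the
`n_j` gauge the charged field of a jet is `O(lam)`, with one more power if a soft particle takes
part (`jet_bounds`); here momenta and photon fields are collinear in the sense of `Coll`, so that
their products gain `lam²`, and soft photon fields are orthogonal to `n_j`. If two jets take part,
the denominator is of order one and the charged field is `O(lam²)` (`hard_step`). Hence a charged
field is the sum over `j` of its restriction to the jet `j` times the soft line of `j`, up to one
extra power (`gOrd_gPhi_sub`).

In the product of `N` fields of size `lam` the error is `O(lam ^ (N + 1))` (`GOrd.prod_sub_prod`).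
In the main term a contraction survives only if it matches fields and jets bijectively with the
right flavours and charges (`prod_jetField`). There are `(N/2)! ∏ m_f!` of these
(`card_contraction`), and the prefactor of the operator removes `(N/2)!`.

All estimates are taken along the filter `Config.small` on the type of all admissible
configurations, so their constants are uniform in the kinematic data. -/

/-- Families of matrix elements, with the convolution product. -/
def Gen (ι : Type*) := Finset ι → ℂ

namespace Gen

/-- A family of matrix elements as an element of the algebra. -/
def mk {ι : Type*} (f : Finset ι → ℂ) : Gen ι := f

theorem mk_apply {ι : Type*} (f : Finset ι → ℂ) (S : Finset ι) : mk f S = f S := rfl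

variable {ι : Type*} [DecidableEq ι]

instance : AddCommGroup (Gen ι) := inferInstanceAs (AddCommGroup (Finset ι → ℂ))
instance : Module ℂ (Gen ι) := inferInstanceAs (Module ℂ (Finset ι → ℂ))
instance : Module ℚ (Gen ι) := inferInstanceAs (Module ℚ (Finset ι → ℂ))
instance : Mul (Gen ι) := ⟨fun f h S => ∑ A ∈ S.powerset, f A * h (S \ A)⟩
instance : One (Gen ι) := ⟨fun S => if S = ∅ then 1 else 0⟩

theorem mul_apply (f h : Gen ι) (S : Finset ι) :
    (f * h) S = ∑ A ∈ S.powerset, f A * h (S \ A) := rfl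
theorem one_apply (S : Finset ι) : (1 : Gen ι) S = if S = ∅ then 1 else 0 := rfl
theorem add_apply (f h : Gen ι) (S : Finset ι) : (f + h) S = f S + h S := rfl
theorem sub_apply (f h : Gen ι) (S : Finset ι) : (f - h) S = f S - h S := rfl
theorem zero_apply (S : Finset ι) : (0 : Gen ι) S = 0 := rfl
theorem smul_apply (c : ℂ) (f : Gen ι) (S : Finset ι) : (c • f) S = c * f S := rfl
theorem qsmul_apply (c : ℚ) (f : Gen ι) (S : Finset ι) : (c • f) S = c * f S :=
  Rat.smul_def c (f S)

@[ext] theorem ext {f h : Gen ι} (H : ∀ S, f S = h S) : f = h := funext H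

theorem sum_apply {κ : Type*} (s : Finset κ) (f : κ → Gen ι) (S : Finset ι) :
    (∑ k ∈ s, f k) S = ∑ k ∈ s, f k S := Finset.sum_apply (M := fun _ : Finset ι => ℂ) S s f

theorem mul_comm' (f h : Gen ι) : f * h = h * f := by
  ext S
  rw [mul_apply, mul_apply]
  refine Finset.sum_nbij' (fun A => S \ A) (fun A => S \ A) ?_ ?_ ?_ ?_ ?_
  · intro A _; simp
  · intro A _; simp
  · intro A hA; simpa using hA
  · intro A hA; simpa using hA
  · intro A hA
    rw [Finset.sdiff_sdiff_eq_self (Finset.mem_powerset.1 hA), mul_comm]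

theorem mul_assoc' (f h k : Gen ι) : f * h * k = f * (h * k) := by
  ext S
  simp only [mul_apply, Finset.sum_mul, Finset.mul_sum]
  rw [Finset.sum_sigma', Finset.sum_sigma']
  -- Both sides sum over ordered splittings of `S` into three blocks; the pair `B ⊆ A` is matched
  -- with `B` and `A \ B`.
  refine Finset.sum_nbij' (fun x => ⟨x.2, x.1 \ x.2⟩) (fun x => ⟨x.1 ∪ x.2, x.1⟩) ?_ ?_ ?_ ?_ ?_
  · rintro ⟨A, B⟩ h
    simp only [Finset.mem_sigma, Finset.mem_powerset] at h ⊢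
    exact ⟨h.2.trans h.1, Finset.sdiff_subset_sdiff h.1 le_rfl⟩
  · rintro ⟨A, B⟩ h
    simp only [Finset.mem_sigma, Finset.mem_powerset] at h ⊢
    exact ⟨Finset.union_subset h.1 (h.2.trans Finset.sdiff_subset), Finset.subset_union_left⟩
  · rintro ⟨A, B⟩ h
    simp only [Finset.mem_sigma, Finset.mem_powerset] at h ⊢
    simp [Finset.union_eq_right.2 h.2]
  · rintro ⟨A, B⟩ h
    simp only [Finset.mem_sigma, Finset.mem_powerset, Finset.subset_sdiff] at h ⊢
    simp [Finset.union_sdiff_cancel_left h.2.2.symm]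
  · rintro ⟨A, B⟩ h
    simp only [Finset.mem_sigma, Finset.mem_powerset] at h ⊢
    rw [sdiff_sdiff_left, Finset.sup_eq_union, Finset.union_sdiff_of_subset h.2]
    ring

theorem one_mul' (f : Gen ι) : 1 * f = f := by
  ext S
  rw [mul_apply, Finset.sum_eq_single ∅]
  · simp [one_apply]
  · intro A _ hA; simp [one_apply, hA]
  · simp

theorem left_distrib' (f h k : Gen ι) : f * (h + k) = f * h + f * k := by
  ext S; simp [mul_apply, add_apply, mul_add, Finset.sum_add_distrib]

instance : CommRing (Gen ι) where
  mul_comm := mul_comm'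
  mul_assoc := mul_assoc'
  one_mul := one_mul'
  mul_one f := by rw [mul_comm', one_mul']
  left_distrib := left_distrib'
  right_distrib f h k := by rw [mul_comm', left_distrib', mul_comm' k f, mul_comm' k h]
  zero_mul f := by ext S; simp [mul_apply, zero_apply]
  mul_zero f := by ext S; simp [mul_apply, zero_apply]
  zsmul := zsmulRec
  neg_add_cancel := neg_add_cancel

instance : Algebra ℂ (Gen ι) := Algebra.ofModule
  (fun c f h => by ext S; simp [mul_apply, smul_apply, Finset.mul_sum, mul_assoc])
  (fun c f h => by ext S; simp [mul_apply, smul_apply, Finset.mul_sum, mul_left_comm])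

/-- Restriction to the subsets of `J`. -/
def res (J : Finset ι) : Gen ι →ₐ[ℂ] Gen ι where
  toFun f := mk fun T => if T ⊆ J then f T else 0
  map_one' := by ext T; by_cases h : T = ∅ <;> simp [mk_apply, one_apply, h]
  map_mul' f h := by
    ext T
    simp only [mul_apply, mk_apply]
    split_ifs with hT
    · refine Finset.sum_congr rfl fun A hA => ?_
      rw [if_pos ((Finset.mem_powerset.1 hA).trans hT), if_pos (Finset.sdiff_subset.trans hT)]
    · refine (Finset.sum_eq_zero fun A hA => ?_).symm
      by_cases h1 : A ⊆ J
      · by_cases h2 : T \ A ⊆ J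
        · refine absurd ?_ hT
          rw [← Finset.union_sdiff_of_subset (Finset.mem_powerset.1 hA)]
          exact Finset.union_subset h1 h2
        · simp [h2]
      · simp [h1]
  map_zero' := by ext T; simp [mk_apply, zero_apply]
  map_add' f h := by ext T; by_cases hT : T ⊆ J <;> simp [mk_apply, add_apply, hT]
  commutes' c := by
    ext T
    simp only [mk_apply, Algebra.algebraMap_eq_smul_one, smul_apply, one_apply]
    by_cases h : T = ∅ <;> simp [h]

theorem res_apply (J : Finset ι) (f : Gen ι) (T : Finset ι) :
    res J f T = if T ⊆ J then f T else 0 := rfl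

theorem res_apply_of_subset {J T : Finset ι} (h : T ⊆ J) (f : Gen ι) : res J f T = f T :=
  if_pos h

/-- The derivation that multiplies the matrix element of `S` by `∑ i ∈ S, v i`. -/
def deriv (v : ι → ℂ) : Derivation ℂ (Gen ι) (Gen ι) :=
  Derivation.mk'
    { toFun := fun f => mk fun S => (∑ i ∈ S, v i) * f S
      map_add' := fun f h => by ext S; simp [mk_apply, add_apply, mul_add]
      map_smul' := fun c f => by ext S; simp [mk_apply, smul_apply, mul_left_comm] }
    (fun f h => by
      ext S
      simp only [smul_eq_mul, mul_comm h, mk_apply, add_apply, mul_apply, Finset.mul_sum, LinearMap.coe_mk,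
        AddHom.coe_mk, ← Finset.sum_add_distrib]
      refine Finset.sum_congr rfl fun A hA => ?_
      rw [← Finset.sum_sdiff (Finset.mem_powerset.1 hA)]
      ring)

theorem deriv_apply (v : ι → ℂ) (f : Gen ι) (S : Finset ι) :
    deriv v f S = (∑ i ∈ S, v i) * f S := rfl

/-! #### Powers and exponentials -/

/-- A factor evaluated on `∅` vanishes, so each of the `n` factors has to take at least one
particle. -/
theorem pow_apply_eq_zero {w : Gen ι} (hw : w ∅ = 0) (n : ℕ) (S : Finset ι) (h : S.card < n) :
    (w ^ n) S = 0 := by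
  induction n generalizing S with
  | zero => omega
  | succ n ih =>
    rw [pow_succ', mul_apply]
    refine Finset.sum_eq_zero fun A hA => ?_
    rcases A.eq_empty_or_nonempty with rfl | hne
    · simp [hw]
    · rw [ih, mul_zero]
      have := Finset.card_sdiff_add_card_eq_card (Finset.mem_powerset.1 hA)
      have := hne.card_pos
      omega

theorem pow_card_eq_zero [Fintype ι] {w : Gen ι} (hw : w ∅ = 0) : w ^ (Fintype.card ι + 1) = 0 := by
  ext S
  rw [pow_apply_eq_zero hw _ _ (Nat.lt_succ_of_le (Finset.card_le_univ S)), zero_apply]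

theorem isNilpotent [Fintype ι] {w : Gen ι} (hw : w ∅ = 0) : IsNilpotent w :=
  ⟨_, pow_card_eq_zero hw⟩

open IsNilpotent (exp)

theorem exp_apply [Fintype ι] {w : Gen ι} (hw : w ∅ = 0) (S : Finset ι) :
    exp w S = ∑ n ∈ Finset.range (S.card + 1), (1 / (n.factorial : ℂ)) * (w ^ n) S := by
  rw [IsNilpotent.exp_eq_sum (pow_card_eq_zero hw), sum_apply]
  simp only [qsmul_apply, Rat.cast_inv, Rat.cast_natCast, one_div]
  symm
  refine Finset.sum_subset ?_ ?_
  · intro n hn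
    have := Finset.card_le_univ S
    simp only [Finset.mem_range] at hn ⊢
    omega
  · intro n _ hn
    rw [pow_apply_eq_zero hw _ _ (by simp only [Finset.mem_range] at hn; omega), mul_zero]

theorem exp_apply_empty [Fintype ι] {w : Gen ι} (hw : w ∅ = 0) : exp w ∅ = 1 := by
  simp [exp_apply hw, one_apply]

theorem exp_add [Fintype ι] {w w' : Gen ι} (hw : w ∅ = 0) (hw' : w' ∅ = 0) :
    exp (w + w') = exp w * exp w' :=
  IsNilpotent.exp_add_of_commute (Commute.all _ _) (isNilpotent hw) (isNilpotent hw')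

theorem exp_sum [Fintype ι] {κ : Type*} (s : Finset κ) (w : κ → Gen ι) (hw : ∀ k, w k ∅ = 0) :
    exp (∑ k ∈ s, w k) = ∏ k ∈ s, exp (w k) := by
  classical
  induction s using Finset.induction_on with
  | empty => simp [IsNilpotent.exp_zero]
  | insert a s ha ih =>
    rw [Finset.sum_insert ha, Finset.prod_insert ha, exp_add (hw a), ih]
    rw [sum_apply]; exact Finset.sum_eq_zero fun k _ => hw k

theorem res_exp [Fintype ι] {w : Gen ι} (hw : w ∅ = 0) (J : Finset ι) :
    res J (exp w) = exp (res J w) :=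
  IsNilpotent.map_exp (isNilpotent hw) _

theorem derivation_exp [Fintype ι] (D : Derivation ℂ (Gen ι) (Gen ι)) {w : Gen ι} (hw : w ∅ = 0) :
    D (exp w) = exp w * D w := by
  have h0 := pow_card_eq_zero hw
  -- The exponential to be differentiated is cut off one order later: dropping its constant term and
  -- shifting the index then gives exactly the sum for `exp w`.
  have h1 : w ^ (Fintype.card ι + 1 + 1) = 0 := by rw [pow_succ, h0, zero_mul]
  have hq : ∀ (q : ℚ) (f : Gen ι), q • f = (q : ℂ) • f := fun q f => by
    ext S; rw [qsmul_apply, smul_apply]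
  rw [IsNilpotent.exp_eq_sum h1, map_sum, Finset.sum_range_succ', ← IsNilpotent.exp_eq_sum h1,
    IsNilpotent.exp_eq_sum h0, Finset.sum_mul]
  simp only [hq, Derivation.map_smul, pow_zero, Derivation.map_one_eq_zero, smul_zero, add_zero,
    Derivation.leibniz_pow, Nat.add_sub_cancel, smul_mul_assoc]
  refine Finset.sum_congr rfl fun n _ => ?_
  rw [← Nat.cast_smul_eq_nsmul (R := ℂ), smul_smul, smul_eq_mul]
  congr 1
  rw [Nat.factorial_succ]
  have : ((n : ℂ) + 1) ≠ 0 := by exact_mod_cast Nat.succ_ne_zero n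
  have : (n.factorial : ℂ) ≠ 0 := by exact_mod_cast n.factorial_ne_zero
  push_cast
  field_simp

/-! #### Products of operators -/

/-- The matrix elements `1` for `T` and `0` otherwise. -/
def single (T : Finset ι) : Gen ι := mk fun S => if S = T then 1 else 0

theorem single_mul_single_apply (A B S : Finset ι) :
    (single A * single B) S = if S = A ∪ B ∧ Disjoint A B then 1 else 0 := by
  simp only [mul_apply, single, mk_apply]
  split_ifs with h
  · obtain ⟨rfl, hd⟩ := h
    rw [Finset.sum_eq_single A]
    · rw [Finset.union_sdiff_cancel_left hd]; simp
    · intro C _ hC; simp [hC]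
    · intro h; exact absurd (Finset.mem_powerset.2 Finset.subset_union_left) h
  · refine Finset.sum_eq_zero fun C hC => ?_
    by_cases h1 : C = A
    · subst h1
      by_cases h2 : S \ C = B
      · subst h2
        exact absurd ⟨(Finset.union_sdiff_of_subset (Finset.mem_powerset.1 hC)).symm,
          Finset.disjoint_sdiff⟩ h
      · simp [h2]
    · simp [h1]

-- Convolving indicators joins their sets and gives zero as soon as two of them overlap; this is the
-- combinatorial core of `prod_apply`.
open Classical in
theorem prod_single_apply {κ : Type*} [DecidableEq κ] (s : Finset κ) (T : κ → Finset ι)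
    (S : Finset ι) :
    (∏ k ∈ s, single (T k)) S =
      if S = s.biUnion T ∧ (s : Set κ).PairwiseDisjoint T then 1 else 0 := by
  have key : ∏ k ∈ s, single (T k) =
      if (s : Set κ).PairwiseDisjoint T then single (s.biUnion T) else 0 := by
    induction s using Finset.induction_on with
    | empty => ext S; by_cases h : S = ∅ <;> simp [single, mk_apply, one_apply, h]
    | insert a s ha ih =>
      have hd : ((insert a s : Finset κ) : Set κ).PairwiseDisjoint T ↔
          (s : Set κ).PairwiseDisjoint T ∧ Disjoint (T a) (s.biUnion T) := by
        rw [Finset.coe_insert, Set.pairwiseDisjoint_insert_of_notMem (by simpa using ha),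
          Finset.disjoint_biUnion_right]
        simp
      rw [Finset.prod_insert ha, ih, hd, Finset.biUnion_insert]
      ext S
      by_cases h1 : (s : Set κ).PairwiseDisjoint T
      · by_cases h2 : Disjoint (T a) (s.biUnion T)
        · rw [if_pos h1, if_pos ⟨h1, h2⟩, single_mul_single_apply]
          simp [h2, single, mk_apply]
        · simp only [h1, h2, and_false, if_true, if_false, single_mul_single_apply, zero_apply]
      · simp [h1, zero_apply]
  rw [key]
  by_cases h : (s : Set κ).PairwiseDisjoint T <;> simp [h, single, mk_apply, zero_apply]

theorem eq_sum_single [Fintype ι] (f : Gen ι) : f = ∑ T : Finset ι, f T • single T := by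
  ext S
  rw [sum_apply, Finset.sum_eq_single S]
  · simp [smul_apply, single, mk_apply]
  · intro T _ hT; simp [smul_apply, single, mk_apply, hT.symm]
  · simp

/-- Each factor is expanded in the indicators `single T`. The families of sets that survive are the
labelled partitions of `S` with blocks that may be empty, and these are the fibres of the maps
summed over in `opProd`. -/
theorem prod_apply [Fintype ι] {κ : Type*} [Fintype κ] [DecidableEq κ] (f : κ → Gen ι)
    (S : Finset ι) :
    (∏ k, f k) S = opProd (fun k => (f k : Finset ι → ℂ)) S := by
  have h1 : ∏ k, f k = ∑ T : κ → Finset ι, (∏ k, f k (T k)) • ∏ k, single (T k) := by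
    conv_lhs => enter [2, k]; rw [eq_sum_single (f k)]
    rw [Finset.prod_univ_sum, Fintype.piFinset_univ]
    refine Finset.sum_congr rfl fun T _ => ?_
    simp only [Algebra.smul_def, Finset.prod_mul_distrib, map_prod]
  rw [h1, sum_apply]
  simp only [smul_apply, prod_single_apply, mul_ite, mul_one, mul_zero, ← Finset.sum_filter]
  symm
  unfold opProd
  refine Finset.sum_bij (fun a _ k => (Finset.univ.filter fun i : S => a i = k).map
    (Function.Embedding.subtype _)) ?_ ?_ ?_ ?_
  · intro a _
    simp only [Finset.mem_filter, Finset.mem_univ, true_and]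
    constructor
    · ext i; simp
    · intro k _ k' _ hk
      rw [Function.onFun, Finset.disjoint_left]
      intro i hi hi'
      simp only [Finset.mem_map, Finset.mem_filter, Finset.mem_univ, true_and,
        Function.Embedding.coe_subtype] at hi hi'
      obtain ⟨x, hx, rfl⟩ := hi
      obtain ⟨y, hy, hxy⟩ := hi'
      rw [Subtype.ext hxy] at hy
      exact hk (hx.symm.trans hy)
  · intro a _ b _ hab
    funext i
    have h := congrFun hab (a i)
    have : (i : ι) ∈ (Finset.univ.filter fun j : S => b j = a i).map
        (Function.Embedding.subtype _) := by
      simp only [← h]; simp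
    simp only [Finset.mem_map, Finset.mem_filter, Finset.mem_univ, true_and,
        Function.Embedding.coe_subtype] at this
    obtain ⟨x, hx, hxi⟩ := this
    rw [Subtype.ext hxi] at hx
    exact hx.symm
  · intro T hT
    simp only [Finset.mem_filter, Finset.mem_univ, true_and] at hT
    obtain ⟨hS, hd⟩ := hT
    have hex : ∀ i : S, ∃ k, (i : ι) ∈ T k := fun i => by
      have : (i : ι) ∈ Finset.univ.biUnion T := hS ▸ i.2
      simpa using this
    choose a ha using hex
    refine ⟨a, Finset.mem_univ _, ?_⟩
    funext k
    ext i
    simp only [Finset.mem_map, Finset.mem_filter, Finset.mem_univ, true_and,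
        Function.Embedding.coe_subtype]
    constructor
    · rintro ⟨x, rfl, rfl⟩; exact ha x
    · intro hi
      have hiS : i ∈ S := by rw [hS]; exact Finset.mem_biUnion.2 ⟨k, Finset.mem_univ _, hi⟩
      refine ⟨⟨i, hiS⟩, ?_, rfl⟩
      by_contra hne
      exact Finset.disjoint_left.1 (hd (Finset.mem_coe.2 (Finset.mem_univ (a ⟨i, hiS⟩)))
        (Finset.mem_coe.2 (Finset.mem_univ k)) hne) (ha ⟨i, hiS⟩) hi
  · intro a _; rfl

theorem opExp_eq [Fintype ι] {w : Gen ι} (hw : w ∅ = 0) (S : Finset ι) :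
    opExp (w : Finset ι → ℂ) S = exp w S := by
  rw [exp_apply hw]
  unfold opExp
  refine Finset.sum_congr rfl fun n _ => ?_
  have := prod_apply (fun _ : Fin n => w) S
  rw [← this, Finset.prod_const, Finset.card_univ, Fintype.card_fin]

end Gen
end ScalarQED
namespace ScalarQED

open IsNilpotent (exp)

/-! ### Field equations -/

section FieldEquations

variable {ι F : Type*} [DecidableEq ι]

theorem totalMom_apply {κ : Type*} (p : κ → Fin 4 → ℝ) (S : Finset κ) (μ : Fin 4) :
    totalMom p S μ = ∑ i ∈ S, p i μ := by
  rw [totalMom, Finset.sum_apply]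

theorem totalMom_empty (p : ι → Fin 4 → ℝ) : totalMom p ∅ = 0 := Finset.sum_empty

theorem totalMom_singleton (p : ι → Fin 4 → ℝ) (i : ι) : totalMom p {i} = p i :=
  Finset.sum_singleton _ _

theorem totalMom_add_sdiff (p : ι → Fin 4 → ℝ) {A S : Finset ι} (h : A ⊆ S) :
    totalMom p A + totalMom p (S \ A) = totalMom p S := by
  rw [totalMom, totalMom, totalMom, add_comm, Finset.sum_sdiff h]

/-- The momentum operator. -/
def momD (p : ι → Fin 4 → ℝ) (μ : Fin 4) : Derivation ℂ (Gen ι) (Gen ι) :=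
  Gen.deriv fun i => (p i μ : ℂ)

theorem momD_apply (p : ι → Fin 4 → ℝ) (μ : Fin 4) (f : Gen ι) (S : Finset ι) :
    momD p μ f S = (totalMom p S μ : ℂ) * f S := by
  rw [momD, Gen.deriv_apply, totalMom_apply, Complex.ofReal_sum]

/-- The covariant derivative `P + e B`. -/
def cov (p : ι → Fin 4 → ℝ) (e : ℂ) (B : Fin 4 → Gen ι) (μ : Fin 4) (φ : Gen ι) : Gen ι :=
  momD p μ φ + e • (B μ * φ)

/-- The covariant wave operator `(P + e B)²`. -/
def box (p : ι → Fin 4 → ℝ) (e : ℂ) (B : Fin 4 → Gen ι) (φ : Gen ι) : Gen ι :=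
  cov p e B 0 (cov p e B 0 φ) - cov p e B 1 (cov p e B 1 φ) - cov p e B 2 (cov p e B 2 φ)
    - cov p e B 3 (cov p e B 3 φ)

/-- By the Leibniz rule the outer derivative of `B φ` gives `P_A + P_{S \ A}`, and the inner
derivative of `φ` gives `P_{S \ A}`; hence the combination `P_A + 2 P_{S \ A}` of the Feynman rule.
-/
theorem cov_cov_apply (p : ι → Fin 4 → ℝ) (e : ℂ) (B : Fin 4 → Gen ι) (μ : Fin 4) (φ : Gen ι)
    (S : Finset ι) : cov p e B μ (cov p e B μ φ) S =
      (totalMom p S μ : ℂ) * (totalMom p S μ : ℂ) * φ S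
      + e * ∑ A ∈ S.powerset, ((totalMom p A μ : ℂ) + 2 * (totalMom p (S \ A) μ : ℂ)) * B μ A
          * φ (S \ A)
      + e ^ 2 * ∑ A ∈ S.powerset, ∑ A' ∈ (S \ A).powerset, B μ A * B μ A' * φ ((S \ A) \ A') := by
  simp only [cov, Gen.add_apply, Gen.smul_apply, momD_apply, Gen.mul_apply, Finset.mul_sum,
    mul_add, Finset.sum_add_distrib]
  have h : ∑ A ∈ S.powerset, e * (((totalMom p A μ : ℂ) + 2 * (totalMom p (S \ A) μ : ℂ)) * B μ A
      * φ (S \ A)) = ∑ A ∈ S.powerset, (totalMom p S μ : ℂ) * (e * (B μ A * φ (S \ A)))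
        + ∑ A ∈ S.powerset, e * (B μ A * ((totalMom p (S \ A) μ : ℂ) * φ (S \ A))) := by
    rw [← Finset.sum_add_distrib]
    refine Finset.sum_congr rfl fun A hA => ?_
    have := congrFun (totalMom_add_sdiff p (Finset.mem_powerset.1 hA)) μ
    rw [← this, Pi.add_apply]
    push_cast
    ring
  rw [h]
  have h2 : ∀ A A' : Finset ι, e * (B μ A * (e * (B μ A' * φ ((S \ A) \ A')))) =
      e ^ 2 * (B μ A * B μ A' * φ ((S \ A) \ A')) := fun A A' => by ring
  simp only [h2]
  ring

/-- The terms linear and quadratic in `B` are the two vertices of `attachVertex`, so the vanishing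
of `box` is the recursion for a charged line multiplied by `P_S²`. -/
theorem box_apply (p : ι → Fin 4 → ℝ) (e : ℂ) (B : Fin 4 → Gen ι) (φ : Gen ι) (S : Finset ι) :
    box p e B φ S = ((mdot (totalMom p S) (totalMom p S) : ℝ) : ℂ) * φ S
      + (e * ∑ A ∈ S.powerset,
          mdot (toC (totalMom p A + 2 • totalMom p (S \ A))) (fun μ => B μ A) * φ (S \ A)
        + e ^ 2 * ∑ A ∈ S.powerset, ∑ A' ∈ (S \ A).powerset,
          mdot (fun μ => B μ A) (fun μ => B μ A') * φ ((S \ A) \ A')) := by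
  simp only [box, Gen.sub_apply, cov_cov_apply, mdot, toC, two_nsmul, Pi.add_apply, sub_mul,
    Finset.sum_sub_distrib]
  push_cast
  ring_nf

/-- Differentiating the exponential produces a term with `P c`, which the shift of `B` removes. The
condition on `c ∅` makes the exponent nilpotent. -/
theorem cov_gauge [Fintype ι] (p : ι → Fin 4 → ℝ) (e : ℂ) (B : Fin 4 → Gen ι) (c : Gen ι)
    (hc : c ∅ = 0) (μ : Fin 4) (φ : Gen ι) :
    cov p e (fun μ => B μ - momD p μ c) μ (exp (e • c) * φ) = exp (e • c) * cov p e B μ φ := by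
  have h0 : (e • c) ∅ = 0 := by rw [Gen.smul_apply, hc, mul_zero]
  simp only [cov, Derivation.leibniz, Gen.derivation_exp _ h0, Derivation.map_smul, smul_eq_mul]
  simp only [Algebra.smul_def]
  ring

theorem box_gauge [Fintype ι] (p : ι → Fin 4 → ℝ) (e : ℂ) (B : Fin 4 → Gen ι) (c : Gen ι)
    (hc : c ∅ = 0) (φ : Gen ι) :
    box p e (fun μ => B μ - momD p μ c) (exp (e • c) * φ) = exp (e • c) * box p e B φ := by
  simp only [box, cov_gauge p e B c hc]
  ring

variable [Fintype F]

/-- The electromagnetic current. -/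
def emCurrent (p : ι → Fin 4 → ℝ) (g : ℂ) (Φ : F → ℤˣ → Gen ι) (B : Fin 4 → Gen ι) (μ : Fin 4) :
    Gen ι :=
  g • ∑ f, (cov p g B μ (Φ f 1) * Φ f (-1) - Φ f 1 * cov p (-g) B μ (Φ f (-1)))

theorem emCurrent_apply (p : ι → Fin 4 → ℝ) (g : ℂ) (Φ : F → ℤˣ → Gen ι) (B : Fin 4 → Gen ι)
    (μ : Fin 4) (S : Finset ι) : emCurrent p g Φ B μ S =
      g * ∑ f : F, ∑ A ∈ S.powerset,
          toC (totalMom p A - totalMom p (S \ A)) μ * Φ f 1 A * Φ f (-1) (S \ A)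
        + 2 * g ^ 2 * ∑ f : F, ∑ A ∈ S.powerset, ∑ A' ∈ (S \ A).powerset,
          B μ ((S \ A) \ A') * Φ f 1 A * Φ f (-1) A' := by
  have h : ∀ f, cov p g B μ (Φ f 1) * Φ f (-1) - Φ f 1 * cov p (-g) B μ (Φ f (-1)) =
      momD p μ (Φ f 1) * Φ f (-1) - Φ f 1 * momD p μ (Φ f (-1))
        + (2 * g) • (Φ f 1 * (Φ f (-1) * B μ)) := fun f => by
    simp only [cov, Algebra.smul_def, map_neg, map_mul, map_ofNat]
    ring
  simp only [emCurrent, h, Gen.smul_apply, Gen.sum_apply, Gen.add_apply, Gen.sub_apply,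
    Gen.mul_apply, momD_apply, toC, Pi.sub_apply, Finset.mul_sum, mul_add, mul_sub,
    Finset.sum_add_distrib, Finset.sum_sub_distrib]
  push_cast
  simp only [sub_mul, mul_sub, Finset.sum_sub_distrib]
  congr 1
  · congr 1
    exact Finset.sum_congr rfl fun f _ => Finset.sum_congr rfl fun A _ => by ring
  · exact Finset.sum_congr rfl fun f _ => Finset.sum_congr rfl fun A _ =>
      Finset.sum_congr rfl fun A' _ => by ring

/-- The charged fields after a gauge transformation. -/
def gaugePhi [Fintype ι] (g : ℂ) (c : Gen ι) (Φ : F → ℤˣ → Gen ι) (f : F) (σ : ℤˣ) : Gen ι :=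
  exp ((((σ : ℤ) : ℂ) * g) • c) * Φ f σ

/-- The photon field after a gauge transformation. -/
def gaugePhot (p : ι → Fin 4 → ℝ) (c : Gen ι) (A : Fin 4 → Gen ι) (μ : Fin 4) : Gen ι :=
  A μ - momD p μ c

/-- The two phases are inverse to each other; for this reason the hard operator is the same in every
gauge. -/
theorem gaugePhi_mul [Fintype ι] (g : ℂ) {c : Gen ι} (hc : c ∅ = 0) (Φ : F → ℤˣ → Gen ι) (f : F) :
    gaugePhi g c Φ f 1 * gaugePhi g c Φ f (-1) = Φ f 1 * Φ f (-1) := by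
  have h0 : (g • c) ∅ = 0 := by rw [Gen.smul_apply, hc, mul_zero]
  have := IsNilpotent.exp_mul_exp_neg_self (Gen.isNilpotent h0)
  simp only [gaugePhi, Units.val_one, Units.val_neg, Int.cast_one, Int.cast_neg, one_mul, neg_mul,
    neg_smul]
  linear_combination (Φ f 1 * Φ f (-1)) * this

/-- Covariant derivatives pick up the same phases as the fields, and each term of the current
contains one phase of either sign. -/
theorem emCurrent_gauge [Fintype ι] (p : ι → Fin 4 → ℝ) (g : ℂ) (Φ : F → ℤˣ → Gen ι)
    (A : Fin 4 → Gen ι) {c : Gen ι} (hc : c ∅ = 0) (μ : Fin 4) :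
    emCurrent p g (gaugePhi g c Φ) (gaugePhot p c A) μ = emCurrent p g Φ A μ := by
  have h0 : (g • c) ∅ = 0 := by rw [Gen.smul_apply, hc, mul_zero]
  have key := IsNilpotent.exp_mul_exp_neg_self (Gen.isNilpotent h0)
  have h1 : ∀ φ, cov p g (gaugePhot p c A) μ (exp (g • c) * φ) = exp (g • c) * cov p g A μ φ :=
    fun φ => cov_gauge p g A c hc μ φ
  have h2 : ∀ φ, cov p (-g) (gaugePhot p c A) μ (exp (-(g • c)) * φ) =
      exp (-(g • c)) * cov p (-g) A μ φ := fun φ => by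
    rw [← neg_smul]; exact cov_gauge p (-g) A c hc μ φ
  simp only [emCurrent, gaugePhi, Units.val_one, Units.val_neg, Int.cast_one, Int.cast_neg,
    one_mul, neg_mul, neg_smul, h1, h2]
  congr 1
  refine Finset.sum_congr rfl fun f _ => ?_
  linear_combination
    (cov p g A μ (Φ f 1) * Φ f (-1) - Φ f 1 * cov p (-g) A μ (Φ f (-1))) * key

theorem box_gaugePhi [Fintype ι] (p : ι → Fin 4 → ℝ) (g : ℂ) (Φ : F → ℤˣ → Gen ι)
    (A : Fin 4 → Gen ι) {c : Gen ι} (hc : c ∅ = 0) (f : F) (σ : ℤˣ)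
    (h : box p (((σ : ℤ) : ℂ) * g) A (Φ f σ) = 0) :
    box p (((σ : ℤ) : ℂ) * g) (gaugePhot p c A) (gaugePhi g c Φ f σ) = 0 := by
  have := box_gauge p (((σ : ℤ) : ℂ) * g) A c hc (Φ f σ)
  rw [h, mul_zero] at this
  exact this

end FieldEquations

/-! ### Tree currents solve the field equations -/

section TreeCurrents

variable {ι F : Type*} [DecidableEq ι] [DecidableEq F]

theorem flavorCharge_add_sdiff (species : ι → Species F) {A S : Finset ι} (h : A ⊆ S) :
    flavorCharge species A + flavorCharge species (S \ A) = flavorCharge species S := by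
  funext f
  simp only [Pi.add_apply, flavorCharge]
  rw [add_comm, Finset.sum_sdiff h]

theorem flavorCharge_empty (species : ι → Species F) : flavorCharge species ∅ = 0 := by
  funext f; simp [flavorCharge]

theorem flavorCharge_of_photon (species : ι → Species F) {S : Finset ι}
    (h : ∀ i ∈ S, species i = .photon) : flavorCharge species S = 0 := by
  funext f
  refine Finset.sum_eq_zero fun i hi => ?_
  rw [h i hi]

/-- The charge of a single particle of flavour `f`. -/
def unitCharge (f : F) (σ : ℤˣ) : F → ℤ := fun f' => if f = f' then (σ : ℤ) else 0

theorem unitCharge_ne_zero (f : F) (σ : ℤˣ) : unitCharge f σ ≠ 0 := fun h => by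
  have := congrFun h f
  simp [unitCharge] at this

theorem unitCharge_injective {f f' : F} {σ σ' : ℤˣ} (h : unitCharge f σ = unitCharge f' σ') :
    f = f' ∧ σ = σ' := by
  have h1 := congrFun h f
  by_cases hf : f' = f
  · subst hf
    simp only [unitCharge, if_true] at h1
    exact ⟨rfl, Units.ext h1⟩
  · simp [unitCharge, hf] at h1

theorem unitCharge_add (f : F) : unitCharge f 1 + unitCharge f (-1) = 0 := by
  funext f'
  by_cases h : f = f' <;> simp [unitCharge, h]

/-- Matrix elements that vanish unless the charges match. -/
def ChargeConserving (species : ι → Species F) (S : Finset ι) (c : Currents F) : Prop :=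
  (∀ f σ, flavorCharge species S ≠ unitCharge f σ → c.charged f σ = 0) ∧
    (flavorCharge species S ≠ 0 → c.photon = 0)

theorem chargeConserving_zero (species : ι → Species F) (S : Finset ι) :
    ChargeConserving species S Currents.zero :=
  ⟨fun _ _ _ => rfl, fun _ => rfl⟩

theorem chargeConserving_externalLine (X : OutState ι F) (i : ι) :
    ChargeConserving X.species {i} (externalLine X i) := by
  cases h : X.species i with
  | charged f σ =>
    have h1 : flavorCharge X.species {i} = unitCharge f σ := by
      funext f'; simp [flavorCharge, h, unitCharge]
    refine ⟨fun f' σ' hne => ?_, fun _ => ?_⟩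
    · rw [h1] at hne
      simp only [externalLine, h]
      rw [if_neg]
      rintro ⟨rfl, rfl⟩
      exact hne rfl
    · simp only [externalLine, h]; rfl
  | photon =>
    have h1 : flavorCharge X.species {i} = 0 := by
      funext f'; simp [flavorCharge, h]
    refine ⟨fun f' σ' _ => by simp only [externalLine, h], fun hne => absurd h1 hne⟩

theorem mdot_zero_right {K : Type*} [CommRing K] (u : Fin 4 → K) : mdot u 0 = 0 := by simp [mdot]
theorem mdot_zero_left {K : Type*} [CommRing K] (u : Fin 4 → K) : mdot 0 u = 0 := by simp [mdot]
theorem mdot_comm {K : Type*} [CommRing K] (u v : Fin 4 → K) : mdot u v = mdot v u := by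
  simp only [mdot]; ring

variable [Fintype F]

/-- Flavour charges add over the legs of a vertex, so if the total charge of `S` is wrong, every
term contains a leg with the wrong charge. -/
theorem chargeConserving_attachVertex (g : ℝ) (X : OutState ι F) (c : Finset ι → Currents F)
    (S : Finset ι) (hc : ∀ T, ChargeConserving X.species T (c T)) :
    ChargeConserving X.species S (attachVertex g X c S) := by
  constructor
  · intro f σ hne
    have e1 : (∑ i ∈ S, if S = {i} then (externalLine X i).charged f σ else 0) = 0 := by
      refine Finset.sum_eq_zero fun i _ => ?_
      split_ifs with h
      · rw [h] at hne
        exact (chargeConserving_externalLine X i).1 f σ hne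
      · rfl
    have e2 : ∀ A ∈ S.powerset, flavorCharge X.species A = 0 →
        flavorCharge X.species (S \ A) ≠ unitCharge f σ := fun A hA h0 h => by
      rw [← flavorCharge_add_sdiff X.species (Finset.mem_powerset.1 hA), h0, h, zero_add] at hne
      exact hne rfl
    simp only [attachVertex]
    rw [e1, Finset.sum_eq_zero, Finset.sum_eq_zero]
    · simp
    · intro A hA
      refine Finset.sum_eq_zero fun B hB => ?_
      by_cases hA0 : flavorCharge X.species A = 0
      · by_cases hB0 : flavorCharge X.species B = 0
        · rw [(hc ((S \ A) \ B)).1 f σ, mul_zero]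
          intro h
          have h1 := flavorCharge_add_sdiff X.species (Finset.mem_powerset.1 hB)
          rw [hB0, h, zero_add] at h1
          exact e2 A hA hA0 h1.symm
        · rw [(hc B).2 hB0, mdot_zero_right, zero_mul]
      · rw [(hc A).2 hA0, mdot_zero_left, zero_mul]
    · intro A hA
      by_cases hA0 : flavorCharge X.species A = 0
      · rw [(hc _).1 f σ (e2 A hA hA0), mul_zero]
      · rw [(hc A).2 hA0, mdot_zero_right, zero_mul]
  · intro hne
    funext μ
    have e1 : (∑ i ∈ S, if S = {i} then (externalLine X i).photon μ else 0) = 0 := by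
      refine Finset.sum_eq_zero fun i _ => ?_
      split_ifs with h
      · rw [h] at hne
        rw [(chargeConserving_externalLine X i).2 hne]; rfl
      · rfl
    simp only [attachVertex]
    rw [e1, Finset.sum_eq_zero, Finset.sum_eq_zero]
    · simp
    · intro f _
      refine Finset.sum_eq_zero fun A hA => Finset.sum_eq_zero fun B hB => ?_
      by_cases hA0 : flavorCharge X.species A = unitCharge f 1
      · by_cases hB0 : flavorCharge X.species B = unitCharge f (-1)
        · rw [(hc ((S \ A) \ B)).2, Pi.zero_apply, zero_mul, zero_mul]
          intro h
          apply hne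
          rw [← flavorCharge_add_sdiff X.species (Finset.mem_powerset.1 hA),
            ← flavorCharge_add_sdiff X.species (Finset.mem_powerset.1 hB), hA0, hB0, h, add_zero,
            unitCharge_add]
        · rw [(hc B).1 f _ hB0, mul_zero]
      · rw [(hc A).1 f _ hA0, mul_zero, zero_mul]
    · intro f _
      refine Finset.sum_eq_zero fun A hA => ?_
      by_cases hA0 : flavorCharge X.species A = unitCharge f 1
      · by_cases hB0 : flavorCharge X.species (S \ A) = unitCharge f (-1)
        · exact absurd (by rw [← flavorCharge_add_sdiff X.species (Finset.mem_powerset.1 hA), hA0,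
            hB0, unitCharge_add]) hne
        · rw [(hc _).1 f _ hB0, mul_zero]
      · rw [(hc A).1 f _ hA0, mul_zero, zero_mul]

theorem chargeConserving_currents (g : ℝ) (X : OutState ι F) (S : Finset ι) :
    ChargeConserving X.species S (currents g X S) := by
  induction S using Finset.strongInduction with
  | H S ih =>
    rw [currents_eq]
    refine chargeConserving_attachVertex g X _ S fun T => ?_
    split_ifs with h
    · exact ih T h
    · exact chargeConserving_zero _ _

theorem currents_charged_empty (g : ℝ) (X : OutState ι F) (f : F) (σ : ℤˣ) :
    (currents g X ∅).charged f σ = 0 :=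
  (chargeConserving_currents g X ∅).1 f σ
    (by rw [flavorCharge_empty]; exact (unitCharge_ne_zero f σ).symm)

theorem currents_charged_of_photon (g : ℝ) (X : OutState ι F) (f : F) (σ : ℤˣ) {S : Finset ι}
    (h : ∀ i ∈ S, X.species i = .photon) : (currents g X S).charged f σ = 0 :=
  (chargeConserving_currents g X S).1 f σ
    (by rw [flavorCharge_of_photon _ h]; exact (unitCharge_ne_zero f σ).symm)

theorem currents_photon_empty (g : ℝ) (X : OutState ι F) : (currents g X ∅).photon = 0 := by
  funext μ
  rw [currents_eq]
  simp [attachVertex, Currents.zero]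

/-! ### The tree recursion without its restriction to proper subsets -/

/-- The vertices of `attachVertex` on a charged line. -/
def scalarVertex (g : ℝ) (p : ι → Fin 4 → ℝ) (c : Finset ι → Currents F) (f : F) (σ : ℤˣ)
    (S : Finset ι) : ℂ :=
  ((σ : ℤ) : ℂ) * g * ∑ A ∈ S.powerset,
      mdot (toC (totalMom p A + 2 • totalMom p (S \ A))) (c A).photon * (c (S \ A)).charged f σ
    + (g : ℂ) ^ 2 * ∑ A ∈ S.powerset, ∑ B ∈ (S \ A).powerset,
      mdot (c A).photon (c B).photon * (c ((S \ A) \ B)).charged f σ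

/-- The vertices of `attachVertex` on a photon line. -/
def photonVertex (g : ℝ) (p : ι → Fin 4 → ℝ) (c : Finset ι → Currents F) (μ : Fin 4)
    (S : Finset ι) : ℂ :=
  (g : ℂ) * ∑ f : F, ∑ A ∈ S.powerset,
      toC (totalMom p A - totalMom p (S \ A)) μ * (c A).charged f 1 * (c (S \ A)).charged f (-1)
    + 2 * (g : ℂ) ^ 2 * ∑ f : F, ∑ A ∈ S.powerset, ∑ B ∈ (S \ A).powerset,
      (c ((S \ A) \ B)).photon μ * (c A).charged f 1 * (c B).charged f (-1)

/-- A vertex involves only currents of proper subsets. -/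
theorem scalarVertex_congr (g : ℝ) (p : ι → Fin 4 → ℝ) {c c' : Finset ι → Currents F} (f : F)
    (σ : ℤˣ) {S : Finset ι} (h : ∀ T, T ⊆ S → T ≠ S → c T = c' T)
    (h1 : (c ∅).charged f σ = 0) (h1' : (c' ∅).charged f σ = 0)
    (h2 : (c ∅).photon = 0) (h2' : (c' ∅).photon = 0) :
    scalarVertex g p c f σ S = scalarVertex g p c' f σ S := by
  unfold scalarVertex
  congr 2
  · refine Finset.sum_congr rfl fun A hA => ?_
    rw [Finset.mem_powerset] at hA
    by_cases hAS : A = S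
    · subst hAS; rw [Finset.sdiff_self, h1, h1', mul_zero, mul_zero]
    · by_cases hA' : S \ A = S
      · have : A = ∅ := by
          rw [Finset.sdiff_eq_self_iff_disjoint] at hA'
          exact Finset.disjoint_self_iff_empty _ |>.1 (hA'.mono_left hA)
        subst this
        rw [h2, h2', mdot_zero_right, zero_mul, zero_mul]
      · rw [h A hA hAS, h _ Finset.sdiff_subset hA']
  · refine Finset.sum_congr rfl fun A hA => Finset.sum_congr rfl fun B hB => ?_
    rw [Finset.mem_powerset] at hA hB
    by_cases hAS : A = S
    · subst hAS; simp [h1, h1']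
    · by_cases hBS : B = S
      · subst hBS
        have : (B \ A) \ B = ∅ := by
          rw [Finset.sdiff_eq_empty_iff_subset]; exact Finset.sdiff_subset
        rw [this, h1, h1', mul_zero, mul_zero]
      · by_cases hC : (S \ A) \ B = S
        · have : A = ∅ := by
            have h3 : (S \ A) \ B ⊆ S \ A := Finset.sdiff_subset
            rw [hC] at h3
            exact Finset.disjoint_self_iff_empty _ |>.1
              (Finset.disjoint_of_subset_left hA (Finset.subset_sdiff.1 h3).2)
          subst this
          simp [h2, h2', mdot_zero_left]
        · rw [h A hA hAS, h B (hB.trans Finset.sdiff_subset) hBS,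
            h _ (Finset.sdiff_subset.trans Finset.sdiff_subset) hC]

/-- A leg that carries all of `S` leaves the others empty, and at least one of these is charged.
Hence only the charged currents have to vanish on `∅`. -/
theorem photonVertex_congr (g : ℝ) (p : ι → Fin 4 → ℝ) {c c' : Finset ι → Currents F} (μ : Fin 4)
    {S : Finset ι} (h : ∀ T, T ⊆ S → T ≠ S → c T = c' T)
    (h1 : ∀ f σ, (c ∅).charged f σ = 0) (h1' : ∀ f σ, (c' ∅).charged f σ = 0) :
    photonVertex g p c μ S = photonVertex g p c' μ S := by
  have hS : ∀ A, A ⊆ S → S \ A = S → A = ∅ := fun A hA hA' => by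
    rw [Finset.sdiff_eq_self_iff_disjoint] at hA'
    exact Finset.disjoint_self_iff_empty _ |>.1 (hA'.mono_left hA)
  unfold photonVertex
  congr 2
  · refine Finset.sum_congr rfl fun f _ => Finset.sum_congr rfl fun A hA => ?_
    rw [Finset.mem_powerset] at hA
    by_cases hAS : A = S
    · subst hAS; rw [Finset.sdiff_self, h1, h1', mul_zero, mul_zero]
    · by_cases hA' : S \ A = S
      · obtain rfl := hS A hA hA'
        rw [h1, h1', mul_zero, zero_mul, zero_mul]
      · rw [h A hA hAS, h _ Finset.sdiff_subset hA']
  · refine Finset.sum_congr rfl fun f _ => Finset.sum_congr rfl fun A hA =>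
      Finset.sum_congr rfl fun B hB => ?_
    rw [Finset.mem_powerset] at hA hB
    by_cases hAS : A = S
    · subst hAS
      obtain rfl : B = ∅ := by simpa using hB
      rw [h1, h1', mul_zero, mul_zero]
    · by_cases hBS : B = S
      · subst hBS
        obtain rfl := hS A hA (Finset.Subset.antisymm Finset.sdiff_subset hB)
        simp [h1, h1']
      · by_cases hC : (S \ A) \ B = S
        · have h3 : (S \ A) \ B ⊆ S \ A := Finset.sdiff_subset
          rw [hC] at h3
          obtain rfl := hS A hA (Finset.Subset.antisymm Finset.sdiff_subset h3)
          simp [h1, h1']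
        · rw [h A hA hAS, h B (hB.trans Finset.sdiff_subset) hBS,
            h _ (Finset.sdiff_subset.trans Finset.sdiff_subset) hC]

/-- Allowing all subsets as legs turns the recursion into an identity between full convolutions,
which can be read as a field equation. -/
theorem currents_charged_eq (g : ℝ) (X : OutState ι F) (f : F) (σ : ℤˣ) (S : Finset ι) :
    (currents g X S).charged f σ =
      (∑ i ∈ S, if S = {i} then (externalLine X i).charged f σ else 0)
        - scalarVertex g X.mom (currents g X) f σ S
          / ((mdot (totalMom X.mom S) (totalMom X.mom S) : ℝ) : ℂ) := by
  conv_lhs => rw [currents_eq]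
  change _ - scalarVertex g X.mom _ f σ S / _ = _
  rw [scalarVertex_congr g X.mom f σ (c' := currents g X)]
  · intro T hT hne; exact if_pos (Finset.ssubset_iff_subset_ne.2 ⟨hT, hne⟩)
  · split_ifs
    · exact currents_charged_empty g X f σ
    · rfl
  · exact currents_charged_empty g X f σ
  · split_ifs
    · exact currents_photon_empty g X
    · rfl
  · exact currents_photon_empty g X

theorem currents_photon_eq (g : ℝ) (X : OutState ι F) (μ : Fin 4) (S : Finset ι) :
    (currents g X S).photon μ =
      (∑ i ∈ S, if S = {i} then (externalLine X i).photon μ else 0)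
        + photonVertex g X.mom (currents g X) μ S
          / ((mdot (totalMom X.mom S) (totalMom X.mom S) : ℝ) : ℂ) := by
  conv_lhs => rw [currents_eq]
  change _ + photonVertex g X.mom _ μ S / _ = _
  rw [photonVertex_congr g X.mom μ (c' := currents g X)]
  · intro T hT hne; exact if_pos (Finset.ssubset_iff_subset_ne.2 ⟨hT, hne⟩)
  · intro f σ; split_ifs
    · exact currents_charged_empty g X f σ
    · rfl
  · exact currents_charged_empty g X

theorem scalarVertex_eq_zero_of_photon (g : ℝ) (X : OutState ι F) (f : F) (σ : ℤˣ)
    {S : Finset ι} (h : ∀ i ∈ S, X.species i = .photon) :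
    scalarVertex g X.mom (currents g X) f σ S = 0 := by
  unfold scalarVertex
  rw [Finset.sum_eq_zero, Finset.sum_eq_zero, mul_zero, mul_zero, add_zero]
  · intro A _
    refine Finset.sum_eq_zero fun B _ => ?_
    rw [currents_charged_of_photon, mul_zero]
    intro i hi
    exact h i (Finset.mem_sdiff.1 (Finset.mem_sdiff.1 hi).1).1
  · intro A _
    rw [currents_charged_of_photon, mul_zero]
    intro i hi
    exact h i (Finset.mem_sdiff.1 hi).1

theorem photonVertex_eq_zero_of_photon (g : ℝ) (X : OutState ι F) (μ : Fin 4)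
    {S : Finset ι} (h : ∀ i ∈ S, X.species i = .photon) :
    photonVertex g X.mom (currents g X) μ S = 0 := by
  unfold photonVertex
  rw [Finset.sum_eq_zero, Finset.sum_eq_zero, mul_zero, mul_zero, add_zero]
  · intro f _
    refine Finset.sum_eq_zero fun A hA => Finset.sum_eq_zero fun B _ => ?_
    rw [currents_charged_of_photon g X f 1 (S := A), mul_zero, zero_mul]
    intro i hi
    exact h i (Finset.mem_powerset.1 hA hi)
  · intro f _
    refine Finset.sum_eq_zero fun A hA => ?_
    rw [currents_charged_of_photon g X f 1 (S := A), mul_zero, zero_mul]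
    intro i hi
    exact h i (Finset.mem_powerset.1 hA hi)

/-- Photons do not scatter off each other at tree level, since the vertices on a photon line need
charged external particles. This is why no lower bound is needed for the product of two photon
momenta of the same sector. -/
theorem currents_photon_of_photon (g : ℝ) (X : OutState ι F) {S : Finset ι} (hS : 2 ≤ S.card)
    (h : ∀ i ∈ S, X.species i = .photon) : (currents g X S).photon = 0 := by
  funext μ
  rw [currents_photon_eq, photonVertex_eq_zero_of_photon g X μ h, zero_div, add_zero]
  refine Finset.sum_eq_zero fun i _ => if_neg ?_
  rintro rfl
  simp at hS

theorem scalarVertex_singleton (g : ℝ) (X : OutState ι F) (f : F) (σ : ℤˣ) (i : ι) :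
    scalarVertex g X.mom (currents g X) f σ {i} = 0 := by
  have h1 := currents_charged_empty g X f σ
  have h2 := currents_photon_empty g X
  have e : ({i} : Finset ι).powerset = {∅, {i}} := by ext; simp [Finset.subset_singleton_iff]
  have hne : (∅ : Finset ι) ≠ {i} := (Finset.singleton_ne_empty i).symm
  simp [scalarVertex, e, Finset.sum_pair hne, h1, h2, mdot_zero_right, mdot_zero_left]

theorem photonVertex_singleton (g : ℝ) (X : OutState ι F) (μ : Fin 4) (i : ι) :
    photonVertex g X.mom (currents g X) μ {i} = 0 := by
  have h1 := currents_charged_empty g X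
  have h2 := currents_photon_empty g X
  have e : ({i} : Finset ι).powerset = {∅, {i}} := by ext; simp [Finset.subset_singleton_iff]
  have hne : (∅ : Finset ι) ≠ {i} := (Finset.singleton_ne_empty i).symm
  simp [photonVertex, e, Finset.sum_pair hne, h1, h2]

theorem currents_singleton_charged (g : ℝ) (X : OutState ι F) (f : F) (σ : ℤˣ) (i : ι) :
    (currents g X {i}).charged f σ = (externalLine X i).charged f σ := by
  rw [currents_charged_eq, scalarVertex_singleton]; simp

theorem currents_singleton_photon (g : ℝ) (X : OutState ι F) (i : ι) :
    (currents g X {i}).photon = (externalLine X i).photon := by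
  funext μ
  rw [currents_photon_eq, photonVertex_singleton]; simp

/-- On-shell momenta without vanishing denominators. -/
structure Regular (X : OutState ι F) : Prop where
  massless : ∀ i, mdot (X.mom i) (X.mom i) = 0
  denominator : ∀ S : Finset ι, 2 ≤ S.card → (∃ i ∈ S, X.species i ≠ .photon) →
    mdot (totalMom X.mom S) (totalMom X.mom S) ≠ 0

/-- Only in the last case is a division by `P_S²` to be undone; in the other cases the field
equations hold because every term vanishes. -/
theorem Regular.cases {X : OutState ι F} (h : Regular X) (S : Finset ι) :
    S = ∅ ∨ (∃ i, S = {i}) ∨ (2 ≤ S.card ∧ ∀ i ∈ S, X.species i = .photon) ∨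
      (2 ≤ S.card ∧ ((mdot (totalMom X.mom S) (totalMom X.mom S) : ℝ) : ℂ) ≠ 0) := by
  rcases Nat.lt_or_ge S.card 2 with hlt | hge
  · have : S.card = 0 ∨ S.card = 1 := by omega
    rcases this with h0 | h1
    · exact Or.inl (Finset.card_eq_zero.1 h0)
    · exact Or.inr (Or.inl (Finset.card_eq_one.1 h1))
  · by_cases hp : ∀ i ∈ S, X.species i = .photon
    · exact Or.inr (Or.inr (Or.inl ⟨hge, hp⟩))
    · push Not at hp
      exact Or.inr (Or.inr (Or.inr ⟨hge, by exact_mod_cast h.denominator S hge hp⟩))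

/-- The charged fields. -/
def phi (g : ℝ) (X : OutState ι F) (f : F) (σ : ℤˣ) : Gen ι :=
  Gen.mk fun S => (currents g X S).charged f σ

/-- The photon field. -/
def phot (g : ℝ) (X : OutState ι F) (μ : Fin 4) : Gen ι :=
  Gen.mk fun S => (currents g X S).photon μ

theorem phi_apply (g : ℝ) (X : OutState ι F) (f : F) (σ : ℤˣ) (S : Finset ι) :
    phi g X f σ S = (currents g X S).charged f σ := rfl

theorem phot_apply (g : ℝ) (X : OutState ι F) (μ : Fin 4) (S : Finset ι) :
    phot g X μ S = (currents g X S).photon μ := rfl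

/-- This is the recursion multiplied by `P_S²`. The external lines drop out because they live on
single particles, where `P_S² = 0`; the sign `σ` drops out of the seagull because the charge enters
it squared. -/
theorem Regular.box_phi {X : OutState ι F} (h : Regular X) (g : ℝ) (f : F) (σ : ℤˣ) :
    box X.mom (((σ : ℤ) : ℂ) * g) (phot g X) (phi g X f σ) = 0 := by
  ext S
  have hs : ((((σ : ℤ) : ℂ) * g) ^ 2 : ℂ) = (g : ℂ) ^ 2 := by
    rcases Int.units_eq_one_or σ with rfl | rfl <;> simp
  rw [box_apply, hs]
  change _ * (currents g X S).charged f σ + scalarVertex g X.mom (currents g X) f σ S = 0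
  rcases h.cases S with rfl | ⟨i, rfl⟩ | ⟨_, hp⟩ | ⟨hc, h0⟩
  · rw [scalarVertex_eq_zero_of_photon g X f σ (by simp), totalMom_empty]; simp [mdot]
  · rw [scalarVertex_singleton, totalMom_singleton, h.massless]; simp
  · rw [scalarVertex_eq_zero_of_photon g X f σ hp, currents_charged_of_photon g X f σ hp]; simp
  · rw [currents_charged_eq, Finset.sum_eq_zero]
    · field_simp; ring
    · intro i _
      refine if_neg ?_
      rintro rfl
      simp at hc

/-- The Feynman-gauge wave equation. Its right side is gauge invariant, its left side is not, which
determines how it is used in `Config.photon_eq`. -/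
theorem Regular.sq_mul_phot {X : OutState ι F} (h : Regular X) (g : ℝ) (μ : Fin 4)
    (S : Finset ι) :
    ((mdot (totalMom X.mom S) (totalMom X.mom S) : ℝ) : ℂ) * phot g X μ S =
      emCurrent X.mom g (phi g X) (phot g X) μ S := by
  rw [emCurrent_apply]
  change _ * (currents g X S).photon μ = photonVertex g X.mom (currents g X) μ S
  rcases h.cases S with rfl | ⟨i, rfl⟩ | ⟨hc, hp⟩ | ⟨hc, h0⟩
  · rw [photonVertex_eq_zero_of_photon g X μ (by simp), totalMom_empty]; simp [mdot]
  · rw [photonVertex_singleton, totalMom_singleton, h.massless]; simp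
  · rw [photonVertex_eq_zero_of_photon g X μ hp, currents_photon_of_photon g X hc hp]; simp
  · rw [currents_photon_eq, Finset.sum_eq_zero]
    · field_simp; ring
    · intro i _
      refine if_neg ?_
      rintro rfl
      simp at hc

end TreeCurrents
end ScalarQED
namespace ScalarQED

/-! ### Causal vectors -/

/-- The closed forward light cone. -/
structure Causal (v : Fin 4 → ℝ) : Prop where
  nonneg : 0 ≤ v 0
  sq_le : v 1 ^ 2 + v 2 ^ 2 + v 3 ^ 2 ≤ v 0 ^ 2

theorem inner_sq_le (a b : Fin 4 → ℝ) : (a 1 * b 1 + a 2 * b 2 + a 3 * b 3) ^ 2 ≤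
    (a 1 ^ 2 + a 2 ^ 2 + a 3 ^ 2) * (b 1 ^ 2 + b 2 ^ 2 + b 3 ^ 2) := by
  nlinarith [sq_nonneg (a 1 * b 2 - a 2 * b 1), sq_nonneg (a 1 * b 3 - a 3 * b 1),
    sq_nonneg (a 2 * b 3 - a 3 * b 2)]

theorem Causal.of_null {v : Fin 4 → ℝ} (h0 : 0 ≤ v 0) (h : mdot v v = 0) : Causal v :=
  ⟨h0, by simp only [mdot] at h; nlinarith⟩

theorem Causal.abs_inner_le {u v : Fin 4 → ℝ} (hu : Causal u) (hv : Causal v) :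
    |u 1 * v 1 + u 2 * v 2 + u 3 * v 3| ≤ u 0 * v 0 := by
  refine abs_le_of_sq_le_sq ?_ (mul_nonneg hu.nonneg hv.nonneg)
  rw [mul_pow]
  exact (inner_sq_le u v).trans (mul_le_mul hu.sq_le hv.sq_le (by positivity) (by positivity))

theorem Causal.mdot_nonneg {u v : Fin 4 → ℝ} (hu : Causal u) (hv : Causal v) : 0 ≤ mdot u v := by
  have := (abs_le.1 (hu.abs_inner_le hv)).2
  simp only [mdot]; linarith

theorem Causal.mdot_le {u v : Fin 4 → ℝ} (hu : Causal u) (hv : Causal v) :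
    mdot u v ≤ 2 * (u 0 * v 0) := by
  have := (abs_le.1 (hu.abs_inner_le hv)).1
  simp only [mdot]; linarith

theorem Causal.zero : Causal 0 := ⟨le_rfl, by simp⟩

theorem Causal.add {u v : Fin 4 → ℝ} (hu : Causal u) (hv : Causal v) : Causal (u + v) := by
  refine ⟨add_nonneg hu.nonneg hv.nonneg, ?_⟩
  have := (abs_le.1 (hu.abs_inner_le hv)).2
  have h1 := hu.sq_le
  have h2 := hv.sq_le
  simp only [Pi.add_apply]
  nlinarith

theorem Causal.sum {ι : Type*} {p : ι → Fin 4 → ℝ} (hp : ∀ i, Causal (p i)) (S : Finset ι) :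
    Causal (totalMom p S) := by
  classical
  unfold totalMom
  induction S using Finset.induction_on with
  | empty => exact Causal.zero
  | insert a s ha ih => rw [Finset.sum_insert ha]; exact (hp a).add ih

theorem Causal.smul {v : Fin 4 → ℝ} (hv : Causal v) {c : ℝ} (hc : 0 ≤ c) : Causal (c • v) := by
  refine ⟨mul_nonneg hc hv.nonneg, ?_⟩
  have := mul_le_mul_of_nonneg_left hv.sq_le (sq_nonneg c)
  simp only [Pi.smul_apply, smul_eq_mul]
  nlinarith

theorem Causal.abs_le {v : Fin 4 → ℝ} (hv : Causal v) (μ : Fin 4) : |v μ| ≤ v 0 := by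
  refine abs_le_of_sq_le_sq ?_ hv.nonneg
  have := hv.sq_le
  fin_cases μ
  · exact le_rfl
  · simp only [Fin.mk_one]; nlinarith [sq_nonneg (v 2), sq_nonneg (v 3)]
  · simp only [Fin.reduceFinMk]; nlinarith [sq_nonneg (v 1), sq_nonneg (v 3)]
  · simp only [Fin.reduceFinMk]; nlinarith [sq_nonneg (v 2), sq_nonneg (v 1)]

theorem mdot_sum_right {ι : Type*} (u : Fin 4 → ℝ) (p : ι → Fin 4 → ℝ) (S : Finset ι) :
    mdot u (totalMom p S) = ∑ i ∈ S, mdot u (p i) := by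
  simp only [mdot, totalMom_apply, Finset.mul_sum, ← Finset.sum_sub_distrib]

theorem mdot_sum_left {ι : Type*} (u : Fin 4 → ℝ) (p : ι → Fin 4 → ℝ) (S : Finset ι) :
    mdot (totalMom p S) u = ∑ i ∈ S, mdot (p i) u := by
  simp only [mdot, totalMom_apply, Finset.sum_mul, ← Finset.sum_sub_distrib]

theorem le_mdot_totalMom {ι : Type*} {p : ι → Fin 4 → ℝ} (hp : ∀ i, Causal (p i)) {u : Fin 4 → ℝ}
    (hu : Causal u) {S : Finset ι} {i : ι} (hi : i ∈ S) : mdot u (p i) ≤ mdot u (totalMom p S) := by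
  rw [mdot_sum_right]
  exact Finset.single_le_sum (f := fun i => mdot u (p i)) (fun k _ => hu.mdot_nonneg (hp k)) hi

theorem le_mdot_totalMom_self {ι : Type*} {p : ι → Fin 4 → ℝ} (hp : ∀ i, Causal (p i))
    {S : Finset ι} {i i' : ι} (hi : i ∈ S) (hi' : i' ∈ S) :
    mdot (p i) (p i') ≤ mdot (totalMom p S) (totalMom p S) := by
  refine (le_mdot_totalMom hp (hp i) hi').trans ?_
  rw [mdot_comm (p i)]
  exact le_mdot_totalMom hp (Causal.sum hp S) hi

/-- Replacing a null vector by a null direction that is almost parallel to it. -/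
theorem sq_mdot_sub_le {p n v : Fin 4 → ℝ} (hp : mdot p p = 0) (hn : mdot n n = 0) (hn0 : n 0 = 1)
    (hv : Causal v) (h : 0 ≤ p 0 * mdot n p) :
    (p 0 * mdot n v - mdot p v) ^ 2 ≤ 2 * (p 0 * mdot n p) * v 0 ^ 2 := by
  have h1 := inner_sq_le (p - p 0 • n) v
  have h2 : p 0 * mdot n v - mdot p v = (p - p 0 • n) 1 * v 1 + (p - p 0 • n) 2 * v 2
      + (p - p 0 • n) 3 * v 3 := by
    simp only [mdot, Pi.sub_apply, Pi.smul_apply, smul_eq_mul, hn0]; ring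
  -- `p - p⁰ n` has no time component, so its Euclidean length squared is minus its Minkowski
  -- square, which is `2 p⁰ (n·p)` for null `p` and `n`.
  have h3 : (p - p 0 • n) 1 ^ 2 + (p - p 0 • n) 2 ^ 2 + (p - p 0 • n) 3 ^ 2 =
      2 * (p 0 * mdot n p) := by
    simp only [mdot, Pi.sub_apply, Pi.smul_apply, smul_eq_mul, hn0] at *
    linear_combination (-1) * hp - p 0 ^ 2 * hn
  rw [h2]
  refine h1.trans ?_
  rw [h3]
  exact mul_le_mul_of_nonneg_left hv.sq_le (by linarith)

/-- A vector orthogonal to two separated forward vectors is space-like. -/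
theorem spatial_sq_le_of_orthogonal {t q a : Fin 4 → ℝ} {κ : ℝ} (ht : Causal t) (ht0 : t 0 = 1)
    (hq : Causal q) (hq0 : 0 < q 0) (hκ : κ * q 0 ≤ mdot t q) (hta : mdot t a = 0)
    (hqa : mdot q a = 0) :
    κ / 2 * (a 1 ^ 2 + a 2 ^ 2 + a 3 ^ 2) ≤ -mdot a a := by
  obtain ⟨u, hu⟩ : ∃ u : Fin 4 → ℝ, u = (q 0)⁻¹ • q := ⟨_, rfl⟩
  have huC : Causal u := hu ▸ hq.smul (inv_nonneg.2 hq0.le)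
  have hu0 : u 0 = 1 := by rw [hu]; simp [hq0.ne']
  have hua : mdot u a = 0 := by
    have : mdot u a = (q 0)⁻¹ * mdot q a := by
      rw [hu]; simp only [mdot, Pi.smul_apply, smul_eq_mul]; ring
    rw [this, hqa, mul_zero]
  have htu : κ ≤ mdot t u := by
    have : mdot t u = mdot t q / q 0 := by
      rw [hu]; simp only [mdot, Pi.smul_apply, smul_eq_mul]; ring
    rw [this, le_div_iff₀ hq0]; exact hκ
  -- Both `t` and `u = q / q⁰` have unit time component. Orthogonality makes the spatial product of
  -- `t + u` with `a` equal to `2 a⁰`, and separation bounds the spatial length squared of `t + u`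
  -- by `4 - 2κ`; Cauchy–Schwarz then bounds `(a⁰)²` by `1 - κ/2` times the spatial square of `a`.
  have h1 := inner_sq_le (t + u) a
  have h2 : (t + u) 1 * a 1 + (t + u) 2 * a 2 + (t + u) 3 * a 3 = 2 * a 0 := by
    simp only [mdot, Pi.add_apply, ht0, hu0] at *; linarith
  have h3 : (t + u) 1 ^ 2 + (t + u) 2 ^ 2 + (t + u) 3 ^ 2 ≤ 4 - 2 * κ := by
    have h4 := ht.sq_le
    have h5 := huC.sq_le
    simp only [mdot, Pi.add_apply, ht0, hu0] at *
    nlinarith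
  rw [h2] at h1
  have h6 : (0 : ℝ) ≤ a 1 ^ 2 + a 2 ^ 2 + a 3 ^ 2 := by positivity
  have h7 := h1.trans (mul_le_mul_of_nonneg_right h3 h6)
  simp only [mdot]
  nlinarith

/-- A normalized complex vector orthogonal to two separated forward vectors is bounded. -/
theorem norm_le_of_orthogonal {t q : Fin 4 → ℝ} {ε : Fin 4 → ℂ} {κ : ℝ} (hκ0 : 0 < κ)
    (ht : Causal t) (ht0 : t 0 = 1) (hq : Causal q) (hq0 : 0 < q 0) (hκ : κ * q 0 ≤ mdot t q)
    (hn : mdot (fun μ => conj (ε μ)) ε = -1) (htε : mdot (toC t) ε = 0)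
    (hqε : mdot (toC q) ε = 0) (μ : Fin 4) : ‖ε μ‖ ≤ 2 / κ + 2 := by
  -- The vectors `t` and `q` are real, so the real and imaginary parts of `ε` are orthogonal to them
  -- separately.
  have hre : ∀ v : Fin 4 → ℝ, mdot (toC v) ε = 0 → mdot v (fun μ => (ε μ).re) = 0 := fun v h => by
    have := congrArg Complex.re h
    simpa [mdot, toC] using this
  have him : ∀ v : Fin 4 → ℝ, mdot (toC v) ε = 0 → mdot v (fun μ => (ε μ).im) = 0 := fun v h => by
    have := congrArg Complex.im h
    simpa [mdot, toC] using this
  have h1 := spatial_sq_le_of_orthogonal ht ht0 hq hq0 hκ (hre t htε) (hre q hqε)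
  have h2 := spatial_sq_le_of_orthogonal ht ht0 hq hq0 hκ (him t htε) (him q hqε)
  have h3 := congrArg Complex.re hn
  simp only [mdot, Complex.sub_re, Complex.mul_re, Complex.conj_re, Complex.conj_im,
    Complex.neg_re, Complex.one_re] at h1 h2 h3
  have hsq : ‖ε μ‖ ^ 2 ≤ 2 / κ + 2 := by
    rw [Complex.sq_norm, Complex.normSq_apply]
    have h4 : (ε 1).re ^ 2 + (ε 2).re ^ 2 + (ε 3).re ^ 2 + ((ε 1).im ^ 2 + (ε 2).im ^ 2
        + (ε 3).im ^ 2) ≤ 2 / κ := by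
      rw [le_div_iff₀ hκ0]; nlinarith
    have h5 : (ε 0).re ^ 2 + (ε 0).im ^ 2 ≤ 2 / κ := by nlinarith
    have : (0 : ℝ) < 2 / κ := by positivity
    fin_cases μ
    · simp only [Fin.zero_eta]; nlinarith
    · simp only [Fin.mk_one]
      nlinarith [sq_nonneg (ε 2).re, sq_nonneg (ε 3).re, sq_nonneg (ε 2).im, sq_nonneg (ε 3).im]
    · simp only [Fin.reduceFinMk]
      nlinarith [sq_nonneg (ε 1).re, sq_nonneg (ε 3).re, sq_nonneg (ε 1).im, sq_nonneg (ε 3).im]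
    · simp only [Fin.reduceFinMk]
      nlinarith [sq_nonneg (ε 2).re, sq_nonneg (ε 1).re, sq_nonneg (ε 2).im, sq_nonneg (ε 1).im]
  have : (0 : ℝ) < 2 / κ := by positivity
  -- The number `2 / κ + 2` exceeds `1`, so as a bound on the square it also bounds the norm.
  nlinarith [norm_nonneg (ε μ)]

/-! ### Light-like directions -/

theorem lightDirection_zero (P : Fin 4 → ℝ) : lightDirection P 0 = 1 := rfl

theorem lightDirection_of_ne {P : Fin 4 → ℝ} {μ : Fin 4} (h : μ ≠ 0) :
    lightDirection P μ = P μ / spatialNorm P := if_neg h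

theorem spatialNorm_sq (P : Fin 4 → ℝ) : spatialNorm P ^ 2 = P 1 ^ 2 + P 2 ^ 2 + P 3 ^ 2 :=
  Real.sq_sqrt (by positivity)

theorem lightDirection_null {P : Fin 4 → ℝ} (h : 0 < spatialNorm P) :
    mdot (lightDirection P) (lightDirection P) = 0 := by
  have h1 := spatialNorm_sq P
  simp only [mdot, lightDirection_zero, lightDirection_of_ne (show (1 : Fin 4) ≠ 0 by decide),
    lightDirection_of_ne (show (2 : Fin 4) ≠ 0 by decide),
    lightDirection_of_ne (show (3 : Fin 4) ≠ 0 by decide)]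
  field_simp
  linarith

/-- True even if the spatial part vanishes: division by zero then leaves `(1, 0, 0, 0)`. Causality
of the jet directions therefore needs no small `lam`, in contrast to nullity. -/
theorem lightDirection_causal (P : Fin 4 → ℝ) : Causal (lightDirection P) := by
  have h0 : 0 ≤ spatialNorm P := Real.sqrt_nonneg _
  rcases h0.eq_or_lt with h | h
  · refine ⟨by rw [lightDirection_zero]; norm_num, ?_⟩
    simp only [lightDirection_zero, lightDirection_of_ne (show (1 : Fin 4) ≠ 0 by decide),
      lightDirection_of_ne (show (2 : Fin 4) ≠ 0 by decide),
      lightDirection_of_ne (show (3 : Fin 4) ≠ 0 by decide), ← h]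
    norm_num
  · exact Causal.of_null (by rw [lightDirection_zero]; norm_num) (lightDirection_null h)

/-- The left side is `|P| p⁰` minus the spatial product of `P` and `p`, and `|P| ≤ P⁰`. Bounds on
`P·p` thus become bounds on `n·p`. -/
theorem spatialNorm_mul_mdot_le {P p : Fin 4 → ℝ} (hP : Causal P) (hp : 0 ≤ p 0)
    (h : 0 < spatialNorm P) : spatialNorm P * mdot (lightDirection P) p ≤ mdot P p := by
  have h1 : spatialNorm P ≤ P 0 :=
    abs_le_of_sq_le_sq' (by rw [spatialNorm_sq]; exact hP.sq_le) hP.nonneg |>.2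
  have h2 : spatialNorm P * mdot (lightDirection P) p =
      spatialNorm P * p 0 - P 1 * p 1 - P 2 * p 2 - P 3 * p 3 := by
    simp only [mdot, lightDirection_zero, lightDirection_of_ne (show (1 : Fin 4) ≠ 0 by decide),
      lightDirection_of_ne (show (2 : Fin 4) ≠ 0 by decide),
      lightDirection_of_ne (show (3 : Fin 4) ≠ 0 by decide)]
    field_simp
  rw [h2]
  simp only [mdot]
  nlinarith

end ScalarQED
namespace ScalarQED

/-! ### Configurations -/

/-- The kinematic data of an `N`-jet state with a given particle content. -/
structure Config {ι F : Type*} [Fintype ι] {N : ℕ} (species : ι → Species F)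
    (sector : ι → Option (Fin N)) (K : ℝ) where
  lam : ℝ
  p : ι → Fin 4 → ℝ
  ref : ι → Fin 4 → ℝ
  pol : ι → Fin 4 → ℂ
  t : Fin N → Fin 4 → ℝ
  lam_pos : 0 < lam
  kin : IsNJetKinematics species sector K lam p
  isPol : ∀ i, species i = .photon → IsPolarization (p i) (ref i) (pol i)
  isDir : ∀ j, IsWilsonDirection K (jetDirection sector p j) (t j)

namespace Config

open Filter

variable {ι F : Type*} [Fintype ι] {N : ℕ} {species : ι → Species F}
  {sector : ι → Option (Fin N)} {K : ℝ}

/-- The limit of a small power-counting parameter. -/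
def small : Filter (Config species sector K) := comap lam (𝓝[>] 0)

/-- The jet directions. -/
def n (x : Config species sector K) (j : Fin N) : Fin 4 → ℝ := jetDirection sector x.p j

/-- The external state. -/
def state (x : Config species sector K) : OutState ι F := ⟨species, x.p, x.pol⟩

/-! ### Consequences of the kinematic assumptions for small `lam` -/

theorem eventually_lam_lt {c : ℝ} (hc : 0 < c) :
    ∀ᶠ x : Config species sector K in small, x.lam < c :=
  Filter.Eventually.comap (p := fun y : ℝ => y < c)
    (mem_nhdsWithin_of_mem_nhds (Iio_mem_nhds hc)) lam

theorem causal (x : Config species sector K) (i : ι) : Causal (x.p i) :=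
  Causal.of_null (x.kin.energy_pos i).le (x.kin.massless i)

theorem n_zero (x : Config species sector K) (j : Fin N) : x.n j 0 = 1 := rfl

theorem n_causal (x : Config species sector K) (j : Fin N) : Causal (x.n j) :=
  lightDirection_causal _

theorem t_causal (x : Config species sector K) (j : Fin N) : Causal (x.t j) :=
  Causal.of_null (x.isDir j).pos.le (x.isDir j).null

theorem energy_le (x : Config species sector K) {i : ι} {j : Fin N} (h : sector i = some j) :
    x.p i 0 ≤ K := (x.kin.jet_energy i (by simp [h])).2

theorem le_energy (x : Config species sector K) {i : ι} {j : Fin N} (h : sector i = some j) :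
    K⁻¹ ≤ x.p i 0 := (x.kin.jet_energy i (by simp [h])).1

theorem mem_sectorSet {i : ι} {s : Option (Fin N)} : i ∈ sectorSet sector s ↔ sector i = s := by
  simp [sectorSet]

theorem mdot_le_of_jet (hK : 0 < K) (x : Config species sector K) {i i' : ι} {j : Fin N}
    (h : sector i = some j) (h' : sector i' = some j) :
    mdot (x.p i) (x.p i') ≤ K * x.lam ^ 2 := by
  by_cases hii : i = i'
  · subst hii; rw [x.kin.massless]; positivity
  · exact x.kin.collinear i i' j hii h h'

theorem mdot_jet_le (hK : 0 < K) (x : Config species sector K) {i : ι} {j : Fin N}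
    (h : sector i = some j) :
    mdot (totalMom x.p (sectorSet sector (some j))) (x.p i) ≤
      Fintype.card ι * (K * x.lam ^ 2) := by
  rw [mdot_sum_left]
  refine (Finset.sum_le_card_nsmul _ _ (K * x.lam ^ 2) fun i' hi' => ?_).trans ?_
  · exact x.mdot_le_of_jet hK (mem_sectorSet.1 hi') h
  · rw [nsmul_eq_mul]
    have := x.lam_pos
    exact mul_le_mul_of_nonneg_right (by exact_mod_cast Finset.card_le_univ _) (by positivity)

/-- The energy of the jet is at least `K⁻¹` and its invariant mass squared is `O(lam²)`, so the
spatial momentum cannot be small. -/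
theorem eventually_spatialNorm (hK : 0 < K) {i : ι} {j : Fin N} (h : sector i = some j) :
    ∀ᶠ x : Config species sector K in small,
      K⁻¹ / 2 ≤ spatialNorm (totalMom x.p (sectorSet sector (some j))) := by
  have hcard : 0 < Fintype.card ι := Fintype.card_pos_iff.2 ⟨i⟩
  have hM : 0 < (Fintype.card ι : ℝ) := by exact_mod_cast hcard
  -- Below this threshold the invariant mass squared is at most `K⁻² / 2`, after estimating `lam²`
  -- by `lam`.
  filter_upwards [eventually_lam_lt (species := species) (sector := sector) (K := K)
    (c := min 1 (K⁻¹ ^ 2 / (2 * (Fintype.card ι * (Fintype.card ι * K))))) (by positivity)]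
    with x hx
  have h0 := x.lam_pos
  have h1 : x.lam < 1 := hx.trans_le (min_le_left _ _)
  have h2 := hx.trans_le (min_le_right _ _)
  set P := totalMom x.p (sectorSet sector (some j)) with hP
  have hPC : Causal P := Causal.sum x.causal _
  have hP0 : K⁻¹ ≤ P 0 := by
    refine (x.le_energy h).trans ?_
    rw [hP, totalMom_apply]
    exact Finset.single_le_sum (f := fun i => x.p i 0) (fun k _ => (x.causal k).nonneg)
      (mem_sectorSet.2 h)
  have hPP : mdot P P ≤ Fintype.card ι * (Fintype.card ι * (K * x.lam ^ 2)) := by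
    conv_lhs => rw [hP, mdot_sum_right]
    refine (Finset.sum_le_card_nsmul _ _ (Fintype.card ι * (K * x.lam ^ 2)) fun i' hi' => ?_).trans
      ?_
    · exact x.mdot_jet_le hK (mem_sectorSet.1 hi')
    · rw [nsmul_eq_mul]
      exact mul_le_mul_of_nonneg_right (by exact_mod_cast Finset.card_le_univ _) (by positivity)
  have h3 : (Fintype.card ι * (Fintype.card ι * (K * x.lam ^ 2)) : ℝ) ≤ K⁻¹ ^ 2 / 2 := by
    rw [lt_div_iff₀ (by positivity)] at h2
    have : x.lam ^ 2 ≤ x.lam := by nlinarith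
    have h4 : (Fintype.card ι * (Fintype.card ι * (K * x.lam ^ 2)) : ℝ) ≤
      Fintype.card ι * (Fintype.card ι * (K * x.lam)) := by gcongr
    linarith
  have hs : K⁻¹ ^ 2 / 2 ≤ spatialNorm P ^ 2 := by
    rw [spatialNorm_sq]
    simp only [mdot] at hPP
    have : K⁻¹ ^ 2 ≤ P 0 ^ 2 := pow_le_pow_left₀ (by positivity) hP0 2
    nlinarith
  have hK' : 0 < K⁻¹ := inv_pos.2 hK
  exact le_of_sq_le_sq (by nlinarith) (Real.sqrt_nonneg _)

theorem eventually_n_null (hK : 0 < K) {i : ι} {j : Fin N} (h : sector i = some j) :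
    ∀ᶠ x : Config species sector K in small, mdot (x.n j) (x.n j) = 0 := by
  filter_upwards [eventually_spatialNorm hK h] with x hx
  exact lightDirection_null (lt_of_lt_of_le (by positivity) hx)

/-- From `|P| (n·p) ≤ P·p`: the products of momenta in a jet are `O(lam²)`, and `|P|` is bounded
below. -/
theorem eventually_n_mdot_le (hK : 0 < K) {i : ι} {j : Fin N} (h : sector i = some j) :
    ∃ C : ℝ, 0 < C ∧ ∀ᶠ x : Config species sector K in small,
      mdot (x.n j) (x.p i) ≤ C * x.lam ^ 2 := by
  have hM : 0 < (Fintype.card ι : ℝ) := by exact_mod_cast Fintype.card_pos_iff.2 ⟨i⟩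
  refine ⟨2 * K * (Fintype.card ι * K), by positivity, ?_⟩
  filter_upwards [eventually_spatialNorm hK h] with x hx
  have hpos : 0 < spatialNorm (totalMom x.p (sectorSet sector (some j))) :=
    lt_of_lt_of_le (by positivity) hx
  have h1 := (spatialNorm_mul_mdot_le (Causal.sum x.causal _) (x.causal i).nonneg hpos).trans
    (x.mdot_jet_le hK h)
  have h2 : 0 ≤ mdot (x.n j) (x.p i) := (x.n_causal j).mdot_nonneg (x.causal i)
  have h3 : K⁻¹ / 2 * mdot (x.n j) (x.p i) ≤ Fintype.card ι * (K * x.lam ^ 2) :=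
    (mul_le_mul_of_nonneg_right hx h2).trans h1
  have h4 := mul_le_mul_of_nonneg_left h3 (show 0 ≤ 2 * K by positivity)
  have h5 : 2 * K * (K⁻¹ / 2 * mdot (x.n j) (x.p i)) = mdot (x.n j) (x.p i) := by field_simp
  rw [h5] at h4
  linarith

/-- A vector separated from a jet direction is separated from the particles of the jet. -/
theorem eventually_separated (hK : 0 < K) {i : ι} {j : Fin N} (h : sector i = some j)
    {v : Config species sector K → Fin 4 → ℝ} (hv : ∀ x, Causal (v x)) {κ : ℝ} (hκ : 0 < κ)
    (hn : ∀ᶠ x in small, κ * v x 0 ≤ mdot (x.n j) (v x)) :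
    ∃ κ' : ℝ, 0 < κ' ∧ ∀ᶠ x : Config species sector K in small,
      κ' * v x 0 ≤ mdot (x.p i) (v x) := by
  obtain ⟨C, hC, hC'⟩ := eventually_n_mdot_le (species := species) hK h
  refine ⟨K⁻¹ * κ / 2, by positivity, ?_⟩
  filter_upwards [hn, hC', eventually_n_null hK h,
    eventually_lam_lt (species := species) (sector := sector) (K := K)
      (c := K⁻¹ * κ / (2 * (2 * (K * C) + 1))) (by positivity)] with x h1 h2 h3 h4
  have h0 := x.lam_pos
  have h5 : 0 ≤ mdot (x.n j) (x.p i) := (x.n_causal j).mdot_nonneg (x.causal i)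
  -- Replacing `p` by `p⁰ n` changes the product with `v` by `O(lam) v⁰`, which for small `lam`
  -- costs at most half of the lower bound.
  have h6 := sq_mdot_sub_le (x.kin.massless i) h3 (x.n_zero j) (hv x)
    (mul_nonneg (x.causal i).nonneg h5)
  have hv0 := (hv x).nonneg
  have h7 : x.p i 0 * mdot (x.n j) (x.p i) ≤ K * (C * x.lam ^ 2) :=
    mul_le_mul (x.energy_le h) h2 h5 hK.le
  have h8 : (x.p i 0 * mdot (x.n j) (v x) - mdot (x.p i) (v x)) ^ 2 ≤
      ((2 * (K * C) + 1) * x.lam * v x 0) ^ 2 := by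
    refine h6.trans ?_
    have h9 : 2 * (x.p i 0 * mdot (x.n j) (x.p i)) ≤ ((2 * (K * C) + 1) * x.lam) ^ 2 := by
      have : 0 ≤ (K * C) * x.lam ^ 2 := by positivity
      have : 0 ≤ ((K * C) * x.lam) ^ 2 := by positivity
      nlinarith [sq_nonneg x.lam]
    calc 2 * (x.p i 0 * mdot (x.n j) (x.p i)) * v x 0 ^ 2
        ≤ ((2 * (K * C) + 1) * x.lam) ^ 2 * v x 0 ^ 2 :=
          mul_le_mul_of_nonneg_right h9 (sq_nonneg _)
      _ = _ := by ring
  have h10 := (abs_le_of_sq_le_sq' h8 (by positivity)).2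
  have h11 : (2 * (K * C) + 1) * x.lam ≤ K⁻¹ * κ / 2 := by
    rw [lt_div_iff₀ (by positivity)] at h4
    linarith
  have h12 : K⁻¹ * (κ * v x 0) ≤ x.p i 0 * mdot (x.n j) (v x) :=
    mul_le_mul (x.le_energy h) h1 (by positivity) (x.causal i).nonneg
  have h13 := mul_le_mul_of_nonneg_right h11 hv0
  linarith

theorem eventually_t_separated (hK : 0 < K) {i : ι} {j : Fin N} (h : sector i = some j) :
    ∃ κ : ℝ, 0 < κ ∧ ∀ᶠ x : Config species sector K in small,
      κ * x.t j 0 ≤ mdot (x.p i) (x.t j) := by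
  refine eventually_separated hK h (fun x => x.t_causal j) (inv_pos.2 hK) ?_
  exact Eventually.of_forall fun x => by
    have := (x.isDir j).not_collinear
    rwa [mdot_comm] at this

/-- Separation is passed on twice: from two jet directions to a direction and a particle, then to
two particles. The trivial power `lam ^ 0` is the shape that `den_lower` takes. -/
theorem eventually_jets_separated (hK : 0 < K) {i i' : ι} {j k : Fin N} (h : sector i = some j)
    (h' : sector i' = some k) (hjk : j ≠ k) :
    ∃ κ : ℝ, 0 < κ ∧ ∀ᶠ x : Config species sector K in small,
      κ * x.lam ^ 0 ≤ mdot (x.p i) (x.p i') := by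
  obtain ⟨κ, hκ, h1⟩ := eventually_separated (species := species) hK h'
    (v := fun x => x.n j) (fun x => x.n_causal j) (inv_pos.2 hK)
    (Eventually.of_forall fun x => by
      rw [x.n_zero, mul_one]; exact x.kin.jets_separated k j hjk.symm)
  obtain ⟨κ', hκ', h2⟩ := eventually_separated (species := species) hK h
    (v := fun x => x.p i') (fun x => x.causal i') (κ := κ * K⁻¹) (by positivity) (by
      filter_upwards [h1] with x hx
      rw [x.n_zero, mul_one] at hx
      rw [mdot_comm]
      refine le_trans ?_ hx
      rw [mul_assoc]
      have : K⁻¹ * x.p i' 0 ≤ 1 := by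
        rw [inv_mul_le_iff₀ hK, mul_one]; exact x.energy_le h'
      nlinarith)
  refine ⟨κ' * K⁻¹, by positivity, ?_⟩
  filter_upwards [h2] with x hx
  rw [pow_zero, mul_one]
  exact (mul_le_mul_of_nonneg_left (x.le_energy h') hκ'.le).trans hx

/-- The upper bound on soft energies turns an absolute lower bound into one relative to the energy,
the form used by `eventually_separated` and `Admissible`. -/
theorem soft_separated (hK : 0 < K) (x : Config species sector K) {i : ι} (h : sector i = none)
    (j : Fin N) : K⁻¹ * K⁻¹ * x.p i 0 ≤ mdot (x.n j) (x.p i) := by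
  refine le_trans ?_ (x.kin.soft_not_collinear i j h)
  rw [mul_assoc]
  refine mul_le_mul_of_nonneg_left ?_ (by positivity)
  rw [inv_mul_le_iff₀ hK]
  exact x.kin.soft_energy i h

theorem eventually_soft_separated (hK : 0 < K) {i i' : ι} {j : Fin N} (h : sector i = some j)
    (h' : sector i' = none) :
    ∃ κ : ℝ, 0 < κ ∧ ∀ᶠ x : Config species sector K in small,
      κ * x.lam ^ 2 ≤ mdot (x.p i) (x.p i') := by
  obtain ⟨κ, hκ, h1⟩ := eventually_separated (species := species) hK h
    (v := fun x => x.p i') (fun x => x.causal i') (κ := K⁻¹ * K⁻¹) (by positivity)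
    (Eventually.of_forall fun x => x.soft_separated hK h' j)
  refine ⟨κ * (K⁻¹ / 2), by positivity, ?_⟩
  filter_upwards [h1] with x hx
  refine le_trans ?_ hx
  rw [mul_assoc]
  refine mul_le_mul_of_nonneg_left ?_ hκ.le
  -- Since `n·k ≤ 2 k⁰`, a soft energy is at least `K⁻¹ / 2` times `lam²`.
  have h2 := (x.n_causal j).mdot_le (x.causal i')
  have h3 := x.kin.soft_not_collinear i' j h'
  rw [x.n_zero, one_mul] at h2
  change _ ≤ mdot (x.n j) (x.p i') at h3
  linarith

theorem eventually_pair_pos (hK : 0 < K) {i i' : ι} (hne : i ≠ i')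
    (hp : ¬(species i = .photon ∧ species i' = .photon)) :
    ∀ᶠ x : Config species sector K in small, 0 < mdot (x.p i) (x.p i') := by
  have key : ∀ {c : ℝ} {e : ℕ} (x : Config species sector K), 0 < c →
      c * x.lam ^ e ≤ mdot (x.p i) (x.p i') → 0 < mdot (x.p i) (x.p i') := fun x hc h =>
    lt_of_lt_of_le (mul_pos hc (pow_pos x.lam_pos _)) h
  rcases h : sector i with _ | j <;> rcases h' : sector i' with _ | k
  · exact Eventually.of_forall fun x =>
      key x (inv_pos.2 hK) (x.kin.soft_lower i i' hne h h' hp)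
  · obtain ⟨κ, hκ, h1⟩ := eventually_soft_separated (species := species) hK h' h
    filter_upwards [h1] with x hx
    exact key x hκ (by rwa [mdot_comm])
  · obtain ⟨κ, hκ, h1⟩ := eventually_soft_separated (species := species) hK h h'
    filter_upwards [h1] with x hx
    exact key x hκ hx
  · by_cases hjk : j = k
    · subst hjk
      exact Eventually.of_forall fun x =>
        key x (inv_pos.2 hK) (x.kin.collinear_lower i i' j hne h h' hp)
    · obtain ⟨κ, hκ, h1⟩ := eventually_jets_separated (species := species) hK h h' hjk
      filter_upwards [h1] with x hx
      exact key x hκ hx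

/-- Products of forward momenta are nonnegative, so `P_S²` is at least the product of any one pair,
and a charged particle in `S` supplies a pair with positive product. -/
theorem eventually_regular [DecidableEq ι] (hK : 0 < K) :
    ∀ᶠ x : Config species sector K in small, Regular x.state := by
  have h : ∀ᶠ x : Config species sector K in small, ∀ i i' : ι, i ≠ i' →
      ¬(species i = .photon ∧ species i' = .photon) → 0 < mdot (x.p i) (x.p i') := by
    simp only [Filter.eventually_all]
    exact fun i i' hne hp => eventually_pair_pos hK hne hp
  filter_upwards [h] with x hx
  refine ⟨x.kin.massless, fun S hS hc => ?_⟩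
  obtain ⟨i, hi, hci⟩ := hc
  obtain ⟨i', hi', hne⟩ := Finset.exists_mem_ne (show 1 < S.card by omega) i
  exact (lt_of_lt_of_le (hx i i' hne.symm fun h => hci h.1)
    (le_mdot_totalMom_self x.causal hi hi')).ne'

end Config
end ScalarQED
namespace ScalarQED
namespace Config

open Filter Asymptotics

variable {ι F : Type*} [Fintype ι] {N : ℕ} {species : ι → Species F}
  {sector : ι → Option (Fin N)} {K : ℝ}

/-! ### Power counting -/

/-- `f = O(lam ^ a)`. -/
def Ord (f : Config species sector K → ℂ) (a : ℤ) : Prop :=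
  f =O[small] fun x => x.lam ^ a

section Ord

variable {f h : Config species sector K → ℂ} {a b : ℤ}

theorem Ord.add (hf : Ord f a) (hh : Ord h a) : Ord (fun x => f x + h x) a := IsBigO.add hf hh

theorem Ord.sub (hf : Ord f a) (hh : Ord h a) : Ord (fun x => f x - h x) a := IsBigO.sub hf hh

theorem Ord.neg (hf : Ord f a) : Ord (fun x => -f x) a := IsBigO.neg_left hf

theorem Ord.mul (hf : Ord f a) (hh : Ord h b) : Ord (fun x => f x * h x) (a + b) := by
  refine (IsBigO.mul hf hh).congr_right fun x => ?_
  rw [zpow_add₀ x.lam_pos.ne']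

theorem Ord.const_mul (c : ℂ) (hf : Ord f a) : Ord (fun x => c * f x) a :=
  IsBigO.const_mul_left hf c

theorem Ord.zero : Ord (fun _ : Config species sector K => 0) a := isBigO_zero _ _

theorem Ord.const (c : ℂ) : Ord (fun _ : Config species sector K => c) 0 := by
  simp only [Ord, zpow_zero]
  exact isBigO_const_const _ one_ne_zero _

theorem Ord.congr (hf : Ord f a) (hfh : ∀ᶠ x in small, h x = f x) : Ord h a :=
  IsBigO.congr' hf (hfh.mono fun _ hx => hx.symm) EventuallyEq.rfl

theorem Ord.sum {κ : Type*} {s : Finset κ} {f : κ → Config species sector K → ℂ}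
    (hf : ∀ k ∈ s, Ord (f k) a) : Ord (fun x => ∑ k ∈ s, f k x) a := IsBigO.fun_sum hf

theorem Ord.of_le {C : ℝ} (hf : ∀ᶠ x in small, ‖f x‖ ≤ C * x.lam ^ a) : Ord f a := by
  refine IsBigO.of_bound C (hf.mono fun x hx => ?_)
  rwa [Real.norm_of_nonneg (zpow_nonneg x.lam_pos.le a)]

theorem Ord.mono (hf : Ord f a) (hab : b ≤ a) : Ord f b := by
  refine hf.trans (IsBigO.of_bound 1 ?_)
  filter_upwards [eventually_lam_lt (species := species) (sector := sector) (K := K) one_pos]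
    with x hx
  rw [one_mul, Real.norm_of_nonneg (zpow_nonneg x.lam_pos.le a),
    Real.norm_of_nonneg (zpow_nonneg x.lam_pos.le b)]
  exact zpow_le_zpow_right_of_le_one₀ x.lam_pos hx.le hab

/-- Inverses of quantities that are bounded below. -/
theorem Ord.inv {d : Config species sector K → ℝ} {κ : ℝ} (hκ : 0 < κ)
    (hd : ∀ᶠ x in small, κ * x.lam ^ a ≤ d x) :
    Ord (fun x => ((d x : ℝ) : ℂ)⁻¹) (-a) := by
  refine Ord.of_le (C := κ⁻¹) (hd.mono fun x hx => ?_)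
  have h1 : 0 < κ * x.lam ^ a := mul_pos hκ (zpow_pos x.lam_pos a)
  rw [norm_inv, Complex.norm_real, Real.norm_of_nonneg (h1.le.trans hx), zpow_neg, ← mul_inv]
  exact inv_anti₀ h1 hx

theorem Ord.ofReal_of_le {d : Config species sector K → ℝ} {C : ℝ}
    (hd : ∀ᶠ x in small, |d x| ≤ C * x.lam ^ a) : Ord (fun x => ((d x : ℝ) : ℂ)) a :=
  Ord.of_le (hd.mono fun x hx => by rwa [Complex.norm_real])

end Ord

/-- All components are `O(lam ^ a)`. -/
def VOrd (v : Config species sector K → Fin 4 → ℂ) (a : ℤ) : Prop :=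
  ∀ μ, Ord (fun x => v x μ) a

/-- Vectors that scale like `lam ^ a` times the momenta of the jet `j`. -/
def Coll (j : Fin N) (v : Config species sector K → Fin 4 → ℂ) (a : ℤ) : Prop :=
  ∃ (α : Config species sector K → ℂ) (R : Config species sector K → Fin 4 → ℂ),
    (∀ᶠ x in small, v x = fun μ => α x * toC (x.n j) μ + R x μ) ∧ Ord α a ∧ VOrd R (a + 1) ∧
      Ord (fun x => mdot (toC (x.n j)) (R x)) (a + 2)

/-- Closure properties shared by the scaling laws of vectors. -/
structure IsScaling (Q : (Config species sector K → Fin 4 → ℂ) → ℤ → Prop) : Prop where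
  zero : ∀ a, Q (fun _ _ => 0) a
  add : ∀ {u v a}, Q u a → Q v a → Q (fun x μ => u x μ + v x μ) a
  smul : ∀ {c v a b}, Ord c a → Q v b → Q (fun x μ => c x * v x μ) (a + b)
  congr : ∀ {u v a}, Q u a → (∀ᶠ x in small, v x = u x) → Q v a
  mono : ∀ {v a b}, Q v a → b ≤ a → Q v b

theorem IsScaling.sum {Q : (Config species sector K → Fin 4 → ℂ) → ℤ → Prop} (hQ : IsScaling Q)
    {κ : Type*} {s : Finset κ} {v : κ → Config species sector K → Fin 4 → ℂ} {a : ℤ}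
    (h : ∀ k ∈ s, Q (v k) a) : Q (fun x μ => ∑ k ∈ s, v k x μ) a := by
  classical
  induction s using Finset.induction_on with
  | empty => simpa using hQ.zero a
  | insert k s hk ih =>
    simp only [Finset.sum_insert hk]
    exact hQ.add (h k (Finset.mem_insert_self k s))
      (ih fun k' hk' => h k' (Finset.mem_insert_of_mem hk'))

theorem IsScaling.const_smul {Q : (Config species sector K → Fin 4 → ℂ) → ℤ → Prop}
    (hQ : IsScaling Q) (c : ℂ) {v : Config species sector K → Fin 4 → ℂ} {a : ℤ} (h : Q v a) :
    Q (fun x μ => c * v x μ) a := by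
  simpa using hQ.smul (Ord.const c) h

theorem IsScaling.sub {Q : (Config species sector K → Fin 4 → ℂ) → ℤ → Prop}
    (hQ : IsScaling Q) {u v : Config species sector K → Fin 4 → ℂ} {a : ℤ} (hu : Q u a)
    (hv : Q v a) : Q (fun x μ => u x μ - v x μ) a := by
  have := hQ.add hu (hQ.const_smul (-1) hv)
  simpa [sub_eq_add_neg] using this

theorem isScaling_vOrd : IsScaling (VOrd (species := species) (sector := sector) (K := K)) where
  zero _ _ := Ord.zero
  add hu hv μ := (hu μ).add (hv μ)
  smul hc hv μ := hc.mul (hv μ)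
  congr hu h μ := (hu μ).congr (h.mono fun _ hx => congrFun hx μ)
  mono hv h μ := (hv μ).mono h

theorem mdot_add_right (u v w : Fin 4 → ℂ) :
    mdot u (fun μ => v μ + w μ) = mdot u v + mdot u w := by
  simp only [mdot]; ring

theorem mdot_smul_right (c : ℂ) (u v : Fin 4 → ℂ) :
    mdot u (fun μ => c * v μ) = c * mdot u v := by
  simp only [mdot]; ring

theorem isScaling_coll (j : Fin N) :
    IsScaling (Coll (species := species) (sector := sector) (K := K) j) where
  zero a := ⟨fun _ => 0, fun _ _ => 0, Eventually.of_forall fun x => by simp, Ord.zero,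
    fun _ => Ord.zero, by simpa [mdot] using Ord.zero⟩
  add := by
    rintro u v a ⟨α, R, h, h1, h2, h3⟩ ⟨α', R', h', h1', h2', h3'⟩
    refine ⟨fun x => α x + α' x, fun x μ => R x μ + R' x μ, ?_, h1.add h1',
      fun μ => (h2 μ).add (h2' μ), ?_⟩
    · filter_upwards [h, h'] with x hx hx'
      rw [hx, hx']
      funext μ
      ring
    · simpa only [mdot_add_right] using h3.add h3'
  smul := by
    rintro c v a b hc ⟨α, R, h, h1, h2, h3⟩
    refine ⟨fun x => c x * α x, fun x μ => c x * R x μ, ?_, hc.mul h1, fun μ => ?_, ?_⟩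
    · filter_upwards [h] with x hx
      rw [hx]
      funext μ
      ring
    · have := hc.mul (h2 μ)
      rwa [← add_assoc] at this
    · have := hc.mul h3
      rw [← add_assoc] at this
      simpa only [mdot_smul_right] using this
  congr := by
    rintro u v a ⟨α, R, h, h1, h2, h3⟩ huv
    exact ⟨α, R, by filter_upwards [h, huv] with x hx hx'; rw [hx', hx], h1, h2, h3⟩
  mono := by
    rintro v a b ⟨α, R, h, h1, h2, h3⟩ hab
    exact ⟨α, R, h, h1.mono hab, fun μ => (h2 μ).mono (by omega), h3.mono (by omega)⟩

theorem VOrd.mdot {u v : Config species sector K → Fin 4 → ℂ} {a b : ℤ} (hu : VOrd u a)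
    (hv : VOrd v b) : Ord (fun x => ScalarQED.mdot (u x) (v x)) (a + b) :=
  ((((hu 0).mul (hv 0)).sub ((hu 1).mul (hv 1))).sub ((hu 2).mul (hv 2))).sub
    ((hu 3).mul (hv 3))

theorem vOrd_toC_of_le {v : Config species sector K → Fin 4 → ℝ} {a : ℤ} {C : ℝ}
    (h : ∀ᶠ x in small, ∀ μ, |v x μ| ≤ C * x.lam ^ a) : VOrd (fun x => toC (v x)) a := fun μ =>
  Ord.ofReal_of_le (h.mono fun _ hx => hx μ)

theorem vOrd_n (j : Fin N) : VOrd (fun x : Config species sector K => toC (x.n j)) 0 :=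
  vOrd_toC_of_le (C := 1) (Eventually.of_forall fun x μ => by
    rw [zpow_zero, mul_one]; exact (x.n_causal j).abs_le μ)

theorem Coll.vOrd {j : Fin N} {v : Config species sector K → Fin 4 → ℂ} {a : ℤ}
    (hv : Coll j v a) : VOrd v a := by
  obtain ⟨α, R, h, h1, h2, _⟩ := hv
  intro μ
  have h3 := h1.mul (vOrd_n (species := species) (sector := sector) (K := K) j μ)
  rw [add_zero] at h3
  exact (h3.add ((h2 μ).mono (by omega))).congr (h.mono fun x hx => congrFun hx μ)

theorem VOrd.coll {j : Fin N} {v : Config species sector K → Fin 4 → ℂ} {a : ℤ}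
    (hv : VOrd v (a + 1)) (hn : Ord (fun x => ScalarQED.mdot (toC (x.n j)) (v x)) (a + 2)) :
    Coll j v a :=
  ⟨fun _ => 0, v, Eventually.of_forall fun x => by simp, Ord.zero, hv, hn⟩

/-- Soft momenta, of order `lam²` in all components, thus count as collinear to every jet. -/
theorem VOrd.coll_of_add_two {j : Fin N} {v : Config species sector K → Fin 4 → ℂ} {a : ℤ}
    (hv : VOrd v (a + 2)) : Coll j v a := by
  refine VOrd.coll (fun μ => (hv μ).mono (by omega)) ?_
  have := (vOrd_n (species := species) (sector := sector) (K := K) j).mdot hv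
  rwa [zero_add] at this

/-- The leading term is proportional to `n·n = 0`; the cross terms with `n·R` and the term `R·R'`
are smaller by `lam²`. This gain pays for the denominators of a jet. -/
theorem Coll.mdot {j : Fin N} {u v : Config species sector K → Fin 4 → ℂ} {a b : ℤ}
    (hn : ∀ᶠ x : Config species sector K in small, ScalarQED.mdot (x.n j) (x.n j) = 0)
    (hu : Coll j u a) (hv : Coll j v b) :
    Ord (fun x => ScalarQED.mdot (u x) (v x)) (a + b + 2) := by
  obtain ⟨α, R, h, h1, h2, h3⟩ := hu
  obtain ⟨α', R', h', h1', h2', h3'⟩ := hv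
  have e1 := h1.mul h3'
  have e2 := h1'.mul h3
  have e3 : Ord (fun x => ScalarQED.mdot (R x) (R' x)) (a + 1 + (b + 1)) := VOrd.mdot h2 h2'
  rw [show a + (b + 2) = a + b + 2 by ring] at e1
  rw [show b + (a + 2) = a + b + 2 by ring] at e2
  rw [show a + 1 + (b + 1) = a + b + 2 by ring] at e3
  refine ((e1.add e2).add e3).congr ?_
  filter_upwards [h, h', hn] with x hx hx' hnx
  have hnx' : ScalarQED.mdot (toC (x.n j)) (toC (x.n j)) = 0 := by
    have := congrArg (fun r : ℝ => (r : ℂ)) hnx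
    simpa [ScalarQED.mdot, toC] using this
  rw [hx, hx']
  simp only [ScalarQED.mdot] at hnx' ⊢
  linear_combination α x * α' x * hnx'

/-! ### Weights -/

/-- The power of `1 / lam` that belongs to a set of particles. -/
def wt (sector : ι → Option (Fin N)) (T : Finset ι) : ℤ :=
  ∑ i ∈ T, if sector i = none then 2 else 1

theorem wt_add_sdiff [DecidableEq ι] {A T : Finset ι} (h : A ⊆ T) :
    wt sector A + wt sector (T \ A) = wt sector T := by
  rw [wt, wt, wt, add_comm, Finset.sum_sdiff h]

theorem wt_empty : wt sector ∅ = 0 := Finset.sum_empty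

theorem wt_singleton (i : ι) : wt sector {i} = if sector i = none then 2 else 1 :=
  Finset.sum_singleton _ _

/-! ### Scaling of momenta and denominators -/

theorem toC_totalMom (p : ι → Fin 4 → ℝ) (T : Finset ι) (μ : Fin 4) :
    toC (totalMom p T) μ = ∑ i ∈ T, toC (p i) μ := by
  simp only [toC, totalMom_apply, Complex.ofReal_sum]

theorem IsScaling.totalMom {Q : (Config species sector K → Fin 4 → ℂ) → ℤ → Prop}
    (hQ : IsScaling Q) {T : Finset ι} {a : ℤ} (h : ∀ i ∈ T, Q (fun x => toC (x.p i)) a) :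
    Q (fun x => toC (ScalarQED.totalMom x.p T)) a := by
  have : (fun x : Config species sector K => toC (ScalarQED.totalMom x.p T)) =
      fun x μ => ∑ i ∈ T, toC (x.p i) μ := by
    funext x μ; exact toC_totalMom x.p T μ
  rw [this]
  exact hQ.sum h

theorem IsScaling.momentum_sum [DecidableEq ι]
    {Q : (Config species sector K → Fin 4 → ℂ) → ℤ → Prop}
    (hQ : IsScaling Q) {A B : Finset ι} {a : ℤ} (hA : ∀ i ∈ A, Q (fun x => toC (x.p i)) a)
    (hB : ∀ i ∈ B, Q (fun x => toC (x.p i)) a) :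
    Q (fun x => toC (ScalarQED.totalMom x.p A + 2 • ScalarQED.totalMom x.p B)) a := by
  have : (fun x : Config species sector K =>
      toC (ScalarQED.totalMom x.p A + 2 • ScalarQED.totalMom x.p B)) =
      fun x μ => toC (ScalarQED.totalMom x.p A) μ + 2 * toC (ScalarQED.totalMom x.p B) μ := by
    funext x μ; simp [toC, two_nsmul]
  rw [this]
  exact hQ.add (hQ.totalMom hA) (hQ.const_smul 2 (hQ.totalMom hB))

theorem vOrd_soft (i : ι) (h : sector i = none) :
    VOrd (fun x : Config species sector K => toC (x.p i)) 2 :=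
  vOrd_toC_of_le (C := K) (Eventually.of_forall fun x μ =>
    ((x.causal i).abs_le μ).trans (by exact_mod_cast x.kin.soft_energy i h))

theorem vOrd_momentum (i : ι) : VOrd (fun x : Config species sector K => toC (x.p i)) 0 := by
  rcases h : sector i with _ | j
  · exact isScaling_vOrd.mono (vOrd_soft i h) (by norm_num)
  · refine vOrd_toC_of_le (C := K) (Eventually.of_forall fun x μ => ?_)
    rw [zpow_zero, mul_one]
    exact ((x.causal i).abs_le μ).trans (x.energy_le h)

/-- The part of a jet momentum that is not parallel to the jet direction. -/
theorem vOrd_transverse (hK : 0 < K) {i : ι} {j : Fin N} (h : sector i = some j) :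
    VOrd (fun x : Config species sector K => toC (x.p i - x.p i 0 • x.n j)) 1 := by
  obtain ⟨C, hC, h1⟩ := eventually_n_mdot_le (species := species) hK h
  refine vOrd_toC_of_le (C := 2 * (K * C) + 1) ?_
  filter_upwards [h1, eventually_n_null hK h] with x hx hn μ
  have hl := x.lam_pos
  have h5 : 0 ≤ mdot (x.n j) (x.p i) := (x.n_causal j).mdot_nonneg (x.causal i)
  have h7 : x.p i 0 * mdot (x.n j) (x.p i) ≤ K * (C * x.lam ^ 2) :=
    mul_le_mul (x.energy_le h) hx h5 hK.le
  rw [zpow_one]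
  have hpos : 0 ≤ (2 * (K * C) + 1) * x.lam := by positivity
  refine abs_le_of_sq_le_sq ?_ hpos
  have hsq : (x.p i - x.p i 0 • x.n j) 1 ^ 2 + (x.p i - x.p i 0 • x.n j) 2 ^ 2 +
      (x.p i - x.p i 0 • x.n j) 3 ^ 2 = 2 * (x.p i 0 * mdot (x.n j) (x.p i)) := by
    have hm := x.kin.massless i
    have hn0 := x.n_zero j
    simp only [ScalarQED.mdot, Pi.sub_apply, Pi.smul_apply, smul_eq_mul, hn0] at *
    linear_combination (-1) * hm - x.p i 0 ^ 2 * hn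
  have hb : 2 * (x.p i 0 * mdot (x.n j) (x.p i)) ≤ ((2 * (K * C) + 1) * x.lam) ^ 2 := by
    have : 0 ≤ (K * C) * x.lam ^ 2 := by positivity
    have : 0 ≤ ((K * C) * x.lam) ^ 2 := by positivity
    nlinarith [sq_nonneg x.lam]
  refine le_trans ?_ (hsq ▸ hb)
  have a1 := sq_nonneg ((x.p i - x.p i 0 • x.n j) 1)
  have a2 := sq_nonneg ((x.p i - x.p i 0 • x.n j) 2)
  have a3 := sq_nonneg ((x.p i - x.p i 0 • x.n j) 3)
  fin_cases μ
  · have : (x.p i - x.p i 0 • x.n j) 0 = 0 := by simp [x.n_zero]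
    simp only [Fin.zero_eta, this]; linarith
  · simp only [Fin.mk_one]; linarith
  · simp only [Fin.reduceFinMk]; linarith
  · simp only [Fin.reduceFinMk]; linarith

/-- The coefficient of `n` is the energy. The remainder `p - p⁰ n` is `O(lam)` and has the same
product with `n` as `p`, which is `O(lam²)`. -/
theorem coll_jet (hK : 0 < K) {i : ι} {j : Fin N} (h : sector i = some j) :
    Coll j (fun x : Config species sector K => toC (x.p i)) 0 := by
  obtain ⟨C, hC, h1⟩ := eventually_n_mdot_le (species := species) hK h
  refine ⟨fun x => (x.p i 0 : ℂ), fun x => toC (x.p i - x.p i 0 • x.n j), ?_, ?_, ?_, ?_⟩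
  · refine Eventually.of_forall fun x => ?_
    funext μ
    simp [toC]
  · exact vOrd_momentum i 0
  · exact vOrd_transverse hK h
  · have : Ord (fun x : Config species sector K =>
        ((ScalarQED.mdot (x.n j) (x.p i) : ℝ) : ℂ)) 2 := by
      refine Ord.ofReal_of_le (C := C) ?_
      filter_upwards [h1] with x hx
      rw [abs_of_nonneg ((x.n_causal j).mdot_nonneg (x.causal i))]
      exact_mod_cast hx
    refine (this.mono (by norm_num)).congr ?_
    filter_upwards [eventually_n_null hK h] with x hn
    have hn' := congrArg (fun r : ℝ => (r : ℂ)) hn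
    simp only [ScalarQED.mdot, toC, Pi.sub_apply, Pi.smul_apply, smul_eq_mul] at hn' ⊢
    push_cast at hn' ⊢
    linear_combination (-(x.p i 0 : ℂ)) * hn'

theorem coll_momentum (hK : 0 < K) {i : ι} {j : Fin N}
    (h : sector i = some j ∨ sector i = none) :
    Coll j (fun x : Config species sector K => toC (x.p i)) 0 := by
  rcases h with h | h
  · exact coll_jet hK h
  · exact VOrd.coll_of_add_two (vOrd_soft i h)

/-- The squared momentum of a set of particles. -/
def den (x : Config species sector K) (T : Finset ι) : ℝ :=
  mdot (totalMom x.p T) (totalMom x.p T)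

/-- One pair suffices, since all other pairs only add to `P_T²`. -/
theorem den_lower {T : Finset ι} {i i' : ι} (hi : i ∈ T) (hi' : i' ∈ T) {e : ℕ}
    (h : ∃ κ : ℝ, 0 < κ ∧ ∀ᶠ x : Config species sector K in small,
      κ * x.lam ^ e ≤ mdot (x.p i) (x.p i')) :
    Ord (fun x : Config species sector K => ((x.den T : ℝ) : ℂ)⁻¹) (-(e : ℤ)) ∧
      ∀ᶠ x : Config species sector K in small, x.den T ≠ 0 := by
  obtain ⟨κ, hκ, h⟩ := h
  have h1 : ∀ᶠ x : Config species sector K in small, κ * x.lam ^ e ≤ x.den T :=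
    h.mono fun x hx => hx.trans (le_mdot_totalMom_self x.causal hi hi')
  refine ⟨Ord.inv hκ (h1.mono fun x hx => by simpa using hx), h1.mono fun x hx => ?_⟩
  exact (lt_of_lt_of_le (mul_pos hκ (pow_pos x.lam_pos e)) hx).ne'

end Config
end ScalarQED
namespace ScalarQED

open IsNilpotent (exp)

/-- Families that vanish on charged sets of particles. -/
def Neutral {ι F : Type*} [DecidableEq F] (species : ι → Species F) (f : Gen ι) : Prop :=
  ∀ T, flavorCharge species T ≠ 0 → f T = 0

/-! ### Charge neutrality under products and exponentials -/

section Neutral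

variable {ι F : Type*} [DecidableEq ι] [DecidableEq F] {species : ι → Species F}

theorem Neutral.one : Neutral species (1 : Gen ι) := fun T hT => by
  rw [Gen.one_apply, if_neg]
  rintro rfl
  exact hT (flavorCharge_empty species)

theorem Neutral.mul {f h : Gen ι} (hf : Neutral species f) (hh : Neutral species h) :
    Neutral species (f * h) := fun T hT => by
  rw [Gen.mul_apply]
  refine Finset.sum_eq_zero fun A hA => ?_
  by_cases h0 : flavorCharge species A = 0
  · rw [hh, mul_zero]
    rwa [← flavorCharge_add_sdiff species (Finset.mem_powerset.1 hA), h0, zero_add] at hT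
  · rw [hf A h0, zero_mul]

theorem Neutral.pow {f : Gen ι} (hf : Neutral species f) (n : ℕ) : Neutral species (f ^ n) := by
  induction n with
  | zero => rw [pow_zero]; exact Neutral.one
  | succ n ih => rw [pow_succ]; exact ih.mul hf

theorem Neutral.smul {f : Gen ι} (hf : Neutral species f) (c : ℂ) : Neutral species (c • f) :=
  fun T hT => by rw [Gen.smul_apply, hf T hT, mul_zero]

theorem Neutral.exp [Fintype ι] {f : Gen ι} (hf : Neutral species f) (h0 : f ∅ = 0) :
    Neutral species (exp f) := fun T hT => by
  rw [Gen.exp_apply h0]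
  exact Finset.sum_eq_zero fun n _ => by rw [hf.pow n T hT, mul_zero]

end Neutral

namespace Config

open Filter Asymptotics

variable {ι F : Type*} [Fintype ι] {N : ℕ} {species : ι → Species F}
  {sector : ι → Option (Fin N)} {K : ℝ} [DecidableEq ι] [DecidableEq F] [Fintype F]

/-! ### Sector-wise axial gauges -/

/-- The gauge vectors of the sectors: the normalized directions of the Wilson lines for the jets
and `w` for the soft particles. -/
def tau (w : Config species sector K → Fin 4 → ℝ) (x : Config species sector K) :
    Option (Fin N) → Fin 4 → ℝ
  | none => w x
  | some j => (x.t j 0)⁻¹ • x.t j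

/-- The transformation to the axial gauge in each sector. -/
def gaugeFn (g : ℝ) (w : Config species sector K → Fin 4 → ℝ) (x : Config species sector K) :
    Gen ι :=
  Gen.mk fun T => ∑ s, if T ⊆ sectorSet sector s then
    mdot (toC (x.tau w s)) (currents g x.state T).photon
      / ((mdot (x.tau w s) (totalMom x.p T) : ℝ) : ℂ) else 0

/-- The charged fields in the axial gauge. -/
def gPhi (g : ℝ) (w : Config species sector K → Fin 4 → ℝ) (x : Config species sector K)
    (f : F) (σ : ℤˣ) : Gen ι :=
  gaugePhi g (gaugeFn g w x) (phi g x.state) f σ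

/-- The photon field in the axial gauge. -/
def gPhot (g : ℝ) (w : Config species sector K → Fin 4 → ℝ) (x : Config species sector K)
    (μ : Fin 4) : Gen ι :=
  gaugePhot x.p (gaugeFn g w x) (phot g x.state) μ

/-- The vector of matrix elements of the photon field in the axial gauge. -/
def gB (g : ℝ) (w : Config species sector K → Fin 4 → ℝ) (x : Config species sector K)
    (T : Finset ι) : Fin 4 → ℂ := fun μ => gPhot g w x μ T

variable {g : ℝ} {w : Config species sector K → Fin 4 → ℝ} {x : Config species sector K}

theorem gaugeFn_apply (T : Finset ι) : gaugeFn g w x T =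
    ∑ s, if T ⊆ sectorSet sector s then mdot (toC (x.tau w s)) (currents g x.state T).photon
      / ((mdot (x.tau w s) (totalMom x.p T) : ℝ) : ℂ) else 0 := rfl

theorem gaugeFn_of_photon_eq_zero {T : Finset ι} (h : (currents g x.state T).photon = 0) :
    gaugeFn g w x T = 0 := by
  rw [gaugeFn_apply]
  refine Finset.sum_eq_zero fun s _ => ?_
  rw [h, mdot_zero_right, zero_div, ite_self]

theorem gaugeFn_empty : gaugeFn g w x ∅ = 0 :=
  gaugeFn_of_photon_eq_zero (currents_photon_empty g x.state)

theorem gaugeFn_of_subset {T : Finset ι} (hT : T.Nonempty) {s : Option (Fin N)}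
    (h : T ⊆ sectorSet sector s) : gaugeFn g w x T =
      mdot (toC (x.tau w s)) (currents g x.state T).photon
        / ((mdot (x.tau w s) (totalMom x.p T) : ℝ) : ℂ) := by
  rw [gaugeFn_apply, Finset.sum_eq_single s]
  · exact if_pos h
  · intro s' _ hne
    refine if_neg fun h' => hne ?_
    obtain ⟨i, hi⟩ := hT
    rw [← mem_sectorSet.1 (h hi), ← mem_sectorSet.1 (h' hi)]
  · exact fun h => absurd (Finset.mem_univ s) h

theorem gaugeFn_of_not_subset {T : Finset ι} (h : ∀ s, ¬T ⊆ sectorSet sector s) :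
    gaugeFn g w x T = 0 := by
  rw [gaugeFn_apply]
  exact Finset.sum_eq_zero fun s _ => if_neg (h s)

theorem neutral_gaugeFn : Neutral species (gaugeFn g w x) := fun T hT =>
  gaugeFn_of_photon_eq_zero ((chargeConserving_currents g x.state T).2 hT)

theorem gB_apply (T : Finset ι) (μ : Fin 4) : gB g w x T μ =
    (currents g x.state T).photon μ - gaugeFn g w x T * toC (totalMom x.p T) μ := by
  rw [gB, gPhot, gaugePhot, Gen.sub_apply, momD_apply, phot_apply, mul_comm]; rfl

theorem gB_of_photon_eq_zero {T : Finset ι} (h : (currents g x.state T).photon = 0) :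
    gB g w x T = 0 := by
  funext μ
  rw [gB_apply, gaugeFn_of_photon_eq_zero h, h, zero_mul, sub_zero]

theorem gB_empty : gB g w x ∅ = 0 := gB_of_photon_eq_zero (currents_photon_empty g x.state)

theorem gB_of_photon {T : Finset ι} (hT : 2 ≤ T.card) (h : ∀ i ∈ T, species i = .photon) :
    gB g w x T = 0 :=
  gB_of_photon_eq_zero (currents_photon_of_photon g x.state hT h)

theorem gB_of_not_subset {T : Finset ι} (h : ∀ s, ¬T ⊆ sectorSet sector s) :
    gB g w x T = (currents g x.state T).photon := by
  funext μ
  rw [gB_apply, gaugeFn_of_not_subset h, zero_mul, sub_zero]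

theorem gB_of_subset {T : Finset ι} (hT : T.Nonempty) {s : Option (Fin N)}
    (h : T ⊆ sectorSet sector s) (μ : Fin 4) : gB g w x T μ =
      (currents g x.state T).photon μ - mdot (toC (x.tau w s)) (currents g x.state T).photon
        / ((mdot (x.tau w s) (totalMom x.p T) : ℝ) : ℂ) * toC (totalMom x.p T) μ := by
  rw [gB_apply, gaugeFn_of_subset hT h]

theorem mdot_toC (u v : Fin 4 → ℝ) : mdot (toC u) (toC v) = ((mdot u v : ℝ) : ℂ) := by
  simp [mdot, toC]

/-- The axial gauge condition: the quotient in `gaugeFn` is chosen so that the two terms cancel. -/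
theorem mdot_tau_gB {T : Finset ι} (hT : T.Nonempty) {s : Option (Fin N)}
    (h : T ⊆ sectorSet sector s) (h0 : mdot (x.tau w s) (totalMom x.p T) ≠ 0) :
    mdot (toC (x.tau w s)) (gB g w x T) = 0 := by
  have h0' : ((mdot (x.tau w s) (totalMom x.p T) : ℝ) : ℂ) ≠ 0 := by exact_mod_cast h0
  have h1 : gB g w x T = fun μ => (currents g x.state T).photon μ
      - gaugeFn g w x T * toC (totalMom x.p T) μ := funext fun μ => gB_apply T μ
  have h2 := mdot_toC (x.tau w s) (totalMom x.p T)
  rw [h1, gaugeFn_of_subset hT h]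
  have h3 : mdot (toC (x.tau w s)) (fun μ => (currents g x.state T).photon μ
      - mdot (toC (x.tau w s)) (currents g x.state T).photon
        / ((mdot (x.tau w s) (totalMom x.p T) : ℝ) : ℂ) * toC (totalMom x.p T) μ) =
      mdot (toC (x.tau w s)) (currents g x.state T).photon
      - mdot (toC (x.tau w s)) (currents g x.state T).photon
        / ((mdot (x.tau w s) (totalMom x.p T) : ℝ) : ℂ)
          * mdot (toC (x.tau w s)) (toC (totalMom x.p T)) := by
    simp only [mdot]; ring
  rw [h3, h2, div_mul_cancel₀ _ h0', sub_self]

theorem gPhi_of_charge_ne {f : F} {σ : ℤˣ} {T : Finset ι}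
    (h : flavorCharge species T ≠ unitCharge f σ) : gPhi g w x f σ T = 0 := by
  rw [gPhi, gaugePhi, Gen.mul_apply]
  refine Finset.sum_eq_zero fun A hA => ?_
  have h0 : ((((σ : ℤ) : ℂ) * g) • gaugeFn g w x) ∅ = 0 := by
    rw [Gen.smul_apply, gaugeFn_empty, mul_zero]
  by_cases hA0 : flavorCharge species A = 0
  · rw [← flavorCharge_add_sdiff species (Finset.mem_powerset.1 hA), hA0, zero_add] at h
    rw [phi_apply, (chargeConserving_currents g x.state _).1 f σ h, mul_zero]
  · rw [(neutral_gaugeFn.smul _).exp h0 A hA0, zero_mul]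

theorem gPhi_of_photon {f : F} {σ : ℤˣ} {T : Finset ι} (h : ∀ i ∈ T, species i = .photon) :
    gPhi g w x f σ T = 0 :=
  gPhi_of_charge_ne (by rw [flavorCharge_of_photon _ h]; exact (unitCharge_ne_zero f σ).symm)

theorem gPhi_empty {f : F} {σ : ℤˣ} : gPhi g w x f σ ∅ = 0 := gPhi_of_photon (by simp)

theorem gPhi_singleton {f : F} {σ : ℤˣ} (i : ι) :
    gPhi g w x f σ {i} = (externalLine x.state i).charged f σ := by
  have h0 : ((((σ : ℤ) : ℂ) * g) • gaugeFn g w x) ∅ = 0 := by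
    rw [Gen.smul_apply, gaugeFn_empty, mul_zero]
  have e : ({i} : Finset ι).powerset = {∅, {i}} := by ext; simp [Finset.subset_singleton_iff]
  rw [gPhi, gaugePhi, Gen.mul_apply, e, Finset.sum_pair (Finset.singleton_ne_empty i).symm,
    Gen.exp_apply_empty h0, phi_apply, phi_apply]
  simp [currents_charged_empty, currents_singleton_charged]

theorem Ord.gPhi_singleton (g : ℝ) (w : Config species sector K → Fin 4 → ℝ) (f : F) (σ : ℤˣ)
    (i : ι) : Ord (fun x => Config.gPhi g w x f σ {i}) 0 := by
  simp only [Config.gPhi_singleton]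
  refine Ord.of_le (C := 1) (Eventually.of_forall fun x => ?_)
  rw [zpow_zero, mul_one]
  simp only [externalLine, state]
  cases species i with
  | charged f' σ' => dsimp only; split_ifs <;> simp
  | photon => simp

/-- The covariant wave equation holds in any gauge; solving it for its `P_T²` term gives a recursion
that involves only the transformed fields. -/
theorem gPhi_eq (hreg : Regular x.state) {T : Finset ι} (h0 : x.den T ≠ 0) (f : F) (σ : ℤˣ) :
    gPhi g w x f σ T = -(((x.den T : ℝ) : ℂ)⁻¹ * ((((σ : ℤ) : ℂ) * g * ∑ A ∈ T.powerset,
        mdot (toC (totalMom x.p A + 2 • totalMom x.p (T \ A))) (gB g w x A)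
          * gPhi g w x f σ (T \ A))
      + (((σ : ℤ) : ℂ) * g) ^ 2 * ∑ A ∈ T.powerset, ∑ A' ∈ (T \ A).powerset,
        mdot (gB g w x A) (gB g w x A') * gPhi g w x f σ ((T \ A) \ A'))) := by
  have h := box_gaugePhi x.p (g : ℂ) (phi g x.state) (phot g x.state)
    (c := gaugeFn g w x) gaugeFn_empty f σ (hreg.box_phi g f σ)
  have h1 := congrFun h T
  change box x.p (((σ : ℤ) : ℂ) * g) (gPhot g w x) (gPhi g w x f σ) T = 0 at h1
  rw [box_apply] at h1
  have h0' : ((x.den T : ℝ) : ℂ) ≠ 0 := by exact_mod_cast h0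
  have h2 := eq_neg_of_add_eq_zero_left h1
  rw [← mul_right_inj' h0', mul_neg, mul_inv_cancel_left₀ h0']
  exact h2

/-- By gauge invariance of the current the source can be evaluated with axial-gauge fields, for
which good bounds are available, although the left side is the Feynman-gauge field. `gB` then
follows by subtracting the gauge term. -/
theorem photon_eq (hreg : Regular x.state) {T : Finset ι} (h0 : x.den T ≠ 0) (μ : Fin 4) :
    (currents g x.state T).photon μ = ((x.den T : ℝ) : ℂ)⁻¹ *
      ((g : ℂ) * ∑ f : F, ∑ A ∈ T.powerset,
          (gPhi g w x f 1 A * gPhi g w x f (-1) (T \ A))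
            * toC (totalMom x.p A - totalMom x.p (T \ A)) μ
        + 2 * (g : ℂ) ^ 2 * ∑ f : F, ∑ A ∈ T.powerset, ∑ A' ∈ (T \ A).powerset,
          (gPhi g w x f 1 A * gPhi g w x f (-1) A') * gB g w x ((T \ A) \ A') μ) := by
  have h := hreg.sq_mul_phot g μ T
  have h3 := congrFun (emCurrent_gauge x.p (g : ℂ) (phi g x.state) (phot g x.state)
    (c := gaugeFn g w x) gaugeFn_empty μ) T
  change emCurrent x.p g (gPhi g w x) (gPhot g w x) μ T = _ at h3
  have h0' : ((x.den T : ℝ) : ℂ) ≠ 0 := by exact_mod_cast h0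
  rw [← mul_right_inj' h0', mul_inv_cancel_left₀ h0']
  refine (h.trans h3.symm).trans ?_
  rw [emCurrent_apply]
  simp only [gB]
  congr 2
  · exact Finset.sum_congr rfl fun f _ => Finset.sum_congr rfl fun A _ => by ring
  · exact Finset.sum_congr rfl fun f _ => Finset.sum_congr rfl fun A _ =>
      Finset.sum_congr rfl fun A' _ => by ring

/-! ### One step of the recursion -/

/-- Terms with an empty leg vanish, so it is enough to count powers at vertices with nonempty legs;
a denominator of size `lam ^ e` costs `e` powers. -/
theorem Ord.gPhi_step (hK : 0 < K) (g : ℝ) (w : Config species sector K → Fin 4 → ℝ) {T : Finset ι}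
    {a e : ℤ}
    (hden : Ord (fun x : Config species sector K => ((x.den T : ℝ) : ℂ)⁻¹) (-e) ∧
      ∀ᶠ x : Config species sector K in small, x.den T ≠ 0) (f : F) (σ : ℤˣ)
    (h1 : ∀ A, A ⊆ T → A.Nonempty → (T \ A).Nonempty →
      Ord (fun x => mdot (toC (totalMom x.p A + 2 • totalMom x.p (T \ A))) (gB g w x A)
        * Config.gPhi g w x f σ (T \ A)) (a + e))
    (h2 : ∀ A A', A ⊆ T → A' ⊆ T \ A → A.Nonempty → A'.Nonempty → ((T \ A) \ A').Nonempty →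
      Ord (fun x => mdot (gB g w x A) (gB g w x A')
        * Config.gPhi g w x f σ ((T \ A) \ A')) (a + e)) :
    Ord (fun x => Config.gPhi g w x f σ T) a := by
  have e1 : Ord (fun x : Config species sector K => ∑ A ∈ T.powerset,
      mdot (toC (totalMom x.p A + 2 • totalMom x.p (T \ A))) (gB g w x A)
        * Config.gPhi g w x f σ (T \ A)) (a + e) := by
    refine Ord.sum fun A hA => ?_
    rcases A.eq_empty_or_nonempty with rfl | hA1
    · simpa only [gB_empty, mdot_zero_right, zero_mul] using Ord.zero
    · rcases (T \ A).eq_empty_or_nonempty with h | hA2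
      · simpa only [h, gPhi_empty, mul_zero] using Ord.zero
      · exact h1 A (Finset.mem_powerset.1 hA) hA1 hA2
  have e2 : Ord (fun x : Config species sector K => ∑ A ∈ T.powerset, ∑ A' ∈ (T \ A).powerset,
      mdot (gB g w x A) (gB g w x A') * Config.gPhi g w x f σ ((T \ A) \ A')) (a + e) := by
    refine Ord.sum fun A hA => Ord.sum fun A' hA' => ?_
    rcases A.eq_empty_or_nonempty with rfl | hA1
    · simpa only [gB_empty, mdot_zero_left, zero_mul] using Ord.zero
    · rcases A'.eq_empty_or_nonempty with rfl | hA2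
      · simpa only [gB_empty, mdot_zero_right, zero_mul] using Ord.zero
      · rcases ((T \ A) \ A').eq_empty_or_nonempty with h | hA3
        · simpa only [h, gPhi_empty, mul_zero] using Ord.zero
        · exact h2 A A' (Finset.mem_powerset.1 hA) (Finset.mem_powerset.1 hA') hA1 hA2 hA3
  have e3 := (hden.1.mul ((e1.const_mul (((σ : ℤ) : ℂ) * g)).add
    (e2.const_mul ((((σ : ℤ) : ℂ) * g) ^ 2)))).neg
  rw [show -e + (a + e) = a by ring] at e3
  refine e3.congr ?_
  filter_upwards [hden.2, eventually_regular hK] with x hx hreg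
  exact gPhi_eq hreg hx f σ

/-- Stated for an arbitrary scaling law so as to serve both `VOrd` (soft and hard sets) and `Coll`
(jets). -/
theorem IsScaling.photon_step {Q : (Config species sector K → Fin 4 → ℂ) → ℤ → Prop}
    (hQ : IsScaling Q) (hK : 0 < K) (g : ℝ) (w : Config species sector K → Fin 4 → ℝ)
    {T : Finset ι} {a e : ℤ}
    (hden : Ord (fun x : Config species sector K => ((x.den T : ℝ) : ℂ)⁻¹) (-e) ∧
      ∀ᶠ x : Config species sector K in small, x.den T ≠ 0)
    (h1 : ∀ (f : F) A, A ⊆ T → A.Nonempty → (T \ A).Nonempty →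
      Q (fun x μ => (gPhi g w x f 1 A * gPhi g w x f (-1) (T \ A))
            * toC (ScalarQED.totalMom x.p A - ScalarQED.totalMom x.p (T \ A)) μ) (a + e))
    (h2 : ∀ (f : F) A A', A ⊆ T → A' ⊆ T \ A → A.Nonempty → A'.Nonempty →
      ((T \ A) \ A').Nonempty →
      Q (fun x μ => (gPhi g w x f 1 A * gPhi g w x f (-1) A') * gB g w x ((T \ A) \ A') μ)
        (a + e)) :
    Q (fun x => (currents g x.state T).photon) a := by
  have e1 : Q (fun x μ => ∑ f : F, ∑ A ∈ T.powerset,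
      (gPhi g w x f 1 A * gPhi g w x f (-1) (T \ A))
            * toC (ScalarQED.totalMom x.p A - ScalarQED.totalMom x.p (T \ A)) μ) (a + e) := by
    refine hQ.sum fun f _ => hQ.sum fun A hA => ?_
    rcases A.eq_empty_or_nonempty with rfl | hA1
    · simpa only [gPhi_empty, zero_mul] using hQ.zero _
    · rcases (T \ A).eq_empty_or_nonempty with h | hA2
      · simpa only [h, gPhi_empty, mul_zero, zero_mul] using hQ.zero _
      · exact h1 f A (Finset.mem_powerset.1 hA) hA1 hA2
  have e2 : Q (fun x μ => ∑ f : F, ∑ A ∈ T.powerset, ∑ A' ∈ (T \ A).powerset,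
      (gPhi g w x f 1 A * gPhi g w x f (-1) A') * gB g w x ((T \ A) \ A') μ) (a + e) := by
    refine hQ.sum fun f _ => hQ.sum fun A hA => hQ.sum fun A' hA' => ?_
    rcases A.eq_empty_or_nonempty with rfl | hA1
    · simpa only [gPhi_empty, zero_mul] using hQ.zero _
    · rcases A'.eq_empty_or_nonempty with rfl | hA2
      · simpa only [gPhi_empty, mul_zero, zero_mul] using hQ.zero _
      · rcases ((T \ A) \ A').eq_empty_or_nonempty with h | hA3
        · simpa only [h, gB_empty, Pi.zero_apply, mul_zero] using hQ.zero _
        · exact h2 f A A' (Finset.mem_powerset.1 hA) (Finset.mem_powerset.1 hA') hA1 hA2 hA3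
  have e3 := hQ.smul hden.1 (hQ.add (hQ.const_smul (g : ℂ) e1)
    (hQ.const_smul (2 * (g : ℂ) ^ 2) e2))
  rw [show -e + (a + e) = a by ring] at e3
  refine hQ.congr e3 ?_
  filter_upwards [hden.2, eventually_regular hK] with x hx hreg
  funext μ
  exact photon_eq hreg hx μ

theorem IsScaling.momentum_sub {Q : (Config species sector K → Fin 4 → ℂ) → ℤ → Prop}
    (hQ : IsScaling Q) {A B : Finset ι} {a : ℤ} (hA : ∀ i ∈ A, Q (fun x => toC (x.p i)) a)
    (hB : ∀ i ∈ B, Q (fun x => toC (x.p i)) a) :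
    Q (fun x => toC (ScalarQED.totalMom x.p A - ScalarQED.totalMom x.p B)) a := by
  have : (fun x : Config species sector K =>
      toC (ScalarQED.totalMom x.p A - ScalarQED.totalMom x.p B)) =
      fun x μ => toC (ScalarQED.totalMom x.p A) μ - toC (ScalarQED.totalMom x.p B) μ := by
    funext x μ; simp [toC]
  rw [this]
  exact hQ.sub (hQ.totalMom hA) (hQ.totalMom hB)

/-! ### Polarization vectors in the axial gauge -/

theorem gB_singleton_of_ne_photon {i : ι} (h : species i ≠ .photon) : gB g w x {i} = 0 := by
  refine gB_of_photon_eq_zero ?_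
  rw [currents_singleton_photon]
  simp only [externalLine, state]
  cases hs : species i with
  | charged f σ => rfl
  | photon => exact absurd hs h

theorem singleton_photon {i : ι} (h : species i = .photon) :
    (currents g x.state {i}).photon = fun μ => conj (x.pol i μ) := by
  rw [currents_singleton_photon]
  simp only [externalLine, state, h]

theorem mdot_momentum_pol {i : ι} (h : species i = .photon) :
    mdot (toC (x.p i)) (fun μ => conj (x.pol i μ)) = 0 := by
  have h1 := congrArg conj (x.isPol i h).transverse
  simpa [mdot, toC] using h1

/-- Transversality survives the gauge transformation because the photon is on shell. -/
theorem mdot_momentum_gB_singleton (i : ι) : mdot (toC (x.p i)) (gB g w x {i}) = 0 := by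
  by_cases h : species i = .photon
  · have h1 := mdot_momentum_pol (x := x) h
    have h2 : mdot (toC (x.p i)) (toC (x.p i)) = 0 := by rw [mdot_toC, x.kin.massless]; simp
    have h3 : gB g w x {i} = fun μ => conj (x.pol i μ) - gaugeFn g w x {i} * toC (x.p i) μ := by
      funext μ
      rw [gB_apply, singleton_photon h, totalMom_singleton]
    rw [h3]
    simp only [mdot] at h1 h2 ⊢
    linear_combination h1 - gaugeFn g w x {i} * h2
  · rw [gB_singleton_of_ne_photon h, mdot_zero_right]

/-- Adding a multiple of the null momentum preserves transversality and normalization, and the axial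
condition supplies a second orthogonal vector. The bound does not see the reference vector, which
may be arbitrarily close to the momentum. -/
theorem norm_gB_singleton_le {i : ι} {s : Option (Fin N)} (hs : sector i = s) {κ : ℝ} (hκ : 0 < κ)
    (ht : Causal (x.tau w s)) (ht0 : x.tau w s 0 = 1)
    (h : κ * x.p i 0 ≤ mdot (x.tau w s) (x.p i)) (μ : Fin 4) :
    ‖gB g w x {i} μ‖ ≤ 2 / κ + 2 := by
  by_cases hi : species i = .photon
  · have hq0 := x.kin.energy_pos i
    have hne : mdot (x.tau w s) (totalMom x.p {i}) ≠ 0 := by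
      rw [totalMom_singleton]; exact (lt_of_lt_of_le (mul_pos hκ hq0) h).ne'
    have hsub : ({i} : Finset ι) ⊆ sectorSet sector s := by
      rw [Finset.singleton_subset_iff]; exact mem_sectorSet.2 hs
    refine norm_le_of_orthogonal hκ ht ht0 (x.causal i) hq0 h ?_
      (mdot_tau_gB (Finset.singleton_nonempty i) hsub hne) (mdot_momentum_gB_singleton i) μ
    have h1 := mdot_momentum_pol (x := x) hi
    have h1' := (x.isPol i hi).transverse
    have h2 : mdot (toC (x.p i)) (toC (x.p i)) = 0 := by rw [mdot_toC, x.kin.massless]; simp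
    have h3 : gB g w x {i} = fun μ => conj (x.pol i μ) - gaugeFn g w x {i} * toC (x.p i) μ := by
      funext μ
      rw [gB_apply, singleton_photon hi, totalMom_singleton]
    have h4 := (x.isPol i hi).normalized
    rw [h3]
    have h5 : ∀ μ, conj (toC (x.p i) μ) = toC (x.p i) μ := fun μ => Complex.conj_ofReal _
    simp only [mdot, map_sub, map_mul, Complex.conj_conj, h5] at h1 h1' h2 h4 ⊢
    linear_combination h4 - conj (gaugeFn g w x {i}) * h1 - gaugeFn g w x {i} * h1'
      + conj (gaugeFn g w x {i}) * gaugeFn g w x {i} * h2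
  · rw [gB_singleton_of_ne_photon hi, Pi.zero_apply, norm_zero]
    positivity

end Config
end ScalarQED
namespace ScalarQED
namespace Config

open Filter Asymptotics

variable {ι F : Type*} [Fintype ι] {N : ℕ} {species : ι → Species F}
  {sector : ι → Option (Fin N)} {K : ℝ} [DecidableEq ι] [DecidableEq F] [Fintype F]

/-! ### Soft particles -/

/-- Gauge vectors that are separated from the soft particles. -/
structure Admissible (w : Config species sector K → Fin 4 → ℝ) : Prop where
  causal : ∀ x, Causal (w x)
  zero : ∀ x, w x 0 = 1
  separated : ∃ κ : ℝ, 0 < κ ∧ ∀ x i, sector i = none → κ * x.p i 0 ≤ mdot (w x) (x.p i)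

theorem admissible_n (hK : 0 < K) (j : Fin N) :
    Admissible fun x : Config species sector K => x.n j where
  causal x := x.n_causal j
  zero x := x.n_zero j
  separated := ⟨K⁻¹ * K⁻¹, by positivity, fun x _ h => x.soft_separated hK h j⟩

/-- The rest frame. -/
def restFrame (_ : Config species sector K) : Fin 4 → ℝ := Pi.single 0 1

theorem mdot_restFrame (x : Config species sector K) (v : Fin 4 → ℝ) :
    mdot x.restFrame v = v 0 := by
  simp [mdot, restFrame]

theorem admissible_restFrame : Admissible (restFrame (species := species) (sector := sector)
    (K := K)) where
  causal x := ⟨by simp [restFrame], by simp [restFrame]⟩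
  zero x := by simp [restFrame]
  separated := ⟨1, one_pos, fun x i _ => by rw [mdot_restFrame, one_mul]⟩

/-- `w·P` is at least `κ P⁰`, and `P⁰` dominates every component, so the gauge term of a soft field
costs no inverse power of `lam`. -/
theorem Admissible.vOrd_ratio {w : Config species sector K → Fin 4 → ℝ} (hw : Admissible w)
    {T : Finset ι} (hT : ∀ i ∈ T, sector i = none) :
    VOrd (fun x μ => ((mdot (w x) (totalMom x.p T) : ℝ) : ℂ)⁻¹ * toC (totalMom x.p T) μ) 0 := by
  obtain ⟨κ, hκ, h⟩ := hw.separated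
  intro μ
  refine Ord.of_le (C := κ⁻¹) (Eventually.of_forall fun x => ?_)
  have h1 := (Causal.sum x.causal T).abs_le μ
  have h2 : κ * totalMom x.p T 0 ≤ mdot (w x) (totalMom x.p T) := by
    rw [mdot_sum_right, totalMom_apply, Finset.mul_sum]
    exact Finset.sum_le_sum fun i hi => h x i (hT i hi)
  have h3 : 0 ≤ mdot (w x) (totalMom x.p T) := (hw.causal x).mdot_nonneg (Causal.sum x.causal T)
  rw [zpow_zero, mul_one, norm_mul, norm_inv, Complex.norm_real, Real.norm_of_nonneg h3, toC,
    Complex.norm_real, Real.norm_eq_abs]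
  rcases h3.eq_or_lt with h4 | h4
  · rw [← h4, inv_zero, zero_mul]; positivity
  · rw [inv_mul_le_iff₀ h4]
    have h5 : |totalMom x.p T μ| ≤ κ⁻¹ * mdot (w x) (totalMom x.p T) :=
      h1.trans ((le_inv_mul_iff₀ hκ).2 h2)
    linarith

theorem Admissible.vOrd {w : Config species sector K → Fin 4 → ℝ} (hw : Admissible w) :
    VOrd (fun x => toC (w x)) 0 :=
  vOrd_toC_of_le (C := 1) (Eventually.of_forall fun x μ => by
    rw [zpow_zero, mul_one, ← hw.zero x]; exact (hw.causal x).abs_le μ)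

/-- A set of particles is a single particle, consists of photons, or contains a pair with a
charged particle. -/
theorem particles_cases (species : ι → Species F) {T : Finset ι} (hT : T.Nonempty) :
    (∃ i, T = {i}) ∨ (2 ≤ T.card ∧ ∀ i ∈ T, species i = .photon) ∨
      ∃ i ∈ T, ∃ i' ∈ T, i ≠ i' ∧ species i ≠ .photon := by
  by_cases h : T.card = 1
  · exact Or.inl (Finset.card_eq_one.1 h)
  · have h2 : 2 ≤ T.card := by have := hT.card_pos; omega
    by_cases hp : ∀ i ∈ T, species i = .photon
    · exact Or.inr (Or.inl ⟨h2, hp⟩)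
    · push Not at hp
      obtain ⟨i, hi, hc⟩ := hp
      obtain ⟨i', hi', hne⟩ := Finset.exists_mem_ne (show 1 < T.card by omega) i
      exact Or.inr (Or.inr ⟨i, hi, i', hi', hne.symm, hc⟩)

theorem ssubset_of_sdiff_nonempty {A T : Finset ι} (hA : A ⊆ T) (h : (T \ A).Nonempty) :
    A ⊂ T := by
  refine Finset.ssubset_iff_subset_ne.2 ⟨hA, ?_⟩
  rintro rfl
  simp at h

theorem sdiff_ssubset_of_nonempty {A T : Finset ι} (hA : A ⊆ T) (h : A.Nonempty) : T \ A ⊂ T :=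
  Finset.sdiff_ssubset hA h

theorem ssubset_of_subset_sdiff {A A' T : Finset ι} (hA : A ⊆ T) (h : A.Nonempty)
    (hA' : A' ⊆ T \ A) : A' ⊂ T :=
  lt_of_le_of_lt hA' (sdiff_ssubset_of_nonempty hA h)

/-- Soft fields are `O(lam²)` relative to the weight of the particles. -/
theorem soft_bounds (hK : 0 < K) (g : ℝ) {w : Config species sector K → Fin 4 → ℝ}
    (hw : Admissible w) (T : Finset ι) (hT : T.Nonempty) (hs : ∀ i ∈ T, sector i = none) :
    (∀ f σ, Ord (fun x => gPhi g w x f σ T) (2 - wt sector T)) ∧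
      VOrd (fun x => gB g w x T) (2 - wt sector T) := by
  induction T using Finset.strongInduction with
  | H T ih =>
  rcases particles_cases species hT with ⟨i, rfl⟩ | ⟨h2, hp⟩ | ⟨i, hi, i', hi', hne, hc⟩
  · have hi : sector i = none := hs i (Finset.mem_singleton_self i)
    rw [wt_singleton, if_pos hi]
    refine ⟨fun f σ => Ord.gPhi_singleton g w f σ i, fun μ => ?_⟩
    obtain ⟨κ, hκ, h⟩ := hw.separated
    refine Ord.of_le (C := 2 / κ + 2) (Eventually.of_forall fun x => ?_)
    rw [sub_self, zpow_zero, mul_one]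
    exact norm_gB_singleton_le hi hκ (hw.causal x) (hw.zero x) (h x i hi) μ
  · refine ⟨fun f σ => ?_, ?_⟩
    · simpa only [gPhi_of_photon hp] using Ord.zero
    · exact isScaling_vOrd.congr (isScaling_vOrd.zero _)
        (Eventually.of_forall fun x => gB_of_photon h2 hp)
  -- A soft denominator costs `lam⁴`. Each vertex yields `lam⁶`, from two fields and a momentum or
  -- from three fields, which leaves the `lam²` of the claim.
  · have hden := den_lower (species := species) (K := K) hi hi' (e := 4)
      ⟨K⁻¹, inv_pos.2 hK, Eventually.of_forall fun x => x.kin.soft_lower i i' hne (hs i hi)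
        (hs i' hi') fun h => hc h.1⟩
    have hmem : ∀ {A}, A ⊆ T → ∀ i ∈ A, sector i = none := fun h i hi => hs i (h hi)
    have hmom : ∀ {A}, A ⊆ T → ∀ i ∈ A,
        VOrd (fun x : Config species sector K => toC (x.p i)) 2 :=
      fun h i hi => vOrd_soft i (hmem h i hi)
    have hA : VOrd (fun x : Config species sector K => (currents g x.state T).photon)
        (2 - wt sector T) := by
      refine isScaling_vOrd.photon_step hK g w hden ?_ ?_
      · intro f A hA hA1 hA2
        have h1 := (ih A (ssubset_of_sdiff_nonempty hA hA2) hA1 (hmem hA)).1 f 1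
        have h2 := (ih (T \ A) (sdiff_ssubset_of_nonempty hA hA1) hA2
          (hmem Finset.sdiff_subset)).1 f (-1)
        have hwt := wt_add_sdiff (sector := sector) hA
        exact isScaling_vOrd.mono (isScaling_vOrd.smul (h1.mul h2)
          (isScaling_vOrd.momentum_sub (hmom hA) (hmom Finset.sdiff_subset))) (by omega)
      · intro f A A' hA hA' hA1 hA2 hA3
        have h1 := (ih A (ssubset_of_sdiff_nonempty hA (hA2.mono hA')) hA1 (hmem hA)).1 f 1
        have h2 := (ih A' (ssubset_of_subset_sdiff hA hA1 hA') hA2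
          (hmem (hA'.trans Finset.sdiff_subset))).1 f (-1)
        have h3 := (ih _ (ssubset_of_subset_sdiff hA hA1 Finset.sdiff_subset) hA3
          (hmem (Finset.sdiff_subset.trans Finset.sdiff_subset))).2
        have hwt := wt_add_sdiff (sector := sector) hA
        have hwt' := wt_add_sdiff (sector := sector) hA'
        exact isScaling_vOrd.mono (isScaling_vOrd.smul (h1.mul h2) h3) (by omega)
    refine ⟨fun f σ => ?_, ?_⟩
    · refine Ord.gPhi_step hK g w hden f σ ?_ ?_
      · intro A hA hA1 hA2
        have h1 := (ih A (ssubset_of_sdiff_nonempty hA hA2) hA1 (hmem hA)).2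
        have h2 := (ih (T \ A) (sdiff_ssubset_of_nonempty hA hA1) hA2
          (hmem Finset.sdiff_subset)).1 f σ
        have hwt := wt_add_sdiff (sector := sector) hA
        exact (((isScaling_vOrd.momentum_sum (hmom hA) (hmom Finset.sdiff_subset)).mdot h1).mul
          h2).mono (by omega)
      · intro A A' hA hA' hA1 hA2 hA3
        have h1 := (ih A (ssubset_of_sdiff_nonempty hA (hA2.mono hA')) hA1 (hmem hA)).2
        have h2 := (ih A' (ssubset_of_subset_sdiff hA hA1 hA') hA2
          (hmem (hA'.trans Finset.sdiff_subset))).2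
        have h3 := (ih _ (ssubset_of_subset_sdiff hA hA1 Finset.sdiff_subset) hA3
          (hmem (Finset.sdiff_subset.trans Finset.sdiff_subset))).1 f σ
        have hwt := wt_add_sdiff (sector := sector) hA
        have hwt' := wt_add_sdiff (sector := sector) hA'
        exact ((h1.mdot h2).mul h3).mono (by omega)
    · have hsub : T ⊆ sectorSet sector none := fun i hi => mem_sectorSet.2 (hs i hi)
      have h1 := isScaling_vOrd.smul (hw.vOrd.mdot hA) (hw.vOrd_ratio hs)
      refine isScaling_vOrd.congr (isScaling_vOrd.sub hA (isScaling_vOrd.mono h1 (by omega)))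
        (Eventually.of_forall fun x => ?_)
      funext μ
      rw [gB_of_subset hT hsub, tau, div_mul_eq_mul_div, mul_div_assoc, div_eq_inv_mul]

/-! ### Jets -/

theorem tau_some (w : Config species sector K → Fin 4 → ℝ) (x : Config species sector K)
    (j : Fin N) : x.tau w (some j) = (x.t j 0)⁻¹ • x.t j := rfl

theorem tau_some_causal (w : Config species sector K → Fin 4 → ℝ) (x : Config species sector K)
    (j : Fin N) : Causal (x.tau w (some j)) :=
  (x.t_causal j).smul (inv_nonneg.2 (x.isDir j).pos.le)

theorem tau_some_zero (w : Config species sector K → Fin 4 → ℝ) (x : Config species sector K)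
    (j : Fin N) : x.tau w (some j) 0 = 1 := by
  rw [tau_some, Pi.smul_apply, smul_eq_mul, inv_mul_cancel₀ (x.isDir j).pos.ne']

theorem mdot_tau_some (w : Config species sector K → Fin 4 → ℝ) (x : Config species sector K)
    (j : Fin N) (v : Fin 4 → ℝ) : mdot (x.tau w (some j)) v = (x.t j 0)⁻¹ * mdot (x.t j) v := by
  simp only [tau_some, mdot, Pi.smul_apply, smul_eq_mul]; ring

theorem vOrd_tau_some (w : Config species sector K → Fin 4 → ℝ) (j : Fin N) :
    VOrd (fun x => toC (x.tau w (some j))) 0 :=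
  vOrd_toC_of_le (C := 1) (Eventually.of_forall fun x μ => by
    rw [zpow_zero, mul_one, ← tau_some_zero w x j]; exact (tau_some_causal w x j).abs_le μ)

theorem eventually_tau_separated (hK : 0 < K) {i : ι} {j : Fin N} (h : sector i = some j)
    (w : Config species sector K → Fin 4 → ℝ) :
    ∃ κ : ℝ, 0 < κ ∧ ∀ᶠ x in small, κ ≤ mdot (x.tau w (some j)) (x.p i) := by
  obtain ⟨κ, hκ, h1⟩ := eventually_t_separated (species := species) hK h
  refine ⟨κ, hκ, h1.mono fun x hx => ?_⟩
  rw [mdot_tau_some, mdot_comm, le_inv_mul_iff₀ (x.isDir j).pos, mul_comm]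
  exact hx

theorem ord_inv_tau (hK : 0 < K) (w : Config species sector K → Fin 4 → ℝ) {T : Finset ι} {i : ι}
    (hi : i ∈ T) {j : Fin N} (h : sector i = some j) :
    Ord (fun x => ((mdot (x.tau w (some j)) (totalMom x.p T) : ℝ) : ℂ)⁻¹) 0 ∧
      ∀ᶠ x in small, mdot (x.tau w (some j)) (totalMom x.p T) ≠ 0 := by
  obtain ⟨κ, hκ, h1⟩ := eventually_tau_separated (species := species) hK h w
  have h2 : ∀ᶠ x in small, κ ≤ mdot (x.tau w (some j)) (totalMom x.p T) :=
    h1.mono fun x hx => hx.trans (le_mdot_totalMom x.causal (tau_some_causal w x j) hi)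
  refine ⟨?_, h2.mono fun x hx => (lt_of_lt_of_le hκ hx).ne'⟩
  simpa using Ord.inv (a := 0) hκ (h2.mono fun x hx => by rwa [zpow_zero, mul_one])

/-- `1` if there are soft particles, and `0` otherwise. -/
def soft (sector : ι → Option (Fin N)) (T : Finset ι) : ℤ :=
  if ∃ i ∈ T, sector i = none then 1 else 0

/-- A soft particle of `T` lies in one of the two parts, so the suppression is not lost when a
vertex splits `T`. -/
theorem soft_le_add {A T : Finset ι} :
    soft sector T ≤ soft sector A + soft sector (T \ A) := by
  unfold soft
  by_cases h : ∃ i ∈ T, sector i = none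
  · obtain ⟨i, hi, hs⟩ := h
    by_cases hA : i ∈ A
    · rw [if_pos (⟨i, hi, hs⟩ : ∃ i ∈ T, sector i = none),
        if_pos (⟨i, hA, hs⟩ : ∃ i ∈ A, sector i = none)]
      split_ifs <;> norm_num
    · rw [if_pos (⟨i, hi, hs⟩ : ∃ i ∈ T, sector i = none),
        if_pos (⟨i, Finset.mem_sdiff.2 ⟨hi, hA⟩, hs⟩ : ∃ i ∈ T \ A, sector i = none)]
      split_ifs <;> norm_num
  · rw [if_neg h]
    split_ifs <;> norm_num

theorem norm_gB_jet_singleton (hK : 0 < K) (g : ℝ) (w : Config species sector K → Fin 4 → ℝ)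
    {i : ι} {j : Fin N} (h : sector i = some j) : VOrd (fun x => gB g w x {i}) 0 := by
  obtain ⟨κ, hκ, h1⟩ := eventually_tau_separated (species := species) hK h w
  intro μ
  refine Ord.of_le (C := 2 / (κ * K⁻¹) + 2) (h1.mono fun x hx => ?_)
  rw [zpow_zero, mul_one]
  refine norm_gB_singleton_le h (by positivity) (tau_some_causal w x j) (tau_some_zero w x j) ?_ μ
  refine le_trans ?_ hx
  rw [mul_assoc]
  have : K⁻¹ * x.p i 0 ≤ 1 := by rw [inv_mul_le_iff₀ hK, mul_one]; exact x.energy_le h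
  nlinarith

/-- By transversality `n·B` equals minus `(p - p⁰ n)·B / p⁰`, hence is `O(lam)`. -/
theorem coll_gB_jet_singleton (hK : 0 < K) (g : ℝ) (w : Config species sector K → Fin 4 → ℝ)
    {i : ι} {j : Fin N} (h : sector i = some j) : Coll j (fun x => gB g w x {i}) (-1) := by
  have hB := norm_gB_jet_singleton hK g w h
  refine VOrd.coll hB ?_
  have h1 : Ord (fun x : Config species sector K => ((x.p i 0 : ℝ) : ℂ)⁻¹) 0 := by
    simpa using Ord.inv (a := 0) (inv_pos.2 hK) (Eventually.of_forall fun x => by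
      rw [zpow_zero, mul_one]; exact x.le_energy h)
  have h2 := (h1.mul ((vOrd_transverse (species := species) hK h).mdot hB)).neg
  refine (h2.mono (by norm_num)).congr (Eventually.of_forall fun x => ?_)
  have h3 := mdot_momentum_gB_singleton (g := g) (w := w) (x := x) i
  have h4 : ((x.p i 0 : ℝ) : ℂ) ≠ 0 := by exact_mod_cast (x.kin.energy_pos i).ne'
  rw [← mul_right_inj' h4, mul_neg, mul_inv_cancel_left₀ h4]
  simp only [mdot, toC, Pi.sub_apply, Pi.smul_apply, smul_eq_mul] at h3 ⊢
  push_cast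
  linear_combination h3

/-- The scaling of the fields of a jet and of the soft particles, in the gauge in which the soft
photons are orthogonal to the jet direction. -/
def JetBound (species : ι → Species F) (sector : ι → Option (Fin N)) (K g : ℝ) (j : Fin N)
    (T : Finset ι) : Prop :=
  (∀ f σ, Ord (fun x : Config species sector K => gPhi g (fun x => x.n j) x f σ T)
      (1 + soft sector T - wt sector T)) ∧
    Coll j (fun x : Config species sector K => gB g (fun x => x.n j) x T)
      (soft sector T - wt sector T)

/-- This is the decoupling of soft photons: with `n_j` as soft gauge vector `n_j·B` vanishes
exactly, so a soft photon field counts as collinear with one power to spare. Without this, its size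
alone would give no suppression. -/
theorem jetBound_of_soft (hK : 0 < K) (g : ℝ) (j : Fin N) (T : Finset ι) (hT : T.Nonempty)
    (hsoft : ∀ i ∈ T, sector i = none) : JetBound species sector K g j T := by
  have h1 : soft sector T = 1 := by
    obtain ⟨i, hi⟩ := hT
    exact if_pos ⟨i, hi, hsoft i hi⟩
  have hb := soft_bounds hK g (admissible_n (species := species) hK j) T hT hsoft
  have hn : Ord (fun x : Config species sector K =>
      mdot (toC (x.n j)) (gB g (fun x => x.n j) x T)) (soft sector T - wt sector T + 2) := by
    refine Ord.zero.congr (Eventually.of_forall fun x => ?_)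
    have hsub : T ⊆ sectorSet sector none := fun i hi => mem_sectorSet.2 (hsoft i hi)
    obtain ⟨i, hi⟩ := hT
    have h2 : 0 < mdot (x.n j) (x.p i) :=
      lt_of_lt_of_le (mul_pos (inv_pos.2 hK) (pow_pos x.lam_pos 2))
        (x.kin.soft_not_collinear i j (hsoft i hi))
    have h3 : mdot (x.n j) (totalMom x.p T) ≠ 0 :=
      (h2.trans_le (le_mdot_totalMom x.causal (x.n_causal j) hi)).ne'
    have h4 := mdot_tau_gB (g := g) (w := fun x => x.n j) (x := x) (s := none) ⟨i, hi⟩ hsub h3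
    exact h4
  constructor
  · intro f σ
    exact (hb.1 f σ).mono (by omega)
  · exact VOrd.coll (fun μ => (hb.2 μ).mono (by omega)) hn

/-! ### The induction step for a set with particles of a jet -/

section JetStep

variable {T : Finset ι} {j : Fin N}

/-- The two charged fields at the vertex provide the `lam²` that cancels the denominator; the
remaining vector, a momentum or a photon field, is collinear. -/
theorem jet_photon_step (hK : 0 < K) (g : ℝ)
    (hden : Ord (fun x : Config species sector K => ((x.den T : ℝ) : ℂ)⁻¹) (-((2 : ℕ) : ℤ)) ∧
      ∀ᶠ x : Config species sector K in small, x.den T ≠ 0)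
    (hmom : ∀ i ∈ T, Coll j (fun x : Config species sector K => toC (x.p i)) 0)
    (ih : ∀ A, A ⊂ T → A.Nonempty → JetBound species sector K g j A) :
    Coll j (fun x : Config species sector K => (currents g x.state T).photon)
      (soft sector T - wt sector T) := by
  have hQ := isScaling_coll (species := species) (sector := sector) (K := K) j
  refine hQ.photon_step hK g (fun x => x.n j) hden ?_ ?_
  · intro f A hA hA1 hA2
    have h1 := (ih A (ssubset_of_sdiff_nonempty hA hA2) hA1).1 f 1
    have h2 := (ih (T \ A) (sdiff_ssubset_of_nonempty hA hA1) hA2).1 f (-1)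
    have hwt := wt_add_sdiff (sector := sector) hA
    have hsf := soft_le_add (sector := sector) (A := A) (T := T)
    have h3 := hQ.momentum_sub (fun i hi => hmom i (hA hi))
      (fun i hi => hmom i (Finset.sdiff_subset (t := A) hi))
    exact hQ.mono (hQ.smul (h1.mul h2) h3) (by omega)
  · intro f A A' hA hA' hA1 hA2 hA3
    have h1 := (ih A (ssubset_of_sdiff_nonempty hA (hA2.mono hA')) hA1).1 f 1
    have h2 := (ih A' (ssubset_of_subset_sdiff hA hA1 hA') hA2).1 f (-1)
    have h3 := (ih _ (ssubset_of_subset_sdiff hA hA1 Finset.sdiff_subset) hA3).2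
    have hwt := wt_add_sdiff (sector := sector) hA
    have hwt' := wt_add_sdiff (sector := sector) hA'
    have hsf := soft_le_add (sector := sector) (A := A) (T := T)
    have hsf' := soft_le_add (sector := sector) (A := A') (T := T \ A)
    exact hQ.mono (hQ.smul (h1.mul h2) h3) (by omega)

/-- The product of two collinear vectors at the vertex gains the `lam²` that the denominator costs;
one power of `lam` remains from the charged field. -/
theorem jet_phi_step (hK : 0 < K) (g : ℝ)
    (hden : Ord (fun x : Config species sector K => ((x.den T : ℝ) : ℂ)⁻¹) (-((2 : ℕ) : ℤ)) ∧
      ∀ᶠ x : Config species sector K in small, x.den T ≠ 0)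
    (hn : ∀ᶠ x : Config species sector K in small, mdot (x.n j) (x.n j) = 0)
    (hmom : ∀ i ∈ T, Coll j (fun x : Config species sector K => toC (x.p i)) 0)
    (ih : ∀ A, A ⊂ T → A.Nonempty → JetBound species sector K g j A) (f : F) (σ : ℤˣ) :
    Ord (fun x : Config species sector K => gPhi g (fun x => x.n j) x f σ T)
      (1 + soft sector T - wt sector T) := by
  have hQ := isScaling_coll (species := species) (sector := sector) (K := K) j
  refine Ord.gPhi_step hK g _ hden f σ ?_ ?_
  · intro A hA hA1 hA2
    have h1 := (ih A (ssubset_of_sdiff_nonempty hA hA2) hA1).2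
    have h2 := (ih (T \ A) (sdiff_ssubset_of_nonempty hA hA1) hA2).1 f σ
    have hwt := wt_add_sdiff (sector := sector) hA
    have hsf := soft_le_add (sector := sector) (A := A) (T := T)
    have h3 := hQ.momentum_sum (fun i hi => hmom i (hA hi))
      (fun i hi => hmom i (Finset.sdiff_subset (t := A) hi))
    exact ((Coll.mdot hn h3 h1).mul h2).mono (by omega)
  · intro A A' hA hA' hA1 hA2 hA3
    have h1 := (ih A (ssubset_of_sdiff_nonempty hA (hA2.mono hA')) hA1).2
    have h2 := (ih A' (ssubset_of_subset_sdiff hA hA1 hA') hA2).2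
    have h3 := (ih _ (ssubset_of_subset_sdiff hA hA1 Finset.sdiff_subset) hA3).1 f σ
    have hwt := wt_add_sdiff (sector := sector) hA
    have hwt' := wt_add_sdiff (sector := sector) hA'
    have hsf := soft_le_add (sector := sector) (A := A) (T := T)
    have hsf' := soft_le_add (sector := sector) (A := A') (T := T \ A)
    exact ((Coll.mdot hn h1 h2).mul h3).mono (by omega)

/-- On a pure jet set the gauge term is a multiple of the collinear vector `P_T`, with a coefficient
no larger than the photon field because `tau·P_T` is bounded below. Mixed sets have no gauge term.
-/
theorem coll_gB_of_photon (hK : 0 < K) (g : ℝ)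
    (hmom : ∀ i ∈ T, Coll j (fun x : Config species sector K => toC (x.p i)) 0)
    {i₁ : ι} (hi₁ : i₁ ∈ T) (hj₁ : sector i₁ = some j) {a : ℤ}
    (hA : Coll j (fun x : Config species sector K => (currents g x.state T).photon) a) :
    Coll j (fun x : Config species sector K => gB g (fun x => x.n j) x T) a := by
  have hQ := isScaling_coll (species := species) (sector := sector) (K := K) j
  by_cases hjet : T ⊆ sectorSet sector (some j)
  · have h1 := hQ.smul (((vOrd_tau_some (fun x => x.n j) j).mdot hA.vOrd).mul
      (ord_inv_tau hK (fun x => x.n j) hi₁ hj₁).1) (hQ.totalMom hmom)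
    refine hQ.congr (hQ.sub hA (hQ.mono h1 (by omega))) (Eventually.of_forall fun x => ?_)
    funext μ
    rw [gB_of_subset ⟨i₁, hi₁⟩ hjet, div_eq_mul_inv]
  · refine hQ.congr hA (Eventually.of_forall fun x => gB_of_not_subset ?_)
    intro s hsub
    have h1 := mem_sectorSet.1 (hsub hi₁)
    rw [hj₁] at h1
    exact hjet (h1 ▸ hsub)

end JetStep

theorem jet_bounds (hK : 0 < K) (g : ℝ) (j : Fin N) (T : Finset ι) (hT : T.Nonempty)
    (hs : ∀ i ∈ T, sector i = some j ∨ sector i = none) : JetBound species sector K g j T := by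
  induction T using Finset.strongInduction with
  | H T ih =>
  by_cases hsoft : ∀ i ∈ T, sector i = none
  · exact jetBound_of_soft hK g j T hT hsoft
  push Not at hsoft
  obtain ⟨i₁, hi₁, hj₁'⟩ := hsoft
  have hj₁ : sector i₁ = some j := (hs i₁ hi₁).resolve_right hj₁'
  rcases particles_cases species hT with ⟨i, rfl⟩ | ⟨h2, hp⟩ | ⟨i, hi, i', hi', hne, hc⟩
  · obtain rfl := Finset.mem_singleton.1 hi₁
    have h1 : soft sector {i₁} = 0 := by simp [soft, hj₁]
    rw [JetBound, wt_singleton, if_neg hj₁', h1]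
    exact ⟨fun f σ => Ord.gPhi_singleton g _ f σ i₁, coll_gB_jet_singleton hK g _ hj₁⟩
  · refine ⟨fun f σ => ?_, ?_⟩
    · simpa only [gPhi_of_photon hp] using Ord.zero
    · exact (isScaling_coll j).congr ((isScaling_coll j).zero _)
        (Eventually.of_forall fun x => gB_of_photon h2 hp)
  -- If the charged particle `i` is in the jet, it is paired with `i'`. If it is soft, it is paired
  -- with the jet particle `i₁`: two soft particles would only give `lam⁴`.
  · have hden : Ord (fun x : Config species sector K => ((x.den T : ℝ) : ℂ)⁻¹) (-((2 : ℕ) : ℤ)) ∧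
        ∀ᶠ x : Config species sector K in small, x.den T ≠ 0 := by
      rcases hs i hi with h | h
      · rcases hs i' hi' with h' | h'
        · exact den_lower hi hi' ⟨K⁻¹, inv_pos.2 hK, Eventually.of_forall fun x =>
            x.kin.collinear_lower i i' j hne h h' fun h => hc h.1⟩
        · exact den_lower hi hi' (eventually_soft_separated hK h h')
      · exact den_lower hi₁ hi (eventually_soft_separated hK hj₁ h)
    have hn := eventually_n_null (species := species) hK hj₁
    have hmom : ∀ i ∈ T, Coll j (fun x : Config species sector K => toC (x.p i)) 0 :=
      fun i hi => coll_momentum hK (hs i hi)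
    have ih' : ∀ A, A ⊂ T → A.Nonempty → JetBound species sector K g j A :=
      fun A hA hA1 => ih A hA hA1 fun i hi => hs i (hA.1 hi)
    exact ⟨jet_phi_step hK g hden hn hmom ih',
      coll_gB_of_photon hK g hmom hi₁ hj₁ (jet_photon_step hK g hden hmom ih')⟩

/-- In the axial gauge a jet photon has no large component. -/
theorem jet_photon_bound (hK : 0 < K) (g : ℝ) (j : Fin N) (T : Finset ι) (hT : T.Nonempty)
    (hs : T ⊆ sectorSet sector (some j)) :
    VOrd (fun x : Config species sector K => gB g (fun x => x.n j) x T) (1 - wt sector T) := by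
  have hj : ∀ i ∈ T, sector i = some j := fun i hi => mem_sectorSet.1 (hs hi)
  obtain ⟨i, hi⟩ := hT
  have h0 : soft sector T = 0 := if_neg (by
    rintro ⟨i, hi, h⟩
    rw [hj i hi] at h
    exact absurd h (by simp))
  obtain ⟨α, R, h, h1, h2, h3⟩ := (jet_bounds (species := species) hK g j T ⟨i, hi⟩
    fun i hi => Or.inl (hj i hi)).2
  rw [h0, zero_sub] at h1 h2 h3
  have h4 : Ord (fun x : Config species sector K =>
      ((mdot (x.tau (fun x => x.n j) (some j)) (x.n j) : ℝ) : ℂ)⁻¹) 0 := by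
    have hsep : ∀ x : Config species sector K,
        K⁻¹ ≤ mdot (x.tau (fun x => x.n j) (some j)) (x.n j) := fun x => by
      rw [mdot_tau_some, le_inv_mul_iff₀ (x.isDir j).pos, mul_comm]
      exact (x.isDir j).not_collinear
    simpa using Ord.inv (a := 0) (inv_pos.2 hK) (Eventually.of_forall fun x => by
      rw [zpow_zero, mul_one]; exact hsep x)
  -- The axial condition reads `α (tau·n) + tau·R = 0`, and `tau·n` is bounded below, so the
  -- coefficient `α` is as small as `R`.
  have h5 : Ord α (1 - wt sector T) := by
    have := (h4.mul ((vOrd_tau_some (species := species) (sector := sector) (K := K)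
      (fun x => x.n j) j).mdot h2)).neg
    refine (this.mono (by omega)).congr ?_
    filter_upwards [h, (ord_inv_tau (species := species) hK (fun x => x.n j) hi (hj i hi)).2]
      with x hx hne
    have h6 := mdot_tau_gB (g := g) (w := fun x => x.n j) (x := x) ⟨i, hi⟩ hs hne
    rw [hx] at h6
    have hpos : mdot (x.tau (fun x => x.n j) (some j)) (x.n j) ≠ 0 := by
      have h7 : K⁻¹ ≤ mdot (x.tau (fun x => x.n j) (some j)) (x.n j) := by
        rw [mdot_tau_some, le_inv_mul_iff₀ (x.isDir j).pos, mul_comm]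
        exact (x.isDir j).not_collinear
      exact (lt_of_lt_of_le (inv_pos.2 hK) h7).ne'
    have hpos' : ((mdot (x.tau (fun x => x.n j) (some j)) (x.n j) : ℝ) : ℂ) ≠ 0 := by
      exact_mod_cast hpos
    have h8 := mdot_toC (x.tau (fun x => x.n j) (some j)) (x.n j)
    rw [← mul_right_inj' hpos', mul_neg, mul_inv_cancel_left₀ hpos', ← h8]
    simp only [mdot] at h6 ⊢
    linear_combination h6
  intro μ
  have h6 := h5.mul (vOrd_n (species := species) (sector := sector) (K := K) j μ)
  exact ((h6.mono (by omega)).add ((h2 μ).mono (by omega))).congr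
    (h.mono fun x hx => congrFun hx μ)

end Config
end ScalarQED
namespace ScalarQED
namespace Config

open Filter Asymptotics
open IsNilpotent (exp)

variable {ι F : Type*} [Fintype ι] {N : ℕ} {species : ι → Species F}
  {sector : ι → Option (Fin N)} {K : ℝ} [DecidableEq ι] [DecidableEq F] [Fintype F]

/-! ### Soft Wilson lines -/

/-- The change of gauge from the rest frame to the jet direction. -/
def softShift (g : ℝ) (j : Fin N) (x : Config species sector K) : Gen ι :=
  gaugeFn g (fun x => x.n j) x - gaugeFn g restFrame x

/-- The soft Wilson line of a jet. -/
def softLine (g : ℝ) (j : Fin N) (σ : ℤˣ) (x : Config species sector K) : Gen ι :=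
  exp ((-(((σ : ℤ) : ℂ) * g)) • softShift g j x)

theorem softShift_empty (g : ℝ) (j : Fin N) (x : Config species sector K) :
    softShift g j x ∅ = 0 := by
  rw [softShift, Gen.sub_apply, gaugeFn_empty, gaugeFn_empty, sub_zero]

theorem smul_softShift_empty (c : ℂ) (g : ℝ) (j : Fin N) (x : Config species sector K) :
    (c • softShift g j x) ∅ = 0 := by
  rw [Gen.smul_apply, softShift_empty, mul_zero]

theorem gaugeFn_congr (g : ℝ) (w w' : Config species sector K → Fin 4 → ℝ)
    (x : Config species sector K) {T : Finset ι} (hT : ¬T ⊆ sectorSet sector none) :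
    gaugeFn g w x T = gaugeFn g w' x T := by
  rw [gaugeFn_apply, gaugeFn_apply]
  refine Finset.sum_congr rfl fun s _ => ?_
  cases s with
  | none => rw [if_neg hT, if_neg hT]
  | some j => rfl

theorem softShift_of_not_subset (g : ℝ) (j : Fin N) (x : Config species sector K) {T : Finset ι}
    (hT : ¬T ⊆ sectorSet sector none) : softShift g j x T = 0 := by
  rw [softShift, Gen.sub_apply, gaugeFn_congr g _ restFrame x hT, sub_self]

theorem res_softShift (g : ℝ) (j : Fin N) (x : Config species sector K) :
    Gen.res (sectorSet sector none) (softShift g j x) = softShift g j x := by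
  ext T
  rw [Gen.res_apply]
  split_ifs with h
  · rfl
  · rw [softShift_of_not_subset g j x h]

theorem res_softLine (g : ℝ) (j : Fin N) (σ : ℤˣ) (x : Config species sector K) :
    Gen.res (sectorSet sector none) (softLine g j σ x) = softLine g j σ x := by
  rw [softLine, Gen.res_exp (smul_softShift_empty _ g j x), map_smul, res_softShift]

theorem softLine_of_not_subset (g : ℝ) (j : Fin N) (σ : ℤˣ) (x : Config species sector K)
    {T : Finset ι} (hT : ¬T ⊆ sectorSet sector none) : softLine g j σ x T = 0 := by
  rw [← res_softLine, Gen.res_apply, if_neg hT]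

/-- The phases in the two gauges differ by a multiple of `softShift` in the exponent, and the
exponential of a sum factors. -/
theorem gPhi_eq_softLine_mul (g : ℝ) (j : Fin N) (x : Config species sector K) (f : F) (σ : ℤˣ) :
    gPhi g restFrame x f σ = softLine g j σ x * gPhi g (fun x => x.n j) x f σ := by
  have h1 : (((σ : ℤ) : ℂ) * g) • gaugeFn g restFrame x =
      (-(((σ : ℤ) : ℂ) * g)) • softShift g j x
        + (((σ : ℤ) : ℂ) * g) • gaugeFn g (fun x => x.n j) x := by
    rw [softShift, smul_sub, neg_smul, neg_smul]; abel
  have h2 : ((((σ : ℤ) : ℂ) * g) • gaugeFn g (fun x => x.n j) x) ∅ = 0 := by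
    rw [Gen.smul_apply, gaugeFn_empty, mul_zero]
  rw [gPhi, gaugePhi, h1, Gen.exp_add (smul_softShift_empty _ g j x) h2, mul_assoc]
  rfl

theorem gB_congr (g : ℝ) (w w' : Config species sector K → Fin 4 → ℝ)
    (x : Config species sector K) {T : Finset ι} (hT : ¬T ⊆ sectorSet sector none) :
    gB g w x T = gB g w' x T := by
  funext μ
  rw [gB_apply, gB_apply, gaugeFn_congr g w w' x hT]

theorem n_mdot_soft_pos (x : Config species sector K) (j : Fin N) {T : Finset ι}
    {i : ι} (hi : i ∈ T) (hs : sector i = none) :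
    K⁻¹ * x.lam ^ 2 ≤ mdot (x.n j) (totalMom x.p T) :=
  (x.kin.soft_not_collinear i j hs).trans (le_mdot_totalMom x.causal (x.n_causal j) hi)

/-- The shift equals `n·B / (n·P)` with the soft photon field `B` of the rest-frame gauge. The
`lam²` of `B` is used up by `n·P`, so soft lines cost no power. -/
theorem ord_softShift (hK : 0 < K) (g : ℝ) (j : Fin N) (T : Finset ι) :
    Ord (fun x : Config species sector K => softShift g j x T) (0 - wt sector T) := by
  by_cases hT : T ⊆ sectorSet sector none
  · rcases T.eq_empty_or_nonempty with rfl | hne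
    · simpa only [softShift_empty] using Ord.zero
    · have hs : ∀ i ∈ T, sector i = none := fun i hi => mem_sectorSet.1 (hT hi)
      have h1 := (soft_bounds (species := species) hK g admissible_restFrame T hne hs).2
      have h2 := (vOrd_n (species := species) (sector := sector) (K := K) j).mdot h1
      obtain ⟨i, hi⟩ := hne
      have h3 : Ord (fun x : Config species sector K =>
          ((mdot (x.n j) (totalMom x.p T) : ℝ) : ℂ)⁻¹) (-2) :=
        Ord.inv (inv_pos.2 hK) (Eventually.of_forall fun x => by
          exact_mod_cast x.n_mdot_soft_pos j hi (hs i hi))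
      refine ((h3.mul h2).mono (by omega)).congr (Eventually.of_forall fun x => ?_)
      have h4 : mdot (x.n j) (totalMom x.p T) ≠ 0 :=
        (lt_of_lt_of_le (mul_pos (inv_pos.2 hK) (pow_pos x.lam_pos 2))
          (x.n_mdot_soft_pos j hi (hs i hi))).ne'
      have h4' : ((mdot (x.n j) (totalMom x.p T) : ℝ) : ℂ) ≠ 0 := by exact_mod_cast h4
      have h5 : gaugeFn g (fun x => x.n j) x T = mdot (toC (x.n j)) (currents g x.state T).photon
          / ((mdot (x.n j) (totalMom x.p T) : ℝ) : ℂ) :=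
        gaugeFn_of_subset (s := none) ⟨i, hi⟩ hT
      have h6 : gB g restFrame x T = fun μ => (currents g x.state T).photon μ
          - gaugeFn g restFrame x T * toC (totalMom x.p T) μ := funext fun μ => gB_apply T μ
      have h7 : mdot (toC (x.n j)) (gB g restFrame x T) =
          mdot (toC (x.n j)) (currents g x.state T).photon
            - gaugeFn g restFrame x T * mdot (toC (x.n j)) (toC (totalMom x.p T)) := by
        rw [h6]; simp only [mdot]; ring
      rw [softShift, Gen.sub_apply, h5, h7, mdot_toC]
      field_simp
  · simpa only [softShift_of_not_subset g j _ hT] using Ord.zero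

/-! ### Scaling of families of matrix elements -/

/-- All matrix elements are `O(lam ^ a)` relative to the weight of the particles. -/
def GOrd (f : Config species sector K → Gen ι) (a : ℤ) : Prop :=
  ∀ T, Ord (fun x => f x T) (a - wt sector T)

section GOrd

variable {f h : Config species sector K → Gen ι} {a b : ℤ}

theorem GOrd.add (hf : GOrd f a) (hh : GOrd h a) : GOrd (fun x => f x + h x) a :=
  fun T => (hf T).add (hh T)

theorem GOrd.sub (hf : GOrd f a) (hh : GOrd h a) : GOrd (fun x => f x - h x) a :=
  fun T => (hf T).sub (hh T)

theorem GOrd.mono (hf : GOrd f a) (hab : b ≤ a) : GOrd f b :=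
  fun T => (hf T).mono (by omega)

theorem GOrd.mul (hf : GOrd f a) (hh : GOrd h b) : GOrd (fun x => f x * h x) (a + b) := by
  intro T
  simp only [Gen.mul_apply]
  refine Ord.sum fun A hA => ?_
  have := wt_add_sdiff (sector := sector) (Finset.mem_powerset.1 hA)
  exact ((hf A).mul (hh (T \ A))).mono (by omega)

theorem GOrd.smul (c : ℂ) (hf : GOrd f a) : GOrd (fun x => c • f x) a := by
  intro T
  simp only [Gen.smul_apply]
  exact (hf T).const_mul c

theorem GOrd.one : GOrd (fun _ : Config species sector K => (1 : Gen ι)) 0 := by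
  intro T
  simp only [Gen.one_apply]
  split_ifs with h
  · rw [h, wt_empty]; exact Ord.const 1
  · exact Ord.zero

theorem GOrd.pow (hf : GOrd f 0) (n : ℕ) : GOrd (fun x => f x ^ n) 0 := by
  induction n with
  | zero => simpa only [pow_zero] using GOrd.one
  | succ n ih => simpa only [pow_succ, add_zero] using ih.mul hf

theorem GOrd.exp (hf : GOrd f 0) (h0 : ∀ x, f x ∅ = 0) :
    GOrd (fun x => IsNilpotent.exp (f x)) 0 := by
  intro T
  simp only [Gen.exp_apply (h0 _)]
  exact Ord.sum fun n _ => (hf.pow n T).const_mul _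

/-- Telescoping: every factor has size `lam`, and a replaced factor contributes one more power. -/
theorem GOrd.prod_sub_prod {κ : Type*} (s : Finset κ)
    {f h : κ → Config species sector K → Gen ι} (hf : ∀ k ∈ s, GOrd (f k) 1)
    (hh : ∀ k ∈ s, GOrd (h k) 1) (hfh : ∀ k ∈ s, GOrd (fun x => f k x - h k x) 2) :
    GOrd (fun x => ∏ k ∈ s, f k x) s.card ∧
      GOrd (fun x => ∏ k ∈ s, f k x - ∏ k ∈ s, h k x) (s.card + 1) := by
  classical
  induction s using Finset.induction_on with
  | empty =>
    simp only [Finset.prod_empty, Finset.card_empty, Nat.cast_zero, sub_self]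
    exact ⟨GOrd.one, fun T => Ord.zero⟩
  | insert k s hk ih =>
    obtain ⟨h1, h2⟩ := ih (fun k' hk' => hf k' (Finset.mem_insert_of_mem hk'))
      (fun k' hk' => hh k' (Finset.mem_insert_of_mem hk'))
      (fun k' hk' => hfh k' (Finset.mem_insert_of_mem hk'))
    have hk' := Finset.mem_insert_self k s
    simp only [Finset.prod_insert hk, Finset.card_insert_of_notMem hk]
    push_cast
    refine ⟨((hf k hk').mul h1).mono (by omega), ?_⟩
    have h3 := (((hfh k hk').mul h1).mono (b := (s.card : ℤ) + 1 + 1) (by omega)).add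
      (((hh k hk').mul h2).mono (b := (s.card : ℤ) + 1 + 1) (by omega))
    intro T
    refine (h3 T).congr (Eventually.of_forall fun x => ?_)
    have e : f k x * ∏ k ∈ s, f k x - h k x * ∏ k ∈ s, h k x =
        (f k x - h k x) * ∏ k ∈ s, f k x + h k x * (∏ k ∈ s, f k x - ∏ k ∈ s, h k x) := by ring
    exact congrFun e T

end GOrd

theorem gOrd_softLine (hK : 0 < K) (g : ℝ) (j : Fin N) (σ : ℤˣ) :
    GOrd (fun x : Config species sector K => softLine g j σ x) 0 := by
  have h : GOrd (fun x : Config species sector K => softShift g j x) 0 := ord_softShift hK g j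
  exact (h.smul _).exp fun x => smul_softShift_empty _ g j x

/-! ### The full fields -/

/-- There are particles of at least two jets. -/
def TwoJets (sector : ι → Option (Fin N)) (T : Finset ι) : Prop :=
  ∃ i ∈ T, ∃ i' ∈ T, ∃ j k, j ≠ k ∧ sector i = some j ∧ sector i' = some k

theorem sector_cases (sector : ι → Option (Fin N)) (T : Finset ι) :
    (∀ i ∈ T, sector i = none) ∨ TwoJets sector T ∨
      ∃ j, (∃ i ∈ T, sector i = some j) ∧ ∀ i ∈ T, sector i = some j ∨ sector i = none := by
  by_cases h : ∀ i ∈ T, sector i = none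
  · exact Or.inl h
  · push Not at h
    obtain ⟨i, hi, hs⟩ := h
    obtain ⟨j, hj⟩ := Option.ne_none_iff_exists'.1 hs
    by_cases h2 : ∀ i ∈ T, sector i = some j ∨ sector i = none
    · exact Or.inr (Or.inr ⟨j, ⟨i, hi, hj⟩, h2⟩)
    · push Not at h2
      obtain ⟨i', hi', h3, h4⟩ := h2
      obtain ⟨k, hk⟩ := Option.ne_none_iff_exists'.1 h4
      exact Or.inr (Or.inl ⟨i, hi, i', hi', j, k, fun h => h3 (h ▸ hk), hj, hk⟩)

theorem TwoJets.not_subset {T : Finset ι} (h : TwoJets sector T) (s : Option (Fin N)) :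
    ¬T ⊆ sectorSet sector s := by
  obtain ⟨i, hi, i', hi', j, k, hjk, hj, hk⟩ := h
  intro hs
  have h1 := mem_sectorSet.1 (hs hi)
  have h2 := mem_sectorSet.1 (hs hi')
  rw [hj] at h1
  rw [hk] at h2
  exact hjk (Option.some_injective _ (h1.trans h2.symm))

/-- The scaling of the fields of all particles. -/
def FullBound (species : ι → Species F) (sector : ι → Option (Fin N)) (K g : ℝ)
    (T : Finset ι) : Prop :=
  (∀ f σ, Ord (fun x : Config species sector K => gPhi g restFrame x f σ T) (1 - wt sector T)) ∧
    VOrd (fun x : Config species sector K => gB g restFrame x T) (1 - wt sector T)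

/-- The charged bound in the `n_j` gauge is carried over to the rest-frame gauge by the soft line,
which is of order one relative to its weight. -/
theorem fullBound_of_jet (hK : 0 < K) (g : ℝ) {j : Fin N} {T : Finset ι}
    (hi : ∃ i ∈ T, sector i = some j) (hs : ∀ i ∈ T, sector i = some j ∨ sector i = none) :
    FullBound species sector K g T := by
  obtain ⟨i, hi, hj⟩ := hi
  have hns : ¬T ⊆ sectorSet sector none := fun h => by
    have := mem_sectorSet.1 (h hi)
    rw [hj] at this
    exact absurd this (by simp)
  constructor
  · intro f σ
    simp only [gPhi_eq_softLine_mul g j, Gen.mul_apply]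
    refine Ord.sum fun A hA => ?_
    have hA' := Finset.mem_powerset.1 hA
    have hwt := wt_add_sdiff (sector := sector) hA'
    rcases (T \ A).eq_empty_or_nonempty with h | h
    · simpa only [h, gPhi_empty, mul_zero] using Ord.zero
    · have h1 := (jet_bounds (species := species) hK g j (T \ A) h
        fun i hi => hs i (Finset.sdiff_subset hi)).1 f σ
      have h2 : 0 ≤ soft sector (T \ A) := by unfold soft; split_ifs <;> norm_num
      exact ((gOrd_softLine hK g j σ A).mul h1).mono (by omega)
  -- On such a set the photon field does not depend on the soft gauge vector. Collinear scaling
  -- alone falls one power short; a pure jet set gains it from the axial gauge, a mixed set from its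
  -- soft particle.
  · simp only [gB_congr g restFrame (fun x => x.n j) _ hns]
    by_cases hjet : T ⊆ sectorSet sector (some j)
    · exact jet_photon_bound hK g j T ⟨i, hi⟩ hjet
    · have h1 := (jet_bounds (species := species) hK g j T ⟨i, hi⟩ hs).2.vOrd
      have h2 : soft sector T = 1 := by
        refine if_pos ?_
        by_contra hcon
        push Not at hcon
        exact hjet fun i hi => mem_sectorSet.2 ((hs i hi).resolve_right (hcon i hi))
      rwa [h2] at h1

/-- The denominator is of order one, and each vertex joins at least two fields of size `lam`, so the
charged field gains a power. -/
theorem hard_step (hK : 0 < K) (g : ℝ) {T : Finset ι} (hT : TwoJets sector T)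
    (ih : ∀ A, A ⊂ T → A.Nonempty → FullBound species sector K g A) :
    (∀ f σ, Ord (fun x : Config species sector K => gPhi g restFrame x f σ T)
        (2 - wt sector T)) ∧
      VOrd (fun x : Config species sector K => gB g restFrame x T) (1 - wt sector T) := by
  have hns := hT.not_subset
  obtain ⟨i, hi, i', hi', j, k, hjk, hj, hk⟩ := hT
  have hden := den_lower (species := species) hi hi' (eventually_jets_separated hK hj hk hjk)
  have hQ := isScaling_vOrd (species := species) (sector := sector) (K := K)
  have hmom : ∀ A : Finset ι, ∀ i ∈ A, VOrd (fun x : Config species sector K => toC (x.p i)) 0 :=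
    fun _ i _ => vOrd_momentum i
  constructor
  · intro f σ
    refine Ord.gPhi_step hK g _ hden f σ ?_ ?_
    · intro A hA hA1 hA2
      have h1 := (ih A (ssubset_of_sdiff_nonempty hA hA2) hA1).2
      have h2 := (ih (T \ A) (sdiff_ssubset_of_nonempty hA hA1) hA2).1 f σ
      have hwt := wt_add_sdiff (sector := sector) hA
      exact (((hQ.momentum_sum (hmom A) (hmom (T \ A))).mdot h1).mul h2).mono (by omega)
    · intro A A' hA hA' hA1 hA2 hA3
      have h1 := (ih A (ssubset_of_sdiff_nonempty hA (hA2.mono hA')) hA1).2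
      have h2 := (ih A' (ssubset_of_subset_sdiff hA hA1 hA') hA2).2
      have h3 := (ih _ (ssubset_of_subset_sdiff hA hA1 Finset.sdiff_subset) hA3).1 f σ
      have hwt := wt_add_sdiff (sector := sector) hA
      have hwt' := wt_add_sdiff (sector := sector) hA'
      exact ((h1.mdot h2).mul h3).mono (by omega)
  · have h : VOrd (fun x : Config species sector K => (currents g x.state T).photon)
        (1 - wt sector T) := by
      refine hQ.photon_step hK g restFrame hden ?_ ?_
      · intro f A hA hA1 hA2
        have h1 := (ih A (ssubset_of_sdiff_nonempty hA hA2) hA1).1 f 1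
        have h2 := (ih (T \ A) (sdiff_ssubset_of_nonempty hA hA1) hA2).1 f (-1)
        have hwt := wt_add_sdiff (sector := sector) hA
        exact hQ.mono (hQ.smul (h1.mul h2) (hQ.momentum_sub (hmom A) (hmom (T \ A)))) (by omega)
      · intro f A A' hA hA' hA1 hA2 hA3
        have h1 := (ih A (ssubset_of_sdiff_nonempty hA (hA2.mono hA')) hA1).1 f 1
        have h2 := (ih A' (ssubset_of_subset_sdiff hA hA1 hA') hA2).1 f (-1)
        have h3 := (ih _ (ssubset_of_subset_sdiff hA hA1 Finset.sdiff_subset) hA3).2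
        have hwt := wt_add_sdiff (sector := sector) hA
        have hwt' := wt_add_sdiff (sector := sector) hA'
        exact hQ.mono (hQ.smul (h1.mul h2) h3) (by omega)
    exact hQ.congr h (Eventually.of_forall fun x => gB_of_not_subset hns)

theorem full_bounds (hK : 0 < K) (g : ℝ) (T : Finset ι) (hT : T.Nonempty) :
    FullBound species sector K g T := by
  induction T using Finset.strongInduction with
  | H T ih =>
  rcases sector_cases sector T with h | h | ⟨j, h1, h2⟩
  · have hb := soft_bounds (species := species) hK g admissible_restFrame T hT h
    exact ⟨fun f σ => (hb.1 f σ).mono (by omega), isScaling_vOrd.mono hb.2 (by omega)⟩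
  · have hb := hard_step hK g h ih
    exact ⟨fun f σ => (hb.1 f σ).mono (by omega), hb.2⟩
  · exact fullBound_of_jet hK g h1 h2

theorem gOrd_gPhi (hK : 0 < K) (g : ℝ) (f : F) (σ : ℤˣ) :
    GOrd (fun x : Config species sector K => gPhi g restFrame x f σ) 1 := by
  intro T
  rcases T.eq_empty_or_nonempty with rfl | hT
  · simpa only [gPhi_empty] using Ord.zero
  · exact (full_bounds hK g T hT).1 f σ

/-- The field of a jet with its soft Wilson line. -/
def jetField (g : ℝ) (f : F) (σ : ℤˣ) (j : Fin N) (x : Config species sector K) : Gen ι :=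
  Gen.res (sectorSet sector (some j)) (gPhi g restFrame x f σ) * softLine g j σ x

theorem jetField_eq_zero (g : ℝ) (f : F) (σ : ℤˣ) (j : Fin N) (x : Config species sector K)
    {T : Finset ι} (h : ¬((∃ i ∈ T, sector i = some j) ∧
      ∀ i ∈ T, sector i = some j ∨ sector i = none)) : jetField g f σ j x T = 0 := by
  rw [jetField, Gen.mul_apply]
  refine Finset.sum_eq_zero fun A hA => ?_
  have hA' := Finset.mem_powerset.1 hA
  by_cases h1 : A ⊆ sectorSet sector (some j)
  · by_cases h2 : T \ A ⊆ sectorSet sector none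
    · rcases A.eq_empty_or_nonempty with rfl | ⟨i, hi⟩
      · rw [Gen.res_apply_of_subset h1, gPhi_empty, zero_mul]
      · refine absurd ⟨⟨i, hA' hi, mem_sectorSet.1 (h1 hi)⟩, fun i' hi' => ?_⟩ h
        by_cases h3 : i' ∈ A
        · exact Or.inl (mem_sectorSet.1 (h1 h3))
        · exact Or.inr (mem_sectorSet.1 (h2 (Finset.mem_sdiff.2 ⟨hi', h3⟩)))
    · rw [softLine_of_not_subset g j σ x h2, mul_zero]
  · rw [Gen.res_apply, if_neg h1, zero_mul]

/-- `softShift` lives on soft sets, so the soft gauge vector is irrelevant inside a jet. -/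
theorem res_gPhi_congr (g : ℝ) (j : Fin N) (x : Config species sector K) (f : F) (σ : ℤˣ) :
    Gen.res (sectorSet sector (some j)) (gPhi g restFrame x f σ) =
      Gen.res (sectorSet sector (some j)) (gPhi g (fun x => x.n j) x f σ) := by
  have h : Gen.res (sectorSet sector (some j)) (softShift g j x) = 0 := by
    ext T
    rw [Gen.res_apply, Gen.zero_apply]
    split_ifs with hT
    · rcases T.eq_empty_or_nonempty with rfl | ⟨i, hi⟩
      · exact softShift_empty g j x
      · refine softShift_of_not_subset g j x fun h => ?_
        have h1 := mem_sectorSet.1 (h hi)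
        rw [mem_sectorSet.1 (hT hi)] at h1
        exact absurd h1 (by simp)
    · rfl
  rw [gPhi_eq_softLine_mul g j, map_mul, softLine, Gen.res_exp (smul_softShift_empty _ g j x),
    map_smul, h, smul_zero, IsNilpotent.exp_zero, one_mul]

/-- The field is the sum of the fields of the jets, up to power corrections. -/
theorem gOrd_gPhi_sub (hK : 0 < K) (g : ℝ) (f : F) (σ : ℤˣ) :
    GOrd (fun x : Config species sector K =>
      gPhi g restFrame x f σ - ∑ j, jetField g f σ j x) 2 := by
  intro T
  simp only [Gen.sub_apply, Gen.sum_apply]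
  rcases sector_cases sector T with h | h | ⟨j, h1, h2⟩
  · have h0 : ∀ x : Config species sector K, ∑ j, jetField g f σ j x T = 0 := fun x =>
      Finset.sum_eq_zero fun j _ => jetField_eq_zero g f σ j x (by
        rintro ⟨⟨i, hi, hj⟩, _⟩
        rw [h i hi] at hj
        exact absurd hj (by simp))
    simp only [h0, sub_zero]
    rcases T.eq_empty_or_nonempty with rfl | hT
    · simpa only [gPhi_empty] using Ord.zero
    · exact (soft_bounds hK g admissible_restFrame T hT h).1 f σ
  · have h0 : ∀ x : Config species sector K, ∑ j, jetField g f σ j x T = 0 := fun x =>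
      Finset.sum_eq_zero fun j _ => jetField_eq_zero g f σ j x (by
        rintro ⟨_, hall⟩
        obtain ⟨i, hi, i', hi', j', k, hjk, hj, hk⟩ := h
        have h3 := hall i hi
        have h4 := hall i' hi'
        simp only [hj, hk, Option.some.injEq, reduceCtorEq, or_false] at h3 h4
        exact hjk (h3.trans h4.symm))
    simp only [h0, sub_zero]
    exact (hard_step hK g h fun A _ hA => full_bounds hK g A hA).1 f σ
  · have h0 : ∀ x : Config species sector K, ∑ j, jetField g f σ j x T = jetField g f σ j x T :=
      fun x => by
        refine Finset.sum_eq_single j (fun k _ hk => jetField_eq_zero g f σ k x ?_)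
          (fun h => absurd (Finset.mem_univ j) h)
        rintro ⟨⟨i, hi, hj⟩, _⟩
        have h3 := h2 i hi
        simp only [hj, Option.some.injEq, reduceCtorEq, or_false] at h3
        exact hk h3
    -- Both terms carry the same soft line. What remains is the field in the `n_j` gauge on sets
    -- with a soft particle, which `jet_bounds` suppresses by one power.
    have h3 : ∀ x : Config species sector K, gPhi g restFrame x f σ T - jetField g f σ j x T =
        ∑ A ∈ T.powerset, softLine g j σ x A * (gPhi g (fun x => x.n j) x f σ (T \ A)
          - Gen.res (sectorSet sector (some j)) (gPhi g (fun x => x.n j) x f σ) (T \ A)) :=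
      fun x => by
        rw [jetField, res_gPhi_congr, gPhi_eq_softLine_mul g j, mul_comm (Gen.res _ _),
          ← Gen.sub_apply, ← mul_sub, Gen.mul_apply]
        rfl
    simp only [h0, h3]
    refine Ord.sum fun A hA => ?_
    have hwt := wt_add_sdiff (sector := sector) (Finset.mem_powerset.1 hA)
    by_cases h4 : T \ A ⊆ sectorSet sector (some j)
    · simpa only [Gen.res_apply_of_subset h4, sub_self, mul_zero] using Ord.zero
    · simp only [Gen.res_apply, if_neg h4, sub_zero]
      have h5 : ∃ i ∈ T \ A, sector i = none := by
        by_contra hcon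
        push Not at hcon
        exact h4 fun i hi =>
          mem_sectorSet.2 ((h2 i (Finset.sdiff_subset hi)).resolve_right (hcon i hi))
      have h6 : soft sector (T \ A) = 1 := if_pos h5
      obtain ⟨i, hi, _⟩ := h5
      have h7 := (jet_bounds (species := species) hK g j (T \ A) ⟨i, hi⟩
        fun i hi => h2 i (Finset.sdiff_subset hi)).1 f σ
      rw [h6] at h7
      exact ((gOrd_softLine hK g j σ A).mul h7).mono (by omega)

end Config
end ScalarQED
namespace ScalarQED

/-! ### The number of contractions -/

section Contractions

variable {F : Type*} [DecidableEq F] {N : ℕ} {flavor : Fin N → F} {σ : Fin N → ℤˣ}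

theorem card_fiber_eq_of_neutral (h : ∀ f, ∑ j, (if flavor j = f then (σ j : ℤ) else 0) = 0) (f : F) :
    Fintype.card {p : {j // σ j = 1} // flavor p = f} =
      Fintype.card {p : {j // σ j = -1} // flavor p = f} := by
  have key : ∀ s : ℤˣ, Fintype.card {p : {j // σ j = s} // flavor p = f} =
      ∑ j, if σ j = s ∧ flavor j = f then 1 else 0 := fun s => by
    rw [Fintype.card_congr (Equiv.subtypeSubtypeEquivSubtypeInter (fun j => σ j = s)
      (fun j => flavor j = f)), Fintype.card_subtype, Finset.card_filter]
  have h1 := h f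
  rw [key, key]
  zify
  rw [← sub_eq_zero, ← Finset.sum_sub_distrib]
  refine Eq.trans (Finset.sum_congr rfl fun j _ => ?_) h1
  rcases Int.units_eq_one_or (σ j) with hs | hs <;> by_cases hf : flavor j = f <;> simp [hs, hf]

/-- A flavour-preserving bijection between the jets of scalars and those of antiscalars. -/
theorem exists_equiv_of_neutral
    (h : ∀ f, ∑ j, (if flavor j = f then (σ j : ℤ) else 0) = 0) :
    ∃ u : {j // σ j = 1} ≃ {j // σ j = -1}, ∀ p, flavor (u p) = flavor p := by
  refine ⟨Equiv.ofFiberEquiv (f := fun p : {j // σ j = 1} => flavor p)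
    (g := fun p : {j // σ j = -1} => flavor p)
    fun f => Fintype.equivOfCardEq (card_fiber_eq_of_neutral h f), fun p => ?_⟩
  exact Equiv.ofFiberEquiv_map (f := fun p : {j // σ j = 1} => flavor p)
    (g := fun p : {j // σ j = -1} => flavor p) _ p

theorem card_scalars_of_neutral
    (h : ∀ f, ∑ j, (if flavor j = f then (σ j : ℤ) else 0) = 0) {M : ℕ} (hM : N = M + M) :
    Fintype.card {j // σ j = 1} = M := by
  obtain ⟨u, _⟩ := exists_equiv_of_neutral h
  have h1 := Fintype.card_congr u
  have h2 := Fintype.card_subtype_compl fun j : Fin N => σ j = 1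
  have h3 : Fintype.card {j : Fin N // ¬σ j = 1} = Fintype.card {j // σ j = -1} :=
    Fintype.card_congr (Equiv.subtypeEquivRight fun j => by
      rcases Int.units_eq_one_or (σ j) with hs | hs <;> simp [hs])
  have h4 := Fintype.card_subtype_le fun j : Fin N => σ j = 1
  rw [Fintype.card_fin] at h2 h4
  omega

/-- The contractions of the fields `(φ_f^* φ_f)^M` with the jets. -/
def Contraction (flavor : Fin N → F) (σ : Fin N → ℤˣ) (M : ℕ) : Type _ :=
  {q : (Fin M → F) × (Fin M × ℤˣ → Fin N) //
    q.2.Bijective ∧ ∀ k, flavor (q.2 k) = q.1 k.1 ∧ σ (q.2 k) = k.2}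

/-- A contraction contracts the scalars and the antiscalars. -/
def contractionEquiv (flavor : Fin N → F) (σ : Fin N → ℤˣ) (M : ℕ) :
    Contraction flavor σ M ≃ Σ e : Fin M ≃ {j // σ j = 1},
      {e' : Fin M ≃ {j // σ j = -1} // ∀ a, flavor (e' a) = flavor (e a)} where
  toFun q :=
    have H : ∀ s : ℤˣ, Function.Bijective fun a : Fin M =>
        (⟨q.1.2 (a, s), (q.2.2 (a, s)).2⟩ : {j // σ j = s}) := fun s => by
      constructor
      · intro a b hab
        exact congrArg Prod.fst (q.2.1.1 (Subtype.ext_iff.1 hab))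
      · rintro ⟨j, hj⟩
        obtain ⟨⟨a, s'⟩, rfl⟩ := q.2.1.2 j
        have : s' = s := (q.2.2 (a, s')).2.symm.trans hj
        subst this
        exact ⟨a, rfl⟩
    ⟨Equiv.ofBijective _ (H 1), Equiv.ofBijective _ (H (-1)), fun a =>
      (q.2.2 (a, -1)).1.trans (q.2.2 (a, 1)).1.symm⟩
  invFun e := ⟨(fun a => flavor (e.1 a), fun k => if k.2 = 1 then e.1 k.1 else e.2.1 k.1), by
    refine ⟨⟨?_, ?_⟩, ?_⟩
    · rintro ⟨a, s⟩ ⟨b, s'⟩ h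
      have h1 := (e.1 a).2
      have h2 := (e.1 b).2
      have h3 := (e.2.1 a).2
      have h4 := (e.2.1 b).2
      rcases Int.units_eq_one_or s with rfl | rfl <;> rcases Int.units_eq_one_or s' with rfl | rfl
      · simpa [Subtype.coe_inj] using h
      · simp only [if_true, if_neg (show ¬(-1 : ℤˣ) = 1 by decide)] at h
        rw [h, h4] at h1
        exact absurd h1 (by decide)
      · simp only [if_true, if_neg (show ¬(-1 : ℤˣ) = 1 by decide)] at h
        rw [h, h2] at h3
        exact absurd h3 (by decide)
      · simpa [Subtype.coe_inj] using h
    · intro j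
      rcases Int.units_eq_one_or (σ j) with hj | hj
      · exact ⟨(e.1.symm ⟨j, hj⟩, 1), by simp⟩
      · exact ⟨(e.2.1.symm ⟨j, hj⟩, -1), by simp⟩
    · rintro ⟨a, s⟩
      rcases Int.units_eq_one_or s with rfl | rfl
      · simpa using (e.1 a).2
      · simpa using ⟨e.2.2 a, (e.2.1 a).2⟩⟩
  left_inv q := by
    refine Subtype.ext (Prod.ext ?_ ?_)
    · funext a
      exact (q.2.2 (a, 1)).1
    · funext ⟨a, s⟩
      rcases Int.units_eq_one_or s with rfl | rfl <;> rfl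
  right_inv e := Sigma.subtype_ext (Equiv.ext fun _ => rfl) (Equiv.ext fun _ => rfl)

instance (M : ℕ) [Fintype F] : Fintype (Contraction flavor σ M) := by
  unfold Contraction; infer_instance

/-- A contraction labels the scalar jets, in `M!` ways, and the antiscalar jets with matching
flavours. Through the bijection `u` the latter labellings are the flavour-preserving permutations of
the scalar jets, a stabilizer of order `∏ m_f!`. -/
theorem card_contraction [Fintype F]
    (h : ∀ f, ∑ j, (if flavor j = f then (σ j : ℤ) else 0) = 0) {M : ℕ} (hM : N = M + M) :
    Fintype.card (Contraction flavor σ M) = M.factorial * leadingOrder flavor σ := by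
  obtain ⟨u, hu⟩ := exists_equiv_of_neutral h
  have hP := card_scalars_of_neutral h hM
  have key : ∀ e : Fin M ≃ {j // σ j = 1}, Fintype.card
      {e' : Fin M ≃ {j // σ j = -1} // ∀ a, flavor (e' a) = flavor (e a)} =
        leadingOrder flavor σ := fun e => by
    have E : {e' : Fin M ≃ {j // σ j = -1} // ∀ a, flavor (e' a) = flavor (e a)} ≃
        {π : Equiv.Perm {j // σ j = 1} // (fun p : {j // σ j = 1} => flavor p) ∘ π =
          fun p : {j // σ j = 1} => flavor p} :=
      (Equiv.equivCongr e u.symm).subtypeEquiv fun e' => by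
        rw [funext_iff]
        constructor
        · intro h p
          have h1 := h (e.symm p)
          have h2 := hu (u.symm (e' (e.symm p)))
          simp only [Equiv.apply_symm_apply] at h1 h2
          simp only [Equiv.equivCongr_apply_apply, Function.comp]
          exact h2.symm.trans h1
        · intro h a
          have h1 := h (e a)
          have h2 := hu (u.symm (e' a))
          simp only [Equiv.equivCongr_apply_apply, Function.comp, Equiv.symm_apply_apply] at h1
          rw [Equiv.apply_symm_apply] at h2
          exact h2.trans h1
    rw [Fintype.card_congr E, DomMulAct.stabilizer_card, leadingOrder]
    refine Finset.prod_congr rfl fun f _ => ?_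
    rw [Fintype.card_congr (Equiv.subtypeSubtypeEquivSubtypeInter (fun j => σ j = 1)
      (fun j => flavor j = f)), Fintype.card_subtype]
    simp only [and_comm]
  rw [Fintype.card_congr (contractionEquiv flavor σ M), Fintype.card_sigma,
    Finset.sum_congr rfl fun e _ => key e, Finset.sum_const, smul_eq_mul, Finset.card_univ,
    Fintype.card_equiv (Fintype.equivOfCardEq (by rw [Fintype.card_fin, hP])), Fintype.card_fin]

end Contractions

/-! ### Products of operators of different sectors -/

/-- Any assignment other than `s` hands some particle to a factor that vanishes on it. -/
theorem opProd_sector {ι κ : Type*} [Fintype ι] [DecidableEq ι] [Fintype κ] [DecidableEq κ]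
    (s : ι → κ) (f : κ → Finset ι → ℂ) (hf : ∀ k T, (∃ i ∈ T, s i ≠ k) → f k T = 0) :
    opProd f Finset.univ = ∏ k, f k (Finset.univ.filter fun i => s i = k) := by
  unfold opProd
  rw [Finset.sum_eq_single fun i : (Finset.univ : Finset ι) => s i]
  · refine Finset.prod_congr rfl fun k _ => ?_
    congr 1
    ext i
    simp
  · intro a _ hne
    obtain ⟨i, hi⟩ := Function.ne_iff.1 hne
    refine Finset.prod_eq_zero (Finset.mem_univ (a i)) (hf _ _ ⟨i, ?_, hi.symm⟩)
    simp
  · exact fun h => absurd (Finset.mem_univ _) h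

theorem opProd_eq_zero {ι κ : Type*} [DecidableEq ι] [Fintype κ] [DecidableEq κ]
    {f : κ → Finset ι → ℂ} {S : Finset ι} {i : ι} (hi : i ∈ S)
    (hf : ∀ k T, i ∈ T → f k T = 0) : opProd f S = 0 := by
  unfold opProd
  refine Finset.sum_eq_zero fun a _ =>
    Finset.prod_eq_zero (Finset.mem_univ (a ⟨i, hi⟩)) (hf _ _ ?_)
  simp [hi]

end ScalarQED
namespace ScalarQED
namespace Config

open Filter Asymptotics
open IsNilpotent (exp)

variable {ι F : Type*} [Fintype ι] {N : ℕ} {species : ι → Species F}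
  {sector : ι → Option (Fin N)} {K : ℝ} [DecidableEq ι] [DecidableEq F] [Fintype F]
  {flavor : Fin N → F} {σ : Fin N → ℤˣ}

/-! ### Operators with Wilson lines -/

/-- The exponent of a Wilson line as an element of the algebra. -/
def wilsonGen (g : ℝ) (X : OutState ι F) (q : ℤˣ) (n : Fin 4 → ℝ) : Gen ι :=
  Gen.mk (wilsonExponent g X q n)

theorem wilsonGen_empty (g : ℝ) (X : OutState ι F) (q : ℤˣ) (n : Fin 4 → ℝ) :
    wilsonGen g X q n ∅ = 0 := by
  rw [wilsonGen, Gen.mk_apply, wilsonExponent, currents_photon_empty, mdot_zero_right]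
  ring

theorem wilsonLine_eq (g : ℝ) (X : OutState ι F) (q : ℤˣ) (n : Fin 4 → ℝ) :
    wilsonLine g X q n = exp (wilsonGen g X q n) :=
  funext fun S => Gen.opExp_eq (wilsonGen_empty g X q n) S

/-- The factors `i` from the coupling and from the ray integral combine to the minus sign; up to the
charge this is the gauge function of the direction `n`. -/
theorem wilsonGen_apply (g : ℝ) (X : OutState ι F) (q : ℤˣ) (n : Fin 4 → ℝ) {T : Finset ι}
    (h : mdot n (totalMom X.mom T) ≠ 0) : wilsonGen g X q n T =
      -(((q : ℤ) : ℂ) * g) * (mdot (toC n) (currents g X T).photon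
        / ((mdot n (totalMom X.mom T) : ℝ) : ℂ)) := by
  rw [wilsonGen, Gen.mk_apply, wilsonExponent, rayIntegral_eq h]
  linear_combination (((q : ℤ) : ℂ) * g * mdot (toC n) (currents g X T).photon
    / ((mdot n (totalMom X.mom T) : ℝ) : ℂ)) * Complex.I_mul_I

theorem mdot_toC_tau_some (w : Config species sector K → Fin 4 → ℝ) (x : Config species sector K)
    (j : Fin N) (v : Fin 4 → ℂ) :
    mdot (toC (x.tau w (some j))) v = ((x.t j 0 : ℝ) : ℂ)⁻¹ * mdot (toC (x.t j)) v := by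
  simp only [tau_some, mdot, toC, Pi.smul_apply, smul_eq_mul]; push_cast; ring

/-- The field of a jet with its Wilson line is the field in the axial gauge. -/
theorem eventually_jetOperator (hK : 0 < K) (g : ℝ) (j : Fin N) (f : F) (s : ℤˣ) :
    ∀ᶠ x : Config species sector K in small,
      jetOperator g x.state f s (x.t j) (sectorSet sector (some j)) =
        gPhi g restFrame x f s (sectorSet sector (some j)) := by
  have h : ∀ᶠ x : Config species sector K in small, ∀ T : Finset ι, ∀ i ∈ T,
      sector i = some j → mdot (x.tau restFrame (some j)) (totalMom x.p T) ≠ 0 := by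
    simp only [Filter.eventually_all]
    exact fun T i hi hj => (ord_inv_tau hK restFrame hi hj).2
  filter_upwards [h] with x hx
  set J := sectorSet sector (some j) with hJ
  -- The Wilson line has charge `-s`, which cancels the sign in `wilsonGen_apply`, and the
  -- normalization of `t_j` drops out of the quotient. So the exponent is the gauge phase on the
  -- subsets of the jet.
  have hres : Gen.res J (wilsonGen g x.state (-s) (x.t j)) =
      Gen.res J ((((s : ℤ) : ℂ) * g) • gaugeFn g restFrame x) := by
    ext T
    rw [Gen.res_apply, Gen.res_apply]
    split_ifs with hT
    · rcases T.eq_empty_or_nonempty with rfl | hne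
      · rw [wilsonGen_empty, Gen.smul_apply, gaugeFn_empty, mul_zero]
      · obtain ⟨i, hi⟩ := hne
        have h1 := hx T i hi (mem_sectorSet.1 (hT hi))
        have ht : (x.t j 0 : ℂ) ≠ 0 := by exact_mod_cast (x.isDir j).pos.ne'
        rw [mdot_tau_some] at h1
        have h2 : mdot (x.t j) (totalMom x.p T) ≠ 0 := right_ne_zero_of_mul h1
        have h2' : ((mdot (x.t j) (totalMom x.p T) : ℝ) : ℂ) ≠ 0 := by exact_mod_cast h2
        rw [Gen.smul_apply, gaugeFn_of_subset ⟨i, hi⟩ hT, mdot_tau_some, mdot_toC_tau_some,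
          wilsonGen_apply g x.state (-s) (x.t j) h2, Units.val_neg]
        change _ * (_ / ((mdot (x.t j) (totalMom x.p T) : ℝ) : ℂ)) = _
        push_cast
        field_simp
    · rfl
  have h0 : ((((s : ℤ) : ℂ) * g) • gaugeFn g restFrame x) ∅ = 0 := by
    rw [Gen.smul_apply, gaugeFn_empty, mul_zero]
  have h1 : jetOperator g x.state f s (x.t j) J =
      (phi g x.state f s * exp (wilsonGen g x.state (-s) (x.t j))) J := by
    have h2 := Gen.prod_apply ![phi g x.state f s, exp (wilsonGen g x.state (-s) (x.t j))] J
    rw [Fin.prod_univ_two] at h2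
    refine Eq.trans ?_ h2.symm
    rw [jetOperator, wilsonLine_eq]
    congr 1
  rw [h1, ← Gen.res_apply_of_subset le_rfl (_ * _), map_mul, Gen.res_exp (wilsonGen_empty _ _ _ _),
    hres, ← Gen.res_exp h0, mul_comm, ← map_mul, Gen.res_apply_of_subset le_rfl]
  rfl

theorem sum_charges_eq_zero (hcontent : IsJetContent species sector flavor σ) :
    ∑ j, (σ j : ℤ) = 0 := by
  have h : ∑ f, ∑ j, (if flavor j = f then (σ j : ℤ) else 0) = 0 :=
    Finset.sum_eq_zero fun f _ => hcontent.neutral f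
  rw [Finset.sum_comm] at h
  simpa using h

/-- The product of the soft Wilson lines. -/
theorem softOperator_eq (hK : 0 < K) (g : ℝ) (hcontent : IsJetContent species sector flavor σ)
    (x : Config species sector K) :
    softOperator g x.state σ (jetDirection sector x.p) (sectorSet sector none) =
      (∏ j, softLine g j (σ j) x) (sectorSet sector none) := by
  set J := sectorSet sector none with hJ
  have h1 : softOperator g x.state σ (jetDirection sector x.p) J =
      (∏ j, exp (wilsonGen g x.state (σ j) (x.n j))) J := by
    refine Eq.trans ?_ (Gen.prod_apply _ J).symm
    rw [softOperator]
    congr 1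
    funext j
    exact wilsonLine_eq _ _ _ _
  have h2 : Gen.res J (∑ j, wilsonGen g x.state (σ j) (x.n j)) =
      ∑ j, (-(((σ j : ℤ) : ℂ) * g)) • softShift g j x := by
    have h3 : ∑ j, (-(((σ j : ℤ) : ℂ) * g)) • softShift g j x =
        Gen.res J (∑ j, (-(((σ j : ℤ) : ℂ) * g)) • gaugeFn g (fun x => x.n j) x) := by
      -- The total charge of the jets is zero, so the rest frame drops out of the product of the
      -- soft lines.
      have h4 : ∑ j, (-(((σ j : ℤ) : ℂ) * g)) • gaugeFn g restFrame x = 0 := by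
        rw [← Finset.sum_smul]
        have h5 : ∑ j, (-(((σ j : ℤ) : ℂ) * g)) = 0 := by
          rw [Finset.sum_neg_distrib, ← Finset.sum_mul]
          have h6 := sum_charges_eq_zero hcontent
          have h7 : ∑ j, ((σ j : ℤ) : ℂ) = 0 := by exact_mod_cast h6
          rw [h7, zero_mul, neg_zero]
        rw [h5, zero_smul]
      have h8 : ∑ j, (-(((σ j : ℤ) : ℂ) * g)) • softShift g j x =
          ∑ j, (-(((σ j : ℤ) : ℂ) * g)) • gaugeFn g (fun x => x.n j) x := by
        simp only [softShift, smul_sub, Finset.sum_sub_distrib]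
        rw [h4, sub_zero]
      rw [← h8, map_sum]
      refine Finset.sum_congr rfl fun j _ => ?_
      rw [map_smul, hJ, res_softShift]
    rw [h3]
    ext T
    rw [Gen.res_apply, Gen.res_apply]
    split_ifs with hT
    · rw [Gen.sum_apply, Gen.sum_apply]
      refine Finset.sum_congr rfl fun j _ => ?_
      rw [Gen.smul_apply]
      rcases T.eq_empty_or_nonempty with rfl | ⟨i, hi⟩
      · rw [wilsonGen_empty, gaugeFn_empty, mul_zero]
      · have h4 : mdot (x.n j) (totalMom x.p T) ≠ 0 :=
          (lt_of_lt_of_le (mul_pos (inv_pos.2 hK) (pow_pos x.lam_pos 2))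
            (x.n_mdot_soft_pos j hi (mem_sectorSet.1 (hT hi)))).ne'
        rw [gaugeFn_of_subset ⟨i, hi⟩ hT]
        exact wilsonGen_apply g x.state (σ j) (x.n j) h4
    · rfl
  have h0 : (∑ j, wilsonGen g x.state (σ j) (x.n j)) ∅ = 0 := by
    rw [Gen.sum_apply]
    exact Finset.sum_eq_zero fun j _ => wilsonGen_empty _ _ _ _
  rw [h1, ← Gen.exp_sum _ _ fun j => wilsonGen_empty _ _ _ _,
    ← Gen.res_apply_of_subset le_rfl (exp _), Gen.res_exp h0, h2,
    Gen.exp_sum _ _ fun j => smul_softShift_empty _ g j x]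
  rfl

/-! ### The hard-scattering operator -/

/-- The product of the matrix elements of the sectors, in the axial gauges. -/
def factorized (g : ℝ) (flavor : Fin N → F) (σ : Fin N → ℤˣ) (x : Config species sector K) : ℂ :=
  (∏ j, gPhi g restFrame x (flavor j) (σ j) (sectorSet sector (some j)))
    * (∏ j, softLine g j (σ j) x) (sectorSet sector none)

theorem flavorCharge_jet (hcontent : IsJetContent species sector flavor σ) (j : Fin N) :
    flavorCharge species (sectorSet sector (some j)) = unitCharge (flavor j) (σ j) :=
  funext fun f => hcontent.single_scalar j f

theorem jet_nonempty (hcontent : IsJetContent species sector flavor σ) (j : Fin N) :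
    (sectorSet sector (some j)).Nonempty := by
  rw [Finset.nonempty_iff_ne_empty]
  intro h
  have h1 := flavorCharge_jet hcontent j
  rw [h, flavorCharge_empty] at h1
  exact unitCharge_ne_zero _ _ h1.symm

-- If `h` misses a jet, no factor can absorb its particles. If `h` is bijective, the jet fields and
-- the collected soft lines live on different sectors and the product splits by `opProd_sector`; a
-- wrong flavour or charge makes the factor of that jet vanish.
open Classical in
theorem prod_jetField (hcontent : IsJetContent species sector flavor σ) (g : ℝ)
    {κ : Type*} [Fintype κ] (hκ : Fintype.card κ = N) (f : κ → F) (s : κ → ℤˣ) (h : κ → Fin N)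
    (x : Config species sector K) :
    (∏ k, jetField g (f k) (s k) (h k) x) Finset.univ =
      if h.Bijective ∧ ∀ k, flavor (h k) = f k ∧ σ (h k) = s k then factorized g flavor σ x
      else 0 := by
  by_cases hb : h.Bijective
  · set e := Equiv.ofBijective h hb with he
    set G : Option (Fin N) → Gen ι := fun o => o.elim (∏ k, softLine g (h k) (s k) x)
      fun j => Gen.res (sectorSet sector (some j)) (gPhi g restFrame x (f (e.symm j)) (s (e.symm j)))
      with hG
    have h1 : ∏ k, jetField g (f k) (s k) (h k) x = ∏ o, G o := by
      rw [Fintype.prod_option, ← e.prod_comp]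
      simp only [jetField, Finset.prod_mul_distrib, hG, Option.elim, Equiv.symm_apply_apply]
      rw [mul_comm]
      rfl
    have h2 : ∀ o T, (∃ i ∈ T, sector i ≠ o) → G o T = 0 := by
      rintro o T ⟨i, hi, ho⟩
      have hT : ¬T ⊆ sectorSet sector o := fun hT => ho (mem_sectorSet.1 (hT hi))
      cases o with
      | none =>
        have h3 : Gen.res (sectorSet sector none) (G none) = G none := by
          simp only [hG, Option.elim, map_prod, res_softLine]
        rw [← h3, Gen.res_apply, if_neg hT]
      | some j => exact if_neg hT
    have h3 : (∏ k, jetField g (f k) (s k) (h k) x) Finset.univ =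
        (∏ k, gPhi g restFrame x (f k) (s k) (sectorSet sector (some (h k))))
          * (∏ k, softLine g (h k) (s k) x) (sectorSet sector none) := by
      rw [h1]
      refine ((Gen.prod_apply G _).trans (opProd_sector sector (fun o => G o) h2)).trans ?_
      rw [Fintype.prod_option, ← e.prod_comp, mul_comm]
      congr 1
      refine Finset.prod_congr rfl fun k _ => ?_
      change Gen.res (sectorSet sector (some (h k))) (gPhi g restFrame x (f (e.symm (e k)))
        (s (e.symm (e k)))) (sectorSet sector (some (h k))) = _
      rw [Gen.res_apply_of_subset le_rfl, Equiv.symm_apply_apply]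
    rw [h3]
    split_ifs with hm
    · rw [factorized, ← e.prod_comp, ← e.prod_comp]
      simp only [← (hm.2 _).1, ← (hm.2 _).2]
      rfl
    · have hm' : ¬∀ k, flavor (h k) = f k ∧ σ (h k) = s k := fun h' => hm ⟨hb, h'⟩
      push Not at hm'
      obtain ⟨k, hk⟩ := hm'
      rw [Finset.prod_eq_zero (Finset.mem_univ k), zero_mul]
      refine gPhi_of_charge_ne fun hc => ?_
      rw [flavorCharge_jet hcontent] at hc
      obtain ⟨h4, h5⟩ := unitCharge_injective hc
      exact hk h4 h5
  · rw [if_neg fun h' => hb h'.1]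
    have hs : ¬h.Surjective := fun hs =>
      hb ((Fintype.bijective_iff_surjective_and_card h).2 ⟨hs, by rw [hκ, Fintype.card_fin]⟩)
    unfold Function.Surjective at hs
    push Not at hs
    obtain ⟨j, hj⟩ := hs
    obtain ⟨i, hi⟩ := jet_nonempty hcontent j
    have hi' := mem_sectorSet.1 hi
    refine (Gen.prod_apply _ _).trans (opProd_eq_zero (Finset.mem_univ i) fun k T hT => ?_)
    refine jetField_eq_zero g _ _ _ x ?_
    rintro ⟨_, hall⟩
    have h3 := hall i hT
    simp only [hi', Option.some.injEq, reduceCtorEq, or_false] at h3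
    exact hj k h3.symm

theorem sum_prod_jetField (hcontent : IsJetContent species sector flavor σ) (g : ℝ)
    {M : ℕ} (hM : N = M + M) (x : Config species sector K) :
    ∑ fl : Fin M → F, (∏ k : Fin M × ℤˣ, ∑ j, jetField g (fl k.1) k.2 j x) Finset.univ =
      (M.factorial * leadingOrder flavor σ : ℂ) * factorized g flavor σ x := by
  classical
  have hκ : Fintype.card (Fin M × ℤˣ) = N := by
    rw [Fintype.card_prod, Fintype.card_fin, Fintype.card_units_int, hM]; ring
  have h1 : ∀ fl : Fin M → F,
      (∏ k : Fin M × ℤˣ, ∑ j, jetField g (fl k.1) k.2 j x) Finset.univ =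
        ∑ h : Fin M × ℤˣ → Fin N, if h.Bijective ∧
          ∀ k, flavor (h k) = fl k.1 ∧ σ (h k) = k.2 then factorized g flavor σ x else 0 :=
    fun fl => by
      rw [Finset.prod_univ_sum, Fintype.piFinset_univ, Gen.sum_apply]
      exact Finset.sum_congr rfl fun h _ =>
        prod_jetField hcontent g hκ (fun k => fl k.1) (fun k => k.2) h x
  simp only [h1]
  rw [← Fintype.sum_prod_type' (f := fun (fl : Fin M → F) (h : Fin M × ℤˣ → Fin N) =>
    if h.Bijective ∧ ∀ k, flavor (h k) = fl k.1 ∧ σ (h k) = k.2 then factorized g flavor σ x else 0),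
    ← Finset.sum_filter, Finset.sum_const, nsmul_eq_mul]
  congr 1
  have h2 := card_contraction hcontent.neutral hM
  rw [← Nat.cast_mul, ← h2]
  congr 1
  rw [← Fintype.card_subtype]
  exact Fintype.card_congr (Equiv.refl _)

/-- Each pair `φ_f^* φ_f` is gauge invariant, so the hard operator can be computed in the axial
gauges. -/
theorem hardOperator_eq (g : ℝ) (x : Config species sector K) :
    hardOperator N g x.state Finset.univ = (1 / ((N / 2).factorial : ℂ)) *
      ∑ fl : Fin (N / 2) → F, (∏ k : Fin (N / 2) × ℤˣ, gPhi g restFrame x (fl k.1) k.2)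
        Finset.univ := by
  rw [hardOperator]
  congr 1
  refine Finset.sum_congr rfl fun fl _ => ?_
  have h1 : ∏ k : Fin (N / 2) × ℤˣ, gPhi g restFrame x (fl k.1) k.2 =
      ∏ k : Fin (N / 2) × ℤˣ, phi g x.state (fl k.1) k.2 := by
    rw [Fintype.prod_prod_type, Fintype.prod_prod_type]
    refine Finset.prod_congr rfl fun a _ => ?_
    have h2 : (Finset.univ : Finset ℤˣ) = {1, -1} := rfl
    rw [h2, Finset.prod_pair (by decide), Finset.prod_pair (by decide)]
    exact gaugePhi_mul g gaugeFn_empty _ _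
  rw [h1]
  exact (Gen.prod_apply _ _).symm

/-- Factorization in the axial gauges. -/
theorem ord_hardOperator_sub (hK : 0 < K) (g : ℝ) (hN : Even N)
    (hcontent : IsJetContent species sector flavor σ) :
    Ord (fun x : Config species sector K => hardOperator N g x.state Finset.univ
      - leadingOrder flavor σ * factorized g flavor σ x) (N + 1 - wt sector Finset.univ) := by
  have hM : N = N / 2 + N / 2 := by obtain ⟨m, hm⟩ := hN; omega
  have hcard : ((Finset.univ : Finset (Fin (N / 2) × ℤˣ)).card : ℤ) = N := by
    rw [Finset.card_univ, Fintype.card_prod, Fintype.card_fin, Fintype.card_units_int]; omega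
  have h1 : ∀ fl : Fin (N / 2) → F, Ord (fun x : Config species sector K =>
      (∏ k : Fin (N / 2) × ℤˣ, gPhi g restFrame x (fl k.1) k.2
        - ∏ k : Fin (N / 2) × ℤˣ, ∑ j, jetField g (fl k.1) k.2 j x) Finset.univ)
      (N + 1 - wt sector Finset.univ) := fun fl => by
    rw [← hcard]
    refine (GOrd.prod_sub_prod (Finset.univ : Finset (Fin (N / 2) × ℤˣ))
      (f := fun k x => gPhi g restFrame x (fl k.1) k.2)
      (h := fun k x => ∑ j, jetField g (fl k.1) k.2 j x)
      (fun k _ => gOrd_gPhi hK g _ _) (fun k _ => ?_)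
      (fun k _ => gOrd_gPhi_sub hK g _ _)).2 Finset.univ
    -- The sum of the jet fields inherits its size `lam` from the full field and from the difference
    -- of the two.
    have := (gOrd_gPhi (species := species) (sector := sector) hK g (fl k.1) k.2).sub
      ((gOrd_gPhi_sub hK g (fl k.1) k.2).mono (b := 1) (by omega))
    simpa only [sub_sub_cancel] using this
  refine ((Ord.sum fun fl (_ : fl ∈ Finset.univ) => h1 fl).const_mul
    (1 / ((N / 2).factorial : ℂ))).congr (Eventually.of_forall fun x => ?_)
  have h2 : ((N / 2).factorial : ℂ) ≠ 0 := by exact_mod_cast Nat.factorial_ne_zero _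
  have h3 := sum_prod_jetField hcontent g hM x
  simp only [Gen.sub_apply]
  rw [hardOperator_eq, Finset.sum_sub_distrib, h3]
  field_simp

/-- Factorization for the configurations with a small power-counting parameter. -/
theorem ord_factorization (hK : 0 < K) (g : ℝ) (hN : Even N)
    (hcontent : IsJetContent species sector flavor σ) :
    Ord (fun x : Config species sector K => hardOperator N g x.state Finset.univ
      - (leadingOrder flavor σ : ℂ)
        * (∏ j, jetOperator g x.state (flavor j) (σ j) (x.t j) (sectorSet sector (some j)))
        * softOperator g x.state σ (jetDirection sector x.p) (sectorSet sector none))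
      (1 - leadingPower sector) := by
  -- `leadingPower` is the total weight minus one for each jet; the `N` charged fields supply
  -- exactly these `N` powers.
  have h1 : (N : ℤ) + 1 - wt sector Finset.univ = 1 - leadingPower sector := by
    have h2 : wt sector Finset.univ = (∑ j, ((sectorSet sector (some j)).card : ℤ))
        + 2 * ((sectorSet sector none).card : ℤ) := by
      rw [wt, ← Finset.sum_fiberwise (s := Finset.univ) (g := sector), Fintype.sum_option, add_comm]
      congr 1
      · refine Finset.sum_congr rfl fun j _ => ?_
        rw [Finset.sum_congr rfl fun i hi => if_neg (by
          rw [(Finset.mem_filter.1 hi).2]; simp)]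
        simp [sectorSet]
      · rw [Finset.sum_congr rfl fun i hi => if_pos (Finset.mem_filter.1 hi).2]
        simp [sectorSet, mul_comm]
    rw [h2, leadingPower]; ring
  rw [← h1]
  refine (ord_hardOperator_sub hK g hN hcontent).congr ?_
  have h3 : ∀ᶠ x : Config species sector K in small, ∀ j,
      jetOperator g x.state (flavor j) (σ j) (x.t j) (sectorSet sector (some j)) =
        gPhi g restFrame x (flavor j) (σ j) (sectorSet sector (some j)) := by
    simp only [Filter.eventually_all]
    exact fun j => eventually_jetOperator hK g j _ _
  filter_upwards [h3] with x hx
  rw [factorized, softOperator_eq hK g hcontent x, Finset.prod_congr rfl fun j _ => hx j, mul_assoc]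

end Config
end ScalarQED
end

/-! ### Uniform constants from the asymptotic statement -/

open ScalarQED
theorem mainTheorem2 {ι F : Type*} [Fintype ι] [DecidableEq ι] [Fintype F] [DecidableEq F]
    (g : ℝ) (N : ℕ) (hN : Even N)
    (species : ι → Species F) (sector : ι → Option (Fin N))
    (flavor : Fin N → F) (σ : Fin N → ℤˣ) (hcontent : IsJetContent species sector flavor σ)
    (K : ℝ) (hK : 0 < K) :
    ∃ C lam₀ : ℝ, 0 < lam₀ ∧ ∀ lam : ℝ, 0 < lam → lam ≤ lam₀ →
      ∀ (p : ι → Fin 4 → ℝ) (ref : ι → Fin 4 → ℝ) (pol : ι → Fin 4 → ℂ)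
        (t : Fin N → Fin 4 → ℝ),
        IsNJetKinematics species sector K lam p →
        (∀ i, species i = .photon → IsPolarization (p i) (ref i) (pol i)) →
        (∀ j, IsWilsonDirection K (jetDirection sector p j) (t j)) →
        ‖hardOperator N g ⟨species, p, pol⟩ Finset.univ
            - (leadingOrder flavor σ : ℂ)
              * (∏ j, jetOperator g ⟨species, p, pol⟩ (flavor j) (σ j) (t j)
                  (sectorSet sector (some j)))
              * softOperator g ⟨species, p, pol⟩ σ (jetDirection sector p)
                  (sectorSet sector none)‖
          ≤ C * lam ^ (1 - leadingPower sector) := by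
  -- A configuration contains all momenta, polarizations, reference vectors and Wilson directions,
  -- so one constant serves them all.
  obtain ⟨C, hC⟩ :=
    (Config.ord_factorization (species := species) (sector := sector) hK g hN hcontent).bound
  rw [Config.small, Filter.eventually_comap] at hC
  -- A right neighbourhood of `0` contains some `(0, l]`, and by the definition of the pulled-back
  -- filter the bound holds for every configuration with `lam` in it.
  obtain ⟨l, hl, hsub⟩ := mem_nhdsGT_iff_exists_Ioc_subset.1 hC
  refine ⟨C, l, hl, fun lam h0 hlam p ref pol t hkin hpol ht => ?_⟩
  have h := hsub ⟨h0, hlam⟩ ⟨lam, p, ref, pol, t, h0, hkin, hpol, ht⟩ rfl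
  rwa [Real.norm_of_nonneg (zpow_nonneg h0.le _)] at h
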